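/- For $N\ge 1$ let $\Gamma_N$ be the star graph consisting of $N$ half-lines $[0,\infty)$ with their endpoints $0$ identified (the vertex), equipped with Lebesgue measure on each edge. Let $X$ be $\mathbb R$ or $\Gamma_N$. The space $H^1(\Gamma_N)$ consists of the functions $\psi$ on $\Gamma_N$ whose restrictions to the $N$ edges belong to $H^1(0,\infty)$ and have a common value at the vertex. For a potential $V:X\to\mathbb R$ with $V_-\in L_p(X)$ for some $1\le p<\infty$ and $V_+\in L_1^{\rm loc}(X)$, let $H_V=-\frac{d^2}{dx^2}+V$ be the self-adjoint operator in $L_2(X)$ associated with the lower semibounded closed quadratic form $$h[\psi]=\int_X\left(|\psi'|^2+V|\psi|^2\right)dx,\qquad \psi\in H^1(X)\cap L_2(X,V_+\,dx),$$ and let $\operatorname{tr}(H_V)_-^\gamma$ be the sum of $|E|^\gamma$ over the negative eigenvalues $E$ of $H_V$, counted with multiplicities. A potential on $\Gamma_N$ is called radial if $V(x)$ depends only on the distance of $x$ from the vertex. Let $L_\gamma\in[0,\infty]$ be the optimal (smallest possible) constant such that $$\operatorname{tr}(H_V)_-^\gamma\le L_\gamma\int_{\mathbb R}V_-^{\gamma+1/2}\,dx$$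 for all such potentials $V$ on $X=\mathbb R$, and let $L^{(\rm rad)}_{\gamma,N}\in[0,\infty]$ be the optimal constant such that $$\operatorname{tr}(H_V)_-^\gamma\le L^{(\rm rad)}_{\gamma,N}\int_{\Gamma_N}V_-^{\gamma+1/2}\,dx$$ for all such radial potentials $V$ on $X=\Gamma_N$. Theorem. For every $\gamma\ge 1/2$ and every integer $N\ge 2$, $$L^{(\rm rad)}_{\gamma,N}=L_\gamma .$$ -/

import Mathlib

open MeasureTheory Set
open scoped ENNReal ComplexConjugate

noncomputable section

/-! ### Schrödinger operators defined through quadratic forms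

`X` is the real line or a star graph, with its Lebesgue measure `μ`. The Sobolev space `H¹(X)` is
represented by the graph `D` of the derivative, i.e. by the set of pairs `(ψ, ψ')` in
`L² × L²` such that `ψ` is in `H¹(X)` with derivative `ψ'`. -/

section Schrodinger

variable {X : Type*} [TopologicalSpace X] [MeasurableSpace X] (μ : Measure X)

/-- The potentials for which the Schrödinger operator is defined:
`V₋ ∈ L_p` for some `1 ≤ p < ∞` and `V₊ ∈ L_1^loc`. -/
def IsAdmissiblePotential (V : X → ℝ) : Prop :=
  (∃ p : ℝ≥0∞, 1 ≤ p ∧ p ≠ ∞ ∧ MemLp (fun x => (V x)⁻) p μ) ∧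
    LocallyIntegrable (fun x => (V x)⁺) μ

variable {μ}

/-- Pairs `(ψ, ψ')` with `ψ` in the form domain `H¹(X) ∩ L²(X, V₊ dx)`. -/
def formDomain (D : Set (Lp ℂ 2 μ × Lp ℂ 2 μ)) (V : X → ℝ) : Set (Lp ℂ 2 μ × Lp ℂ 2 μ) :=
  {u | u ∈ D ∧ Integrable (fun x => (V x)⁺ * ‖u.1 x‖ ^ 2) μ}

/-- The sesquilinear form `h[φ, ψ] = ∫ (conj φ' ψ' + V conj φ ψ) dx`, for `u = (φ, φ')` and
`w = (ψ, ψ')`. -/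
def schrodingerForm (V : X → ℝ) (u w : Lp ℂ 2 μ × Lp ℂ 2 μ) : ℂ :=
  (∫ x, conj (u.2 x) * w.2 x ∂μ) + ∫ x, (V x : ℂ) * (conj (u.1 x) * w.1 x) ∂μ

/-- The (graph of the) operator `H = -d²/dx² + V` associated with the form: `ψ` is in the domain
of `H` and `H ψ = f` iff `ψ` is in the form domain and `h[φ, ψ] = ⟨φ, f⟩` for every `φ` in the
form domain. -/
def IsSchrodingerImage (D : Set (Lp ℂ 2 μ × Lp ℂ 2 μ)) (V : X → ℝ) (ψ f : Lp ℂ 2 μ) : Prop :=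
  ∃ ψ' : Lp ℂ 2 μ, (ψ, ψ') ∈ formDomain D V ∧
    ∀ u ∈ formDomain D V, schrodingerForm V u (ψ, ψ') = inner ℂ u.1 f

/-- The multiplicity of `E` as an eigenvalue of `H` (zero if `E` is not an eigenvalue): the
dimension of the space of all `ψ` with `H ψ = E ψ`. -/
def eigenMultiplicity (D : Set (Lp ℂ 2 μ × Lp ℂ 2 μ)) (V : X → ℝ) (E : ℝ) : ℕ∞ :=
  Cardinal.toENat
    (Module.rank ℂ (Submodule.span ℂ {ψ : Lp ℂ 2 μ | IsSchrodingerImage D V ψ ((E : ℂ) • ψ)}))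

/-- `tr H₋^γ`: the sum of `|E|^γ` over the negative eigenvalues `E` of `H`, counted with
multiplicities. -/
def negTrace (D : Set (Lp ℂ 2 μ × Lp ℂ 2 μ)) (V : X → ℝ) (γ : ℝ) : ℝ≥0∞ :=
  ∑' E : Iio (0 : ℝ), (eigenMultiplicity D V E : ℝ≥0∞) * ENNReal.ofReal (|(E : ℝ)| ^ γ)

/-- The optimal (smallest possible) constant `C` in
`tr H₋^γ ≤ C ∫ V₋^(γ+1/2) dx`, where `V` runs over the admissible potentials in the class `P`. -/
def optimalConst (D : Set (Lp ℂ 2 μ × Lp ℂ 2 μ)) (P : (X → ℝ) → Prop) (γ : ℝ) : ℝ≥0∞ :=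
  sInf {C : ℝ≥0∞ | ∀ V : X → ℝ, IsAdmissiblePotential μ V → P V →
    negTrace D V γ ≤ C * ∫⁻ x, ENNReal.ofReal ((V x)⁻ ^ (γ + 1 / 2)) ∂μ}

end Schrodinger

/-! ### The real line -/

/-- `H¹(ℝ)`: pairs `(ψ, ψ')` in `L²(ℝ) × L²(ℝ)` such that `ψ` has an (absolutely continuous)
representative which is an antiderivative of `ψ'`. -/
def sobolevLine : Set (Lp ℂ 2 (volume : Measure ℝ) × Lp ℂ 2 (volume : Measure ℝ)) :=
  {u | ∃ c : ℂ, ∀ᵐ x : ℝ, u.1 x = c + ∫ t in (0 : ℝ)..x, u.2 t}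

/-- The optimal constant `L_γ` of the Lieb–Thirring inequality on `ℝ`. -/
def lineConst (γ : ℝ) : ℝ≥0∞ :=
  optimalConst sobolevLine (fun _ => True) γ

/-! ### The star graph `Γ_N` -/

/-- Lebesgue measure on `Γ_N`: the point at distance `x > 0` from the vertex on the edge `j` is
`(j, x)`, and the measure does not charge any other pair `(j, x)`, nor does it see the vertex. -/
def starMeasure (N : ℕ) : Measure (Fin N × ℝ) :=
  Measure.count.prod (volume.restrict (Ioi 0))

/-- `H¹(Γ_N)`: pairs `(ψ, ψ')` in `L²(Γ_N) × L²(Γ_N)` such that on every edge `ψ` has an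
(absolutely continuous) representative which is an antiderivative of `ψ'`, and the values `c` of
these representatives at the vertex coincide. -/
def sobolevStar (N : ℕ) : Set (Lp ℂ 2 (starMeasure N) × Lp ℂ 2 (starMeasure N)) :=
  {u | ∃ c : ℂ, ∀ j : Fin N, ∀ᵐ x ∂(volume.restrict (Ioi (0 : ℝ))),
    u.1 (j, x) = c + ∫ t in (0 : ℝ)..x, u.2 (j, t)}

/-- `V(x)` depends only on the distance of `x` from the vertex. -/
def IsRadial {N : ℕ} (V : Fin N × ℝ → ℝ) : Prop :=
  ∀ j k : Fin N, ∀ x : ℝ, 0 < x → V (j, x) = V (k, x)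

/-- The optimal constant of the Lieb–Thirring inequality on `Γ_N` for radial potentials. -/
def starRadialConst (γ : ℝ) (N : ℕ) : ℝ≥0∞ :=
  optimalConst (sobolevStar N) IsRadial γ

end

/-! For a fixed constant C, the bound on the line and the bound for radial potentials on the star
imply each other. The two sets of valid constants therefore coincide, and so do their infima, finite
or not.

From the line to the star (`star_bound_of_line_bound`). Let V be radial with profile f. The sum of
an eigenfunction over all edges is a Neumann eigenfunction on the half-line; the differences between
edges vanish at the vertex and are Dirichlet eigenfunctions. With n and d the Neumann and Dirichlet
traces on the half-line, this gives tr(star) ≤ n + (N-1)d (`eigenMult_star_le`). Even and odd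
extension give n + d ≤ tr(line) for the potential f(|x|) (`eigenMult_line_ge`), and d ≤ n by the
variational principle. Since N(n + d) exceeds 2(n + (N-1)d) by (N-2)(n-d), it follows that 2
tr(star) ≤ N tr(line). The integrals over star and line are N and 2 times the half-line integral, so
C is preserved.

From the star to the line (`line_bound_of_star_bound`). Move V to the right by n and put it on every
edge. Eigenfunctions of the line, cut off near the vertex, provide N mutually orthogonal copies of
each trial space. As n grows, every level has at least N times as many star eigenvalues below it as
a slightly lower level has line eigenvalues, while the integral of the potential is at most N times
the original. Fatou's lemma for the counting functions, followed by closing the gap between the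
levels, gives the bound with the same C.

Counting rests on one half of the min-max principle (`card_le_weightBelow`), needed on star graphs
only; on the line, only given eigenvectors are used. Encoding a function as the quadruple (ψ, ψ',
√V₊ ψ, √V₋ ψ) makes the form continuous and its domain a closed subspace of a Hilbert space power.
Below a negative level the form is coercive up to finitely many functionals
(`isCoerciveBelow_star`), because V₋ is form compact (`exists_lintegral_mul_sq_le`). Hence
minimizers exist (`exists_groundState`). The layer cake formula (`tsum_mul_abs_rpow_eq_lintegral`)
turns counts into traces. -/

open Filter Topology

noncomputable section

/-! ### Closed Hermitian forms and their negative eigenvalues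

A vector of the form domain of `-d²/dx² + V` is represented by the quadruple
`(ψ, ψ', √V₊ ψ, √V₋ ψ)`. -/

section AbstractForm

variable {H : Type*} [NormedAddCommGroup H] [InnerProductSpace ℂ H]

/-- The form `h[u, w] - E ⟨u, w⟩` on quadruples `(ψ, ψ', √V₊ ψ, √V₋ ψ)`. -/
def shiftedForm (H : Type*) [NormedAddCommGroup H] [InnerProductSpace ℂ H] (E : ℝ) :
    (H × H × H × H) →ₗ⋆[ℂ] (H × H × H × H) →ₗ[ℂ] ℂ :=
  LinearMap.mk₂'ₛₗ (starRingEnd ℂ) (RingHom.id ℂ)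
    (fun u w => inner ℂ u.2.1 w.2.1 + inner ℂ u.2.2.1 w.2.2.1 - inner ℂ u.2.2.2 w.2.2.2
      - (E : ℂ) * inner ℂ u.1 w.1)
    (by intro a b c; simp only [Prod.fst_add, Prod.snd_add, inner_add_left]; ring)
    (by intro a b c; simp only [Prod.smul_fst, Prod.smul_snd, inner_smul_left, smul_eq_mul]; ring)
    (by intro a b c; simp only [Prod.fst_add, Prod.snd_add, inner_add_right]; ring)
    (by
      intro a b c
      simp only [Prod.smul_fst, Prod.smul_snd, inner_smul_right, smul_eq_mul, RingHom.id_apply]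
      ring)

lemma shiftedForm_apply (E : ℝ) (u w : H × H × H × H) :
    shiftedForm H E u w = inner ℂ u.2.1 w.2.1 + inner ℂ u.2.2.1 w.2.2.1
      - inner ℂ u.2.2.2 w.2.2.2 - (E : ℂ) * inner ℂ u.1 w.1 := rfl

lemma shiftedForm_eq_add (E E' : ℝ) (u w : H × H × H × H) :
    shiftedForm H E u w = shiftedForm H E' u w + ((E' : ℂ) - E) * inner ℂ u.1 w.1 := by
  simp only [shiftedForm_apply]; ring

lemma shiftedForm_conj_symm (E : ℝ) (u w : H × H × H × H) :
    conj (shiftedForm H E w u) = shiftedForm H E u w := by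
  simp [shiftedForm_apply, inner_conj_symm]

lemma shiftedForm_self_re (E : ℝ) (u : H × H × H × H) :
    (shiftedForm H E u u).re
      = ‖u.2.1‖ ^ 2 + ‖u.2.2.1‖ ^ 2 - ‖u.2.2.2‖ ^ 2 - E * ‖u.1‖ ^ 2 := by
  have h (x : H) : inner ℂ x x = ((‖x‖ ^ 2 : ℝ) : ℂ) := by
    rw [inner_self_eq_norm_sq_to_K]; norm_cast
  simp only [shiftedForm_apply, h]
  norm_cast

lemma shiftedForm_self_re_shift (E E' : ℝ) (u : H × H × H × H) :
    (shiftedForm H E u u).re = (shiftedForm H E' u u).re + (E' - E) * ‖u.1‖ ^ 2 := by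
  simp only [shiftedForm_self_re]; ring

lemma shiftedForm_smul_self_re (E : ℝ) (z : ℂ) (u : H × H × H × H) :
    (shiftedForm H E (z • u) (z • u)).re = ‖z‖ ^ 2 * (shiftedForm H E u u).re := by
  simp only [shiftedForm_self_re, Prod.smul_fst, Prod.smul_snd, norm_smul]; ring

lemma shiftedForm_add_self_re (E : ℝ) (u v : H × H × H × H) :
    (shiftedForm H E (u + v) (u + v)).re = (shiftedForm H E u u).re + (shiftedForm H E v v).re
      + 2 * (shiftedForm H E u v).re := by
  have h : (shiftedForm H E v u).re = (shiftedForm H E u v).re := by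
    rw [← shiftedForm_conj_symm E v u, Complex.conj_re]
  simp only [map_add, LinearMap.add_apply, Complex.add_re, h]; ring

/-- Makes minimizing sequences Cauchy: if the form is nonnegative, two almost-minimizers have a
small form on their difference. -/
lemma shiftedForm_parallelogram (E : ℝ) (u v : H × H × H × H) :
    (shiftedForm H E (u - v) (u - v)).re = 2 * (shiftedForm H E u u).re
      + 2 * (shiftedForm H E v v).re - (shiftedForm H E (u + v) (u + v)).re := by
  simp only [map_add, map_sub, LinearMap.add_apply, LinearMap.sub_apply, Complex.add_re,
    Complex.sub_re]; ring

lemma continuous_shiftedForm_self_re (E : ℝ) :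
    Continuous fun u : H × H × H × H => (shiftedForm H E u u).re := by
  simp only [shiftedForm_self_re]; fun_prop

/-- Vectors `w` of the form domain `Q` which solve the eigenvalue equation with eigenvalue `E`. -/
def eigenLift (Q : Submodule ℂ (H × H × H × H)) (E : ℝ) : Submodule ℂ (H × H × H × H) where
  carrier := {w | w ∈ Q ∧ ∀ u ∈ Q, shiftedForm H E u w = 0}
  add_mem' := fun ha hb => ⟨Q.add_mem ha.1 hb.1, fun u hu => by simp [ha.2 u hu, hb.2 u hu]⟩
  zero_mem' := ⟨Q.zero_mem, fun u _ => by simp⟩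
  smul_mem' := fun c x hx => ⟨Q.smul_mem c hx.1, fun u hu => by simp [hx.2 u hu]⟩

/-- The eigenspace of the operator associated with the form on `Q`. -/
def eigenspaceOf (Q : Submodule ℂ (H × H × H × H)) (E : ℝ) : Submodule ℂ H :=
  (eigenLift Q E).map (LinearMap.fst ℂ H (H × H × H))

lemma mem_eigenspaceOf {Q : Submodule ℂ (H × H × H × H)} {E : ℝ} {ψ : H} :
    ψ ∈ eigenspaceOf Q E ↔ ∃ w ∈ Q, w.1 = ψ ∧ ∀ u ∈ Q, shiftedForm H E u w = 0 := by
  simp only [eigenspaceOf, Submodule.mem_map]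
  constructor
  · rintro ⟨w, ⟨h1, h2⟩, h3⟩; exact ⟨w, h1, h3, h2⟩
  · rintro ⟨w, h1, h3, h2⟩; exact ⟨w, ⟨h1, h2⟩, h3⟩

/-- The multiplicity of `E` as an eigenvalue of the operator associated with the form on `Q`. -/
def eigenMult (Q : Submodule ℂ (H × H × H × H)) (E : ℝ) : ℕ∞ :=
  Cardinal.toENat (Module.rank ℂ (eigenspaceOf Q E))

/-- The total weight of `(-∞, E]`. -/
def weightBelow (m : ℝ → ℕ∞) (E : ℝ) : ℝ≥0∞ :=
  ∑' x : ℝ, (Iic E).indicator (fun x => (m x : ℝ≥0∞)) x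

/-- Below `E`, the form is coercive up to finitely many bounded functionals. -/
def IsCoerciveBelow (Q : Submodule ℂ (H × H × H × H)) (E : ℝ) : Prop :=
  ∃ (c C : ℝ) (m : ℕ) (g : Fin m → H), 0 < c ∧ 0 ≤ C ∧ ∀ w ∈ Q,
    c * (‖w.1‖ ^ 2 + ‖w.2.1‖ ^ 2 + ‖w.2.2.1‖ ^ 2 + ‖w.2.2.2‖ ^ 2)
      ≤ (shiftedForm H E w w).re + C * ∑ i, ‖(inner ℂ (g i) w.1 : ℂ)‖ ^ 2

lemma IsCoerciveBelow.mono {Q P : Submodule ℂ (H × H × H × H)} {E : ℝ} (h : IsCoerciveBelow Q E)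
    (hP : P ≤ Q) : IsCoerciveBelow P E := by
  obtain ⟨c, C, m, g, hc, hC, h⟩ := h
  exact ⟨c, C, m, g, hc, hC, fun w hw => h w (hP hw)⟩

/-- The correcting functionals see only the first component, so coercivity makes the form
nonnegative where that component vanishes. This gives independence in L² of trial vectors on which
the form is negative. -/
lemma IsCoerciveBelow.fst_ne_zero {Q : Submodule ℂ (H × H × H × H)} {E : ℝ}
    (h : IsCoerciveBelow Q E) {w : H × H × H × H} (hw : w ∈ Q)
    (hlt : (shiftedForm H E w w).re < 0) : w.1 ≠ 0 := by
  intro h0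
  obtain ⟨c, C, m, g, hc, hC, h⟩ := h
  have := h w hw
  simp only [h0, inner_zero_right, norm_zero] at this
  have h2 : 0 ≤ c * (0 ^ 2 + ‖w.2.1‖ ^ 2 + ‖w.2.2.1‖ ^ 2 + ‖w.2.2.2‖ ^ 2) := by positivity
  simp at this h2
  linarith

/-- A nonnegative form vanishes against the vectors on which its quadratic form vanishes. -/
lemma shiftedForm_eq_zero_of_nonneg {P : Submodule ℂ (H × H × H × H)} {E : ℝ}
    (hP : ∀ w ∈ P, 0 ≤ (shiftedForm H E w w).re) {u : H × H × H × H} (hu : u ∈ P)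
    (hu0 : (shiftedForm H E u u).re = 0) {v : H × H × H × H} (hv : v ∈ P) :
    shiftedForm H E v u = 0 := by
  have key : ∀ v ∈ P, (shiftedForm H E v u).re = 0 := by
    intro v hv
    have h (t : ℝ) : 0 ≤ t ^ 2 * (shiftedForm H E v v).re + 2 * t * (shiftedForm H E v u).re := by
      have := hP _ (P.add_mem (P.smul_mem (t : ℂ) hv) hu)
      rw [shiftedForm_add_self_re, shiftedForm_smul_self_re, hu0] at this
      simp only [map_smulₛₗ, LinearMap.smul_apply, smul_eq_mul, Complex.conj_ofReal,
        Complex.re_ofReal_mul, Complex.norm_real, Real.norm_eq_abs, sq_abs] at this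
      linarith
    set A := (shiftedForm H E v v).re
    set B := (shiftedForm H E v u).re
    have hA : 0 ≤ A := hP v hv
    -- A near-minimizer of the quadratic in t; the `+ 1` keeps the denominator positive when A = 0.
    have h1 := h (-B / (A + 1))
    have h2 : (-B / (A + 1)) ^ 2 * A + 2 * (-B / (A + 1)) * B
        = - (B ^ 2 * (A + 2) / (A + 1) ^ 2) := by
      field_simp; ring
    rw [h2] at h1
    have h3 : B ^ 2 * (A + 2) / (A + 1) ^ 2 ≤ 0 := by linarith
    rw [div_le_iff₀ (by positivity), zero_mul] at h3
    have h4 : B ^ 2 ≤ 0 := by nlinarith [sq_nonneg B]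
    exact pow_eq_zero_iff (two_ne_zero) |>.1 (le_antisymm h4 (sq_nonneg B))
  refine Complex.ext (key v hv) ?_
  -- The form is conjugate linear on the left, so testing with iv exposes the imaginary part.
  have := key _ (P.smul_mem Complex.I hv)
  simpa [map_smulₛₗ] using this

/-- Existence of a ground state below the level `E`, on a closed subspace. -/
lemma exists_groundState [CompleteSpace H] {P : Submodule ℂ (H × H × H × H)}
    (hP : IsClosed (P : Set (H × H × H × H))) {E : ℝ} (hE : IsCoerciveBelow P E)
    {w₀ : H × H × H × H} (hw₀ : w₀ ∈ P) (hw₀0 : w₀.1 ≠ 0)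
    (hw₀E : (shiftedForm H E w₀ w₀).re ≤ 0) :
    ∃ E' ≤ E, ∃ u ∈ P, u.1 ≠ 0 ∧ ∀ v ∈ P, shiftedForm H E' v u = 0 := by
  obtain ⟨c, C, m, g, hc, hC, hco⟩ := hE
  -- The values of the Rayleigh quotient on P; its infimum will be the eigenvalue E'.
  set A : Set ℝ := {r | ∃ w ∈ P, ‖w.1‖ = 1 ∧ (shiftedForm H 0 w w).re = r} with hA
  have normalize : ∀ w ∈ P, w.1 ≠ 0 → (shiftedForm H 0 w w).re / ‖w.1‖ ^ 2 ∈ A := by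
    intro w hw h0
    refine ⟨((‖w.1‖⁻¹ : ℝ) : ℂ) • w, P.smul_mem _ hw, ?_, ?_⟩
    · rw [Prod.smul_fst, norm_smul]; simp [h0]
    · rw [shiftedForm_smul_self_re]; simp; field_simp
  have hbdd : BddBelow A := by
    refine ⟨E - C * ∑ i, ‖g i‖ ^ 2, ?_⟩
    rintro r ⟨w, hw, hw1, rfl⟩
    have h1 := hco w hw
    have h2 : 0 ≤ c * (‖w.1‖ ^ 2 + ‖w.2.1‖ ^ 2 + ‖w.2.2.1‖ ^ 2 + ‖w.2.2.2‖ ^ 2) := by positivity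
    have h3 : ∑ i, ‖(inner ℂ (g i) w.1 : ℂ)‖ ^ 2 ≤ ∑ i, ‖g i‖ ^ 2 := by
      refine Finset.sum_le_sum fun i _ => ?_
      have := norm_inner_le_norm (𝕜 := ℂ) (g i) w.1
      rw [hw1, mul_one] at this
      gcongr
    have h4 := mul_le_mul_of_nonneg_left h3 hC
    rw [shiftedForm_self_re_shift E 0, hw1] at h1
    rw [hw1] at h2
    linarith
  set E' := sInf A with hE'
  have hnonneg : ∀ w ∈ P, 0 ≤ (shiftedForm H E' w w).re := by
    intro w hw
    -- Vectors with zero first component cannot be normalized; for them coercivity itself gives the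
    -- sign.
    by_cases h0 : w.1 = 0
    · have h1 := hco w hw
      have h2 : 0 ≤ c * (‖w.1‖ ^ 2 + ‖w.2.1‖ ^ 2 + ‖w.2.2.1‖ ^ 2 + ‖w.2.2.2‖ ^ 2) := by positivity
      simp only [h0, inner_zero_right, norm_zero] at h1 h2
      rw [shiftedForm_self_re_shift E' E, h0]
      simp at h1 h2 ⊢
      linarith
    · have h1 := csInf_le hbdd (normalize w hw h0)
      have h2 : 0 < ‖w.1‖ ^ 2 := by positivity
      rw [← hE', le_div_iff₀ h2] at h1
      rw [shiftedForm_self_re_shift E' 0]; linarith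
  have hE'E : E' ≤ E := by
    refine (csInf_le hbdd (normalize w₀ hw₀ hw₀0)).trans ?_
    rw [div_le_iff₀ (by positivity)]
    rw [shiftedForm_self_re_shift E 0] at hw₀E; linarith
  have hseq (n : ℕ) : ∃ w ∈ P, ‖w.1‖ = 1 ∧ (shiftedForm H E' w w).re < 1 / ((n : ℝ) + 1) := by
    obtain ⟨r, ⟨w, hw, hw1, rfl⟩, hlt⟩ := exists_lt_of_csInf_lt (s := A) ⟨_, normalize w₀ hw₀ hw₀0⟩
      (show sInf A < E' + 1 / ((n : ℝ) + 1) by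
        rw [← hE']; linarith [Nat.one_div_pos_of_nat (α := ℝ) (n := n)])
    refine ⟨w, hw, hw1, ?_⟩
    rw [shiftedForm_self_re_shift E' 0, hw1]; linarith
  choose w hw hw1 hwlt using hseq
  -- The finitely many functionals are bounded along the minimizing sequence, so a subsequence makes
  -- all of them converge. This replaces weak compactness.
  let ℓ : H × H × H × H → (Fin m → ℂ) := fun v i => inner ℂ (g i) v.1
  have hℓ : ∀ n, ℓ (w n) ∈ Metric.closedBall (0 : Fin m → ℂ) (∑ i, ‖g i‖) := by
    intro n
    rw [mem_closedBall_zero_iff, pi_norm_le_iff_of_nonneg (by positivity)]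
    intro i
    have := norm_inner_le_norm (𝕜 := ℂ) (g i) (w n).1
    rw [hw1, mul_one] at this
    exact this.trans (Finset.single_le_sum (f := fun i => ‖g i‖) (fun _ _ => norm_nonneg _)
      (Finset.mem_univ i))
  obtain ⟨z, -, φ, hφ, hz⟩ := tendsto_subseq_of_bounded Metric.isBounded_closedBall hℓ
  -- Coercivity at E, the inequality E' ≤ E and the parallelogram identity at E' combine; the sum of
  -- the two vectors contributes a nonnegative term that is dropped.
  have hdiff (n k : ℕ) : c * ‖w (φ n) - w (φ k)‖ ^ 2 ≤ 2 * (1 / ((φ n : ℝ) + 1))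
      + 2 * (1 / ((φ k : ℝ) + 1)) + C * ∑ i, ‖ℓ (w (φ n)) i - ℓ (w (φ k)) i‖ ^ 2 := by
    set a := w (φ n)
    set b := w (φ k)
    have ha : a ∈ P := hw _
    have hb : b ∈ P := hw _
    have h1 := hco (a - b) (P.sub_mem ha hb)
    have h2 : (shiftedForm H E (a - b) (a - b)).re ≤ (shiftedForm H E' (a - b) (a - b)).re := by
      rw [shiftedForm_self_re_shift E E']
      have : (E' - E) * ‖(a - b).1‖ ^ 2 ≤ 0 :=
        mul_nonpos_of_nonpos_of_nonneg (by linarith) (by positivity)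
      linarith
    have h3 := shiftedForm_parallelogram E' a b
    have h4 := hnonneg (a + b) (P.add_mem ha hb)
    have h5 := hwlt (φ n)
    have h6 := hwlt (φ k)
    have h7 : ∑ i, ‖(inner ℂ (g i) (a - b).1 : ℂ)‖ ^ 2 = ∑ i, ‖ℓ a i - ℓ b i‖ ^ 2 := by
      simp [ℓ]
    have h8 : ‖a - b‖ ^ 2 ≤ ‖(a - b).1‖ ^ 2 + ‖(a - b).2.1‖ ^ 2 + ‖(a - b).2.2.1‖ ^ 2
        + ‖(a - b).2.2.2‖ ^ 2 := by
      generalize a - b = d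
      obtain ⟨d1, d2, d3, d4⟩ := d
      simp only [Prod.norm_mk]
      rcases max_choice ‖d1‖ (max ‖d2‖ (max ‖d3‖ ‖d4‖)) with h | h <;> rw [h]
      · nlinarith [sq_nonneg ‖d2‖, sq_nonneg ‖d3‖, sq_nonneg ‖d4‖]
      rcases max_choice ‖d2‖ (max ‖d3‖ ‖d4‖) with h | h <;> rw [h]
      · nlinarith [sq_nonneg ‖d1‖, sq_nonneg ‖d3‖, sq_nonneg ‖d4‖]
      rcases max_choice ‖d3‖ ‖d4‖ with h | h <;> rw [h]
      · nlinarith [sq_nonneg ‖d1‖, sq_nonneg ‖d2‖, sq_nonneg ‖d4‖]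
      · nlinarith [sq_nonneg ‖d1‖, sq_nonneg ‖d2‖, sq_nonneg ‖d3‖]
    have h9 := mul_le_mul_of_nonneg_left h8 hc.le
    rw [h7] at h1
    linarith
  have hcauchy : CauchySeq fun n => w (φ n) := by
    rw [cauchySeq_iff_tendsto_dist_atTop_0]
    have t1 : Tendsto (fun n : ℕ => 2 * (1 / ((φ n : ℝ) + 1))) atTop (𝓝 0) := by
      have := (tendsto_one_div_add_atTop_nhds_zero_nat (𝕜 := ℝ)).comp hφ.tendsto_atTop
      simpa using this.const_mul 2
    have tfst : Tendsto (fun p : ℕ × ℕ => p.1) atTop atTop := by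
      rw [← prod_atTop_atTop_eq]; exact tendsto_fst
    have tsnd : Tendsto (fun p : ℕ × ℕ => p.2) atTop atTop := by
      rw [← prod_atTop_atTop_eq]; exact tendsto_snd
    have t2 : Tendsto (fun p : ℕ × ℕ => ∑ i, ‖ℓ (w (φ p.1)) i - ℓ (w (φ p.2)) i‖ ^ 2) atTop
        (𝓝 0) := by
      have : ∀ i, Tendsto (fun p : ℕ × ℕ => ‖ℓ (w (φ p.1)) i - ℓ (w (φ p.2)) i‖ ^ 2) atTop
          (𝓝 0) := by
        intro i
        have hi := (tendsto_pi_nhds.1 hz) i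
        have := (((hi.comp tfst).sub (hi.comp tsnd)).norm).pow 2
        simpa using this
      simpa using tendsto_finsetSum Finset.univ (fun i _ => this i)
    have t3 := (((t1.comp tfst).add (t1.comp tsnd)).add (t2.const_mul C)).const_mul c⁻¹
    have t4 : Tendsto (fun p : ℕ × ℕ => ‖w (φ p.1) - w (φ p.2)‖ ^ 2) atTop (𝓝 0) := by
      refine squeeze_zero (fun _ => by positivity) (fun p => ?_) (by simpa using t3)
      have := hdiff p.1 p.2
      rw [← div_eq_inv_mul, le_div_iff₀ hc, mul_comm]
      simpa using this
    have t5 := t4.sqrt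
    simp only [Real.sqrt_zero] at t5
    refine t5.congr fun p => ?_
    rw [Real.sqrt_sq (norm_nonneg _), dist_eq_norm]
  obtain ⟨u, hu⟩ := cauchySeq_tendsto_of_complete hcauchy
  have huP : u ∈ P := hP.mem_of_tendsto hu (Eventually.of_forall fun n => hw _)
  have hu1 : ‖u.1‖ = 1 := by
    have := ((continuous_fst.tendsto u).comp hu).norm
    simp only [Function.comp_def, hw1] at this
    exact tendsto_nhds_unique this tendsto_const_nhds
  refine ⟨E', hE'E, u, huP, fun h => by simp [h] at hu1, fun v hv => ?_⟩
  refine shiftedForm_eq_zero_of_nonneg hnonneg huP (le_antisymm ?_ (hnonneg u huP)) hv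
  have t1 := ((continuous_shiftedForm_self_re (H := H) E').tendsto u).comp hu
  have t2 := (tendsto_one_div_add_atTop_nhds_zero_nat (𝕜 := ℝ)).comp hφ.tendsto_atTop
  exact le_of_tendsto_of_tendsto' t1 t2 fun n => (hwlt (φ n)).le

lemma finrank_finset_sup_le {ι : Type*} (s : Finset ι) (S : ι → Submodule ℂ H)
    (hS : ∀ i ∈ s, FiniteDimensional ℂ (S i)) :
    FiniteDimensional ℂ (s.sup S : Submodule ℂ H) ∧
      Module.finrank ℂ (s.sup S : Submodule ℂ H) ≤ ∑ i ∈ s, Module.finrank ℂ (S i) := by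
  classical
  induction s using Finset.induction_on with
  | empty => rw [Finset.sup_empty]; exact ⟨inferInstance, by simp⟩
  | insert i s hi ih =>
    obtain ⟨h1, h2⟩ := ih fun j hj => hS j (Finset.mem_insert_of_mem hj)
    have h3 := hS i (Finset.mem_insert_self i s)
    rw [Finset.sup_insert, Finset.sum_insert hi]
    exact ⟨inferInstance, (Submodule.finrank_add_le_finrank_add_finrank _ _).trans (by gcongr)⟩

/-- The variational principle: a trial space of dimension `k` below the level `E` forces `k`
eigenvalues below `E`. -/
theorem card_le_weightBelow [CompleteSpace H] {Q : Submodule ℂ (H × H × H × H)}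
    (hQ : IsClosed (Q : Set (H × H × H × H))) {E : ℝ} (hE : IsCoerciveBelow Q E)
    {ι : Type*} [Fintype ι] (w : ι → H × H × H × H) (hw : ∀ i, w i ∈ Q)
    (hne : ∀ a : ι → ℂ, a ≠ 0 → (∑ i, a i • w i).1 ≠ 0)
    (hle : ∀ a : ι → ℂ, (shiftedForm H E (∑ i, a i • w i) (∑ i, a i • w i)).re ≤ 0) :
    (Fintype.card ι : ℝ≥0∞) ≤ weightBelow (eigenMult Q) E := by
  -- A weight below the number of trial vectors is finite, so only finitely many eigenvalues, each
  -- of finite multiplicity, lie at or below E.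
  by_contra! hlt
  set f : ℝ → ℝ≥0∞ := (Iic E).indicator (fun x => (eigenMult Q x : ℝ≥0∞)) with hf
  have hfin : ∑' x, f x ≠ ∞ := (hlt.trans (ENNReal.natCast_lt_top _)).ne
  have hF := ENNReal.finite_const_le_of_tsum_ne_top hfin one_ne_zero
  set F := hF.toFinset
  have hFmem : ∀ x, x ≤ E → eigenMult Q x ≠ 0 → x ∈ F := by
    intro x hx h0
    simp only [F, Finite.mem_toFinset, mem_ofPred_eq, hf, indicator_of_mem (mem_Iic.2 hx)]
    exact_mod_cast Order.one_le_iff_ne_zero.2 h0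
  have hFE : ∀ x ∈ F, x ≤ E := by
    intro x hx
    by_contra hxE
    simp [F, hf, hxE] at hx
  have hFd : ∀ x ∈ F, FiniteDimensional ℂ (eigenspaceOf Q x) := by
    intro x hx
    have h1 : (eigenMult Q x : ℝ≥0∞) ≠ ∞ := by
      have := ENNReal.ne_top_of_tsum_ne_top hfin x
      rwa [hf, indicator_of_mem (mem_Iic.2 (hFE x hx))] at this
    refine Module.rank_lt_aleph0_iff.1 ?_
    by_contra! h2
    exact h1 (by rw [eigenMult, Cardinal.toENat_eq_top.2 h2]; rfl)
  obtain ⟨hSd, hSr⟩ := finrank_finset_sup_le F (eigenspaceOf Q) hFd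
  set S := F.sup (eigenspaceOf Q)
  have hSlt : Module.finrank ℂ S < Fintype.card ι := by
    have h1 : ∑ x ∈ F, f x ≤ ∑' x, f x := ENNReal.sum_le_tsum F
    have h2 : ∑ x ∈ F, f x = ((∑ x ∈ F, Module.finrank ℂ (eigenspaceOf Q x) : ℕ) : ℝ≥0∞) := by
      push_cast
      refine Finset.sum_congr rfl fun x hx => ?_
      have := hFd x hx
      rw [hf, indicator_of_mem (mem_Iic.2 (hFE x hx)), eigenMult, ← Module.finrank_eq_rank,
        Cardinal.toENat_nat]
      rfl
    rw [h2] at h1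
    have h3 := h1.trans_lt hlt
    exact hSr.trans_lt (by exact_mod_cast h3)
  let T : (ι → ℂ) →ₗ[ℂ] S := S.orthogonalProjectionOnto.toLinearMap ∘ₗ
    (LinearMap.fst ℂ H (H × H × H)) ∘ₗ (Fintype.linearCombination ℂ w)
  -- There are more trial vectors than dimensions in S, so some nonzero combination is orthogonal to
  -- every eigenspace at or below E. It certifies that Q ∩ S⊥ still has a ground state at or below
  -- E.
  have hker : LinearMap.ker T ≠ ⊥ := LinearMap.ker_ne_bot_of_finrank_lt (by simpa using hSlt)
  obtain ⟨a, ha, ha0⟩ := Submodule.exists_mem_ne_zero_of_ne_bot hker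
  have haS : (∑ i, a i • w i).1 ∈ Sᗮ := by
    have : S.orthogonalProjectionOnto (∑ i, a i • w i).1 = 0 := by
      simpa [T, Fintype.linearCombination_apply] using ha
    exact Submodule.orthogonalProjectionOnto_eq_zero_iff.1 this
  let P : Submodule ℂ (H × H × H × H) := Q ⊓ Sᗮ.comap (LinearMap.fst ℂ H (H × H × H))
  have hPcl : IsClosed (P : Set (H × H × H × H)) :=
    hQ.inter ((Submodule.isClosed_orthogonal S).preimage continuous_fst)
  obtain ⟨E', hE', u, hu, hu0, huE⟩ := exists_groundState hPcl (hE.mono inf_le_left)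
    (w₀ := ∑ i, a i • w i) ⟨Q.sum_mem fun i _ => Q.smul_mem _ (hw i), haS⟩ (hne a ha0) (hle a)
  -- The test vectors in Q for which the Euler equation of u holds. All eigenvectors spanning S lift
  -- into it, because u is orthogonal to them and each solves its own eigenvalue equation against u.
  let R : Submodule ℂ (H × H × H × H) :=
    { carrier := {x | x ∈ Q ∧ shiftedForm H E' x u = 0}
      add_mem' := fun ha hb => ⟨Q.add_mem ha.1 hb.1, by simp [ha.2, hb.2]⟩
      zero_mem' := ⟨Q.zero_mem, by simp⟩
      smul_mem' := fun c x hx => ⟨Q.smul_mem c hx.1, by simp [map_smulₛₗ, hx.2]⟩ }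
  have hSR : S ≤ R.map (LinearMap.fst ℂ H (H × H × H)) := by
    refine Finset.sup_le fun x hx ψ hψ => ?_
    obtain ⟨v, hvQ, rfl, hv⟩ := mem_eigenspaceOf.1 hψ
    refine ⟨v, ⟨hvQ, ?_⟩, rfl⟩
    have h1 : inner ℂ v.1 u.1 = 0 := hu.2 v.1 (Finset.le_sup (f := eigenspaceOf Q) hx hψ)
    rw [shiftedForm_eq_add E' x, h1, mul_zero, add_zero, ← shiftedForm_conj_symm, hv u hu.1,
      map_zero]
  -- A test vector splits into a lift of its projection onto S, covered by R, and a remainder in P,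
  -- covered by minimality. So u is an eigenvector on all of Q.
  have hueig : u.1 ∈ eigenspaceOf Q E' := by
    refine mem_eigenspaceOf.2 ⟨u, hu.1, rfl, fun v hv => ?_⟩
    obtain ⟨x, ⟨hxQ, hx⟩, hxv⟩ := hSR (S.orthogonalProjectionOnto v.1).2
    have hvx : v - x ∈ P := by
      refine ⟨Q.sub_mem hv hxQ, ?_⟩
      change v.1 - x.1 ∈ Sᗮ
      rw [show x.1 = _ from hxv]
      exact Submodule.sub_starProjection_mem_orthogonal v.1
    have h1 := huE _ hvx
    rwa [map_sub, LinearMap.sub_apply, hx, sub_zero] at h1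
  have hne0 : eigenMult Q E' ≠ 0 := by
    intro h0
    rw [eigenMult, Cardinal.toENat_eq_zero, rank_zero_iff] at h0
    exact hu0 (congrArg Subtype.val (Subsingleton.elim (⟨u.1, hueig⟩ : eigenspaceOf Q E') 0))
  -- The new eigenvalue is at most E, so u belongs to S as well as to its orthogonal complement.
  have huS : u.1 ∈ S := Finset.le_sup (f := eigenspaceOf Q) (hFmem E' hE' hne0) hueig
  exact hu0 (inner_self_eq_zero.1 (hu.2 u.1 huS))

/-- Eigenvectors with different eigenvalues are orthogonal. -/
lemma inner_eq_zero_of_eigenLift {Q : Submodule ℂ (H × H × H × H)} {E E' : ℝ} (hne : E ≠ E')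
    {u w : H × H × H × H} (hu : u ∈ eigenLift Q E) (hw : w ∈ eigenLift Q E') :
    inner ℂ u.1 w.1 = 0 := by
  have h1 := hw.2 u hu.1
  have h2 := hu.2 w hw.1
  rw [← shiftedForm_conj_symm, map_eq_zero, shiftedForm_eq_add E E', h1, zero_add,
    mul_eq_zero] at h2
  refine h2.resolve_left fun h => hne ?_
  have : (E' : ℂ) = E := by linear_combination h
  exact_mod_cast this.symm

/-- Below `E` there are as many orthonormal eigenvectors as `weightBelow` predicts. -/
theorem exists_orthonormal_eigenLift (Q : Submodule ℂ (H × H × H × H)) (E : ℝ) (k : ℕ)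
    (hk : (k : ℝ≥0∞) ≤ weightBelow (eigenMult Q) E) :
    ∃ (ι : Type) (_ : Fintype ι) (w : ι → H × H × H × H) (e : ι → ℝ), k ≤ Fintype.card ι ∧
      Orthonormal ℂ (fun i => (w i).1) ∧ ∀ i, e i ≤ E ∧ w i ∈ eigenLift Q (e i) := by
  classical
  set f : ℝ → ℝ≥0∞ := (Iic E).indicator (fun x => (eigenMult Q x : ℝ≥0∞)) with hf
  -- Truncation at k keeps the multiplicities finite even when an eigenspace is infinite
  -- dimensional.
  set r : ℝ → ℕ := fun x => if x ≤ E then (min (eigenMult Q x) k).toNat else 0 with hr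
  have hrcast : ∀ x, (r x : ℝ≥0∞) = min (f x) k := by
    intro x
    by_cases hx : x ≤ E
    · have h1 : ((min (eigenMult Q x) k).toNat : ℕ∞) = min (eigenMult Q x) k :=
        ENat.natCast_toNat (ne_top_of_le_ne_top (ENat.natCast_ne_top k) (min_le_right _ _))
      have h2 : (((min (eigenMult Q x) k).toNat : ℕ∞) : ℝ≥0∞)
          = ((min (eigenMult Q x) k : ℕ∞) : ℝ≥0∞) := by rw [h1]
      simp only [hr, hx, if_true, hf, indicator_of_mem (mem_Iic.2 hx)]
      rw [ENat.toENNReal_min] at h2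
      simpa using h2
    · simp [hr, hf, hx]
  -- If every finite sum of truncated multiplicities stayed below k, no truncation would take place
  -- (singletons show this), so the full weight would be at most k - 1.
  obtain ⟨F, hF⟩ : ∃ F : Finset ℝ, k ≤ ∑ x ∈ F, r x := by
    by_contra! hlt
    have hmin : ∀ x, f x < k := by
      intro x
      have h1 := hlt {x}
      rw [Finset.sum_singleton] at h1
      have h2 : (r x : ℝ≥0∞) < k := by exact_mod_cast h1
      rw [hrcast] at h2
      exact (min_lt_iff.1 h2).resolve_right (lt_irrefl _)
    have hk0 : 0 < k := by simpa using hlt ∅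
    have h3 : ∑' x, f x ≤ ((k - 1 : ℕ) : ℝ≥0∞) := by
      rw [ENNReal.tsum_eq_iSup_sum]
      refine iSup_le fun F => ?_
      have h4 : ∑ x ∈ F, f x = ((∑ x ∈ F, r x : ℕ) : ℝ≥0∞) := by
        push_cast
        refine Finset.sum_congr rfl fun x _ => ?_
        rw [hrcast, min_eq_left (hmin x).le]
      rw [h4]
      exact_mod_cast Nat.le_sub_one_of_lt (hlt F)
    have h5 := hk.trans h3
    have h6 : k ≤ k - 1 := by exact_mod_cast h5
    omega
  have hex : ∀ x, ∃ w : Fin (r x) → H × H × H × H, Orthonormal ℂ (fun i => (w i).1) ∧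
      ∀ i, w i ∈ eigenLift Q x := by
    intro x
    have h1 : (r x : Cardinal) ≤ Module.rank ℂ (eigenspaceOf Q x) := by
      rw [← Cardinal.natCast_le_toENat]
      by_cases hx : x ≤ E
      · simp only [hr, hx, if_true]
        rw [ENat.natCast_toNat (ne_top_of_le_ne_top (ENat.natCast_ne_top k) (min_le_right _ _))]
        exact min_le_left _ _
      · simp [hr, hx]
    obtain ⟨v, hv⟩ := Module.le_rank_iff.1 h1
    have hfd : FiniteDimensional ℂ (Submodule.span ℂ (range v)) :=
      FiniteDimensional.span_of_finite ℂ (finite_range v)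
    have hfr : Module.finrank ℂ (Submodule.span ℂ (range v)) = r x := by
      rw [finrank_span_eq_card hv, Fintype.card_fin]
    let b := (stdOrthonormalBasis ℂ (Submodule.span ℂ (range v))).reindex (finCongr hfr)
    have hlift : ∀ i, ∃ w ∈ eigenLift Q x, w.1 = ((b i : eigenspaceOf Q x) : H) := fun i =>
      (b i : eigenspaceOf Q x).2
    choose w hw hw1 using hlift
    refine ⟨w, ?_, hw⟩
    simp only [hw1]
    have h2 := b.orthonormal
    rw [orthonormal_iff_ite] at h2 ⊢
    exact h2
  choose w hw1 hw2 using hex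
  refine ⟨Σ x : F, Fin (r x), inferInstance, fun i => w i.1 i.2, fun i => i.1, ?_, ?_, ?_⟩
  · rw [Fintype.card_sigma]
    simp only [Fintype.card_fin]
    rwa [Finset.sum_coe_sort F r]
  · rw [orthonormal_iff_ite]
    rintro ⟨x, i⟩ ⟨y, j⟩
    by_cases hxy : x = y
    · subst hxy
      have := (orthonormal_iff_ite.1 (hw1 x)) i j
      simpa using this
    · rw [if_neg (by rintro h; exact hxy (congrArg Sigma.fst h))]
      exact inner_eq_zero_of_eigenLift (fun h => hxy (Subtype.ext h)) (hw2 x i) (hw2 y j)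
  · rintro ⟨x, i⟩
    refine ⟨?_, hw2 x i⟩
    by_contra hx
    have : r x = 0 := by simp [hr, hx]
    exact (Fin.cast this i).elim0

/-- The form on the span of orthonormal eigenvectors. -/
lemma shiftedForm_sum_eigenLift {Q : Submodule ℂ (H × H × H × H)} {ι : Type*} [Fintype ι]
    {w : ι → H × H × H × H} {e : ι → ℝ} (ho : Orthonormal ℂ (fun i => (w i).1))
    (hw : ∀ i, w i ∈ eigenLift Q (e i)) (E : ℝ) (a : ι → ℂ) :
    (shiftedForm H E (∑ i, a i • w i) (∑ i, a i • w i)).re = ∑ i, (e i - E) * ‖a i‖ ^ 2 := by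
  classical
  have h1 : ∀ i j, shiftedForm H E (w i) (w j) = if i = j then ((e j : ℂ) - E) else 0 := by
    intro i j
    rw [shiftedForm_eq_add E (e j), (hw j).2 _ (hw i).1, zero_add, (orthonormal_iff_ite.1 ho) i j]
    split_ifs <;> simp
  simp only [map_sum, LinearMap.sum_apply, map_smulₛₗ, LinearMap.smul_apply, h1, smul_eq_mul,
    RingHom.id_apply]
  simp only [mul_ite, mul_zero, Finset.sum_ite_eq', Finset.mem_univ, if_true, Complex.re_sum]
  refine Finset.sum_congr rfl fun i _ => ?_
  have h2 : conj (a i) * a i = ((‖a i‖ ^ 2 : ℝ) : ℂ) := by rw [Complex.conj_mul']; norm_cast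
  have h3 : conj (a i) * (a i * ((e i : ℂ) - E)) = (((e i - E) * ‖a i‖ ^ 2 : ℝ) : ℂ) := by
    rw [← mul_assoc, h2]; push_cast; ring
  rw [show a i * (conj (a i) * ((e i : ℂ) - E)) = conj (a i) * (a i * ((e i : ℂ) - E)) by ring,
    h3, Complex.ofReal_re]

lemma fst_sum_ne_zero_of_orthonormal {ι : Type*} [Fintype ι] {w : ι → H × H × H × H}
    (ho : Orthonormal ℂ (fun i => (w i).1)) {a : ι → ℂ} (ha : a ≠ 0) :
    (∑ i, a i • w i).1 ≠ 0 := by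
  intro h
  refine ha (funext fun i => ?_)
  have h1 : ∑ i, a i • (w i).1 = 0 := by simpa [Prod.fst_sum] using h
  exact Fintype.linearIndependent_iff.1 ho.linearIndependent a h1 i

/-- Negativity on a finite dimensional space is stable under perturbations. -/
lemma eventually_shiftedForm_neg {ι : Type*} [Fintype ι] {w : ι → H × H × H × H} {E : ℝ}
    (hw : ∀ a : ι → ℂ, a ≠ 0 → (shiftedForm H E (∑ i, a i • w i) (∑ i, a i • w i)).re < 0)
    {v : ℕ → ι → H × H × H × H} (hv : ∀ i, Tendsto (fun n => v n i) atTop (𝓝 (w i))) :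
    ∀ᶠ n in atTop, ∀ a : ι → ℂ, a ≠ 0 →
      (shiftedForm H E (∑ i, a i • v n i) (∑ i, a i • v n i)).re < 0 := by
  have hcont : Continuous fun z : (ι → H × H × H × H) × (ι → ℂ) =>
      (shiftedForm H E (∑ i, z.2 i • z.1 i) (∑ i, z.2 i • z.1 i)).re :=
    (continuous_shiftedForm_self_re E).comp (by fun_prop)
  -- Negativity on the compact unit sphere of coefficients is an open condition on the vectors;
  -- homogeneity then removes the normalization.
  have h1 : ∀ᶠ x in 𝓝 w, ∀ a ∈ Metric.sphere (0 : ι → ℂ) 1,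
      (shiftedForm H E (∑ i, a i • x i) (∑ i, a i • x i)).re < 0 := by
    refine IsCompact.eventually_forall_of_forall_eventually (isCompact_sphere _ _) fun a ha => ?_
    have ha0 : a ≠ 0 := fun h => by simp [h] at ha
    have hlim := hcont.tendsto (w, a)
    exact hlim.eventually_lt_const (hw a ha0)
  filter_upwards [(tendsto_pi_nhds.2 hv).eventually h1] with n hn a ha
  have ha' : 0 < ‖a‖ := norm_pos_iff.2 ha
  have h2 := hn (((‖a‖⁻¹ : ℝ) : ℂ) • a) (by
    rw [mem_sphere_zero_iff_norm, norm_smul, Complex.norm_real, norm_inv, norm_norm,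
      inv_mul_cancel₀ ha'.ne'])
  have h3 : ∑ i, (((‖a‖⁻¹ : ℝ) : ℂ) • a) i • v n i = ((‖a‖⁻¹ : ℝ) : ℂ) • ∑ i, a i • v n i := by
    rw [Finset.smul_sum]
    exact Finset.sum_congr rfl fun i _ => by rw [Pi.smul_apply, smul_eq_mul, mul_smul]
  rw [h3, shiftedForm_smul_self_re] at h2
  by_contra! h4
  have : 0 ≤ ‖((‖a‖⁻¹ : ℝ) : ℂ)‖ ^ 2 * (shiftedForm H E (∑ i, a i • v n i)
    (∑ i, a i • v n i)).re := by positivity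
  linarith

end AbstractForm

/-! ### Traces as integrals of eigenvalue counting functions -/

section LayerCake

/-- The layer cake representation of `∑ m(x) (t |x|)^γ` over the negative half-line. -/
theorem tsum_mul_abs_rpow_eq_lintegral (m : ℝ → ℕ∞) {γ t : ℝ} (hγ : 0 < γ) (ht : 0 < t) :
    ∑' x : Iio (0 : ℝ), (m x : ℝ≥0∞) * ENNReal.ofReal ((t * |(x : ℝ)|) ^ γ)
      = ∫⁻ s in Ioi (0 : ℝ), weightBelow m (-(s ^ (1 / γ)) / t) := by
  -- With the discrete σ-algebra everything is measurable, and the sum becomes an integral against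
  -- point masses of weight m(x).
  let _ : MeasurableSpace (Iio (0 : ℝ)) := ⊤
  have : MeasurableSingletonClass (Iio (0 : ℝ)) := ⟨fun _ => trivial⟩
  set ν : Measure (Iio (0 : ℝ)) := Measure.count.withDensity fun x => (m x : ℝ≥0∞)
  have h1 : ∑' x : Iio (0 : ℝ), (m x : ℝ≥0∞) * ENNReal.ofReal ((t * |(x : ℝ)|) ^ γ)
      = ∫⁻ x, ENNReal.ofReal ((t * |(x : ℝ)|) ^ γ) ∂ν := by
    rw [lintegral_withDensity_eq_lintegral_mul _ measurable_from_top measurable_from_top,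
      lintegral_count]
    rfl
  have hm : Measurable fun x : Iio (0 : ℝ) => (t * |(x : ℝ)|) ^ γ := measurable_from_top
  rw [h1, lintegral_eq_lintegral_meas_le ν (Eventually.of_forall fun x => by positivity)
    hm.aemeasurable]
  refine setLIntegral_congr_fun measurableSet_Ioi fun s hs => ?_
  have hs : 0 < s := hs
  have hms : MeasurableSet {a : Iio (0 : ℝ) | s ≤ (t * |(a : ℝ)|) ^ γ} := trivial
  rw [withDensity_apply _ hms, ← lintegral_indicator hms, lintegral_count, weightBelow]
  have hpos : -(s ^ (1 / γ)) / t < 0 :=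
    div_neg_of_neg_of_pos (neg_lt_zero.2 (Real.rpow_pos_of_pos hs _)) ht
  -- The level is negative, so the sum over the negative half-line may be replaced by the sum over ℝ
  -- used in `weightBelow`.
  have hsupp : Function.support ((Iic (-(s ^ (1 / γ)) / t)).indicator (fun x => (m x : ℝ≥0∞)))
      ⊆ Iio 0 := by
    intro x hx
    have := mem_of_indicator_ne_zero hx
    simp only [mem_Iic] at this
    exact mem_Iio.2 (by linarith)
  rw [← tsum_subtype_eq_of_support_subset hsupp]
  refine tsum_congr fun x => ?_
  have hx : (x : ℝ) < 0 := x.2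
  have hiff : s ≤ (t * |(x : ℝ)|) ^ γ ↔ (x : ℝ) ≤ -(s ^ (1 / γ)) / t := by
    rw [one_div, abs_of_neg hx, ← Real.rpow_inv_le_iff_of_pos hs.le (by nlinarith) hγ,
      le_div_iff₀ ht]
    constructor <;> intro h <;> linarith
  by_cases h : s ≤ (t * |(x : ℝ)|) ^ γ
  · rw [indicator_of_mem (by exact h), indicator_of_mem (by exact hiff.1 h)]
  · rw [indicator_of_notMem (by exact h), indicator_of_notMem (by exact fun h' => h (hiff.2 h'))]

theorem tsum_abs_rpow_eq_lintegral (m : ℝ → ℕ∞) {γ : ℝ} (hγ : 0 < γ) :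
    ∑' x : Iio (0 : ℝ), (m x : ℝ≥0∞) * ENNReal.ofReal (|(x : ℝ)| ^ γ)
      = ∫⁻ s in Ioi (0 : ℝ), weightBelow m (-(s ^ (1 / γ))) := by
  simpa using tsum_mul_abs_rpow_eq_lintegral m hγ zero_lt_one

lemma weightBelow_mono (m : ℝ → ℕ∞) : Monotone (weightBelow m) := fun _ _ h =>
  ENNReal.tsum_le_tsum fun x =>
    indicator_le_indicator_of_subset (Iic_subset_Iic.2 h) (fun _ => zero_le) x

end LayerCake

/-! ### The form domain as a closed space of quadruples -/

section FormDomain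

variable {X : Type*} [MeasurableSpace X] {μ : Measure X}

lemma exists_subseq_tendsto_ae {f : ℕ → Lp ℂ 2 μ} {g : Lp ℂ 2 μ} (h : Tendsto f atTop (𝓝 g)) :
    ∃ φ : ℕ → ℕ, StrictMono φ ∧ ∀ᵐ x ∂μ, Tendsto (fun n => f (φ n) x) atTop (𝓝 (g x)) :=
  (tendstoInMeasure_of_tendsto_Lp h).exists_seq_tendsto_ae

/-- The function b may be unbounded: multiplication operators are closed, since L² limits are
pointwise limits along a subsequence. -/
lemma isClosed_setOf_ae_eq_mul (b : X → ℂ) :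
    IsClosed {p : Lp ℂ 2 μ × Lp ℂ 2 μ | p.2 =ᵐ[μ] fun x => b x * p.1 x} := by
  refine IsSeqClosed.isClosed fun p q hp hpq => ?_
  obtain ⟨φ, hφ, h1⟩ := exists_subseq_tendsto_ae ((continuous_fst.tendsto q).comp hpq)
  obtain ⟨φ', hφ', h2⟩ := exists_subseq_tendsto_ae
    (((continuous_snd.tendsto q).comp hpq).comp hφ.tendsto_atTop)
  have h3 : ∀ᵐ x ∂μ, ∀ n, (p n).2 x = b x * (p n).1 x := ae_all_iff.2 hp
  filter_upwards [h1, h2, h3] with x h1 h2 h3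
  refine tendsto_nhds_unique h2 ?_
  have := (h1.comp hφ'.tendsto_atTop).const_mul (b x)
  refine this.congr fun n => ?_
  simp [h3]

/-- The quadruples `(ψ, ψ', √V₊ ψ, √V₋ ψ)`, without regularity condition on `ψ`. -/
def potentialGraph (μ : Measure X) (V : X → ℝ) :
    Submodule ℂ (Lp ℂ 2 μ × Lp ℂ 2 μ × Lp ℂ 2 μ × Lp ℂ 2 μ) where
  carrier := {w | w.2.2.1 =ᵐ[μ] (fun x => (√((V x)⁺) : ℂ) * w.1 x) ∧
    w.2.2.2 =ᵐ[μ] (fun x => (√((V x)⁻) : ℂ) * w.1 x)}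
  add_mem' := by
    rintro a b ⟨ha1, ha2⟩ ⟨hb1, hb2⟩
    constructor
    · filter_upwards [ha1, hb1, Lp.coeFn_add a.1 b.1, Lp.coeFn_add a.2.2.1 b.2.2.1]
        with x h1 h2 h3 h4
      simp only [Prod.fst_add, Prod.snd_add, h3, h4, Pi.add_apply, h1, h2, mul_add]
    · filter_upwards [ha2, hb2, Lp.coeFn_add a.1 b.1, Lp.coeFn_add a.2.2.2 b.2.2.2]
        with x h1 h2 h3 h4
      simp only [Prod.fst_add, Prod.snd_add, h3, h4, Pi.add_apply, h1, h2, mul_add]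
  zero_mem' := by
    constructor <;> filter_upwards [Lp.coeFn_zero ℂ 2 μ] with x hx <;>
      simp only [Prod.fst_zero, Prod.snd_zero, hx, Pi.zero_apply, mul_zero]
  smul_mem' := by
    rintro c a ⟨ha1, ha2⟩
    constructor
    · filter_upwards [ha1, Lp.coeFn_smul c a.1, Lp.coeFn_smul c a.2.2.1] with x h1 h3 h4
      simp only [Prod.smul_fst, Prod.smul_snd, h3, h4, Pi.smul_apply, h1, smul_eq_mul]; ring
    · filter_upwards [ha2, Lp.coeFn_smul c a.1, Lp.coeFn_smul c a.2.2.2] with x h1 h3 h4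
      simp only [Prod.smul_fst, Prod.smul_snd, h3, h4, Pi.smul_apply, h1, smul_eq_mul]; ring

/-- The form domain of `-d²/dx² + V`, as a space of quadruples `(ψ, ψ', √V₊ ψ, √V₋ ψ)`. -/
def formGraph (D : Submodule ℂ (Lp ℂ 2 μ × Lp ℂ 2 μ)) (V : X → ℝ) :
    Submodule ℂ (Lp ℂ 2 μ × Lp ℂ 2 μ × Lp ℂ 2 μ × Lp ℂ 2 μ) :=
  potentialGraph μ V ⊓ D.comap ((LinearMap.fst ℂ _ _).prod
    (LinearMap.fst ℂ _ _ ∘ₗ LinearMap.snd ℂ _ _))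

lemma mem_formGraph {D : Submodule ℂ (Lp ℂ 2 μ × Lp ℂ 2 μ)} {V : X → ℝ}
    {w : Lp ℂ 2 μ × Lp ℂ 2 μ × Lp ℂ 2 μ × Lp ℂ 2 μ} :
    w ∈ formGraph D V ↔ w ∈ potentialGraph μ V ∧ (w.1, w.2.1) ∈ D := Iff.rfl

lemma isClosed_formGraph {D : Submodule ℂ (Lp ℂ 2 μ × Lp ℂ 2 μ)}
    (hD : IsClosed (D : Set (Lp ℂ 2 μ × Lp ℂ 2 μ))) (V : X → ℝ) :
    IsClosed (formGraph D V : Set (Lp ℂ 2 μ × Lp ℂ 2 μ × Lp ℂ 2 μ × Lp ℂ 2 μ)) := by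
  have h1 := (isClosed_setOf_ae_eq_mul (μ := μ) fun x => (√((V x)⁺) : ℂ)).preimage
    (f := fun w : Lp ℂ 2 μ × Lp ℂ 2 μ × Lp ℂ 2 μ × Lp ℂ 2 μ => (w.1, w.2.2.1)) (by fun_prop)
  have h2 := (isClosed_setOf_ae_eq_mul (μ := μ) fun x => (√((V x)⁻) : ℂ)).preimage
    (f := fun w : Lp ℂ 2 μ × Lp ℂ 2 μ × Lp ℂ 2 μ × Lp ℂ 2 μ => (w.1, w.2.2.2)) (by fun_prop)
  have h3 := hD.preimage
    (f := fun w : Lp ℂ 2 μ × Lp ℂ 2 μ × Lp ℂ 2 μ × Lp ℂ 2 μ => (w.1, w.2.1)) (by fun_prop)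
  exact (h1.inter h2).inter h3

lemma integrable_mul_sq_of_ae_eq {b : X → ℝ} (hb : ∀ x, 0 ≤ b x) {f g : Lp ℂ 2 μ}
    (h : g =ᵐ[μ] fun x => (√(b x) : ℂ) * f x) :
    Integrable (fun x => b x * ‖f x‖ ^ 2) μ ∧ ∫ x, b x * ‖f x‖ ^ 2 ∂μ = ‖g‖ ^ 2 := by
  have h1 : (fun x => ‖g x‖ ^ 2) =ᵐ[μ] fun x => b x * ‖f x‖ ^ 2 := by
    filter_upwards [h] with x hx
    rw [hx, norm_mul, mul_pow, Complex.norm_real, Real.norm_eq_abs, sq_abs, Real.sq_sqrt (hb x)]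
  refine ⟨((memLp_two_iff_integrable_sq_norm (Lp.aestronglyMeasurable g)).1 (Lp.memLp g)).congr h1,
    ?_⟩
  rw [← integral_congr_ae h1]
  have h2 := L2.inner_def (𝕜 := ℂ) g g
  simp only [inner_self_eq_norm_sq_to_K] at h2
  have h3 : ((‖g‖ ^ 2 : ℝ) : ℂ) = ((∫ x, ‖g x‖ ^ 2 ∂μ : ℝ) : ℂ) := by
    rw [← integral_complex_ofReal]; push_cast; exact h2
  exact_mod_cast h3.symm

lemma exists_ae_eq_sqrt_mul {b : X → ℝ} (hbm : AEMeasurable b μ) (hb : ∀ x, 0 ≤ b x)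
    {f : Lp ℂ 2 μ} (h : Integrable (fun x => b x * ‖f x‖ ^ 2) μ) :
    ∃ g : Lp ℂ 2 μ, g =ᵐ[μ] fun x => (√(b x) : ℂ) * f x := by
  have hm : AEStronglyMeasurable (fun x => (√(b x) : ℂ) * f x) μ :=
    ((Complex.measurable_ofReal.comp_aemeasurable hbm.sqrt).aestronglyMeasurable).mul
      (Lp.aestronglyMeasurable f)
  have : MemLp (fun x => (√(b x) : ℂ) * f x) 2 μ := by
    rw [memLp_two_iff_integrable_sq_norm hm]
    refine h.congr (Eventually.of_forall fun x => ?_)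
    simp only [norm_mul, mul_pow, Complex.norm_real, Real.norm_eq_abs, sq_abs, Real.sq_sqrt (hb x)]
  exact ⟨this.toLp _, this.coeFn_toLp⟩

lemma exists_mem_formGraph {D : Submodule ℂ (Lp ℂ 2 μ × Lp ℂ 2 μ)} {V : X → ℝ}
    (hV : AEMeasurable V μ) {u : Lp ℂ 2 μ × Lp ℂ 2 μ} (hu : u ∈ formDomain (D : Set _) V)
    (hneg : Integrable (fun x => (V x)⁻ * ‖u.1 x‖ ^ 2) μ) :
    ∃ w ∈ formGraph D V, w.1 = u.1 ∧ w.2.1 = u.2 := by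
  have hVp : AEMeasurable (fun x => (V x)⁺) μ := hV.sup_const 0
  have hVm : AEMeasurable (fun x => (V x)⁻) μ := hV.neg.sup_const 0
  obtain ⟨g, hg⟩ := exists_ae_eq_sqrt_mul hVp (fun x => posPart_nonneg (V x)) hu.2
  obtain ⟨k, hk⟩ := exists_ae_eq_sqrt_mul hVm (fun x => negPart_nonneg (V x)) hneg
  exact ⟨(u.1, u.2, g, k), ⟨⟨hg, hk⟩, hu.1⟩, rfl, rfl⟩

lemma mem_formDomain_of_mem_formGraph {D : Submodule ℂ (Lp ℂ 2 μ × Lp ℂ 2 μ)} {V : X → ℝ}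
    {w : Lp ℂ 2 μ × Lp ℂ 2 μ × Lp ℂ 2 μ × Lp ℂ 2 μ} (hw : w ∈ formGraph D V) :
    (w.1, w.2.1) ∈ formDomain (D : Set _) V :=
  ⟨hw.2, (integrable_mul_sq_of_ae_eq (fun x => posPart_nonneg (V x)) hw.1.1).1⟩

/-- The last two components are in L², so the V₊ and V₋ integrals converge separately and may be
combined into one. -/
lemma shiftedForm_eq_schrodingerForm {V : X → ℝ}
    {u w : Lp ℂ 2 μ × Lp ℂ 2 μ × Lp ℂ 2 μ × Lp ℂ 2 μ} (hu : u ∈ potentialGraph μ V)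
    (hw : w ∈ potentialGraph μ V) (E : ℝ) :
    shiftedForm (Lp ℂ 2 μ) E u w
      = schrodingerForm V (u.1, u.2.1) (w.1, w.2.1) - inner ℂ u.1 ((E : ℂ) • w.1) := by
  rw [shiftedForm_apply, schrodingerForm, inner_smul_right]
  congr 1
  rw [add_sub_assoc]
  congr 1
  · rw [L2.inner_def]
    refine integral_congr_ae (Eventually.of_forall fun x => ?_)
    simp [RCLike.inner_apply, mul_comm]
  · rw [L2.inner_def, L2.inner_def, ← integral_sub (L2.integrable_inner _ _)
      (L2.integrable_inner _ _)]
    refine integral_congr_ae ?_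
    filter_upwards [hu.1, hu.2, hw.1, hw.2] with x h1 h2 h3 h4
    have hp : (√((V x)⁺) : ℂ) * (√((V x)⁺) : ℂ) = ((V x)⁺ : ℝ) := by
      rw [← Complex.ofReal_mul, Real.mul_self_sqrt (posPart_nonneg _)]
    have hm : (√((V x)⁻) : ℂ) * (√((V x)⁻) : ℂ) = ((V x)⁻ : ℝ) := by
      rw [← Complex.ofReal_mul, Real.mul_self_sqrt (negPart_nonneg _)]
    have hv : (V x : ℂ) = ((V x)⁺ : ℝ) - ((V x)⁻ : ℝ) := by
      rw [← Complex.ofReal_sub, posPart_sub_negPart]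
    simp only [h1, h2, h3, h4, RCLike.inner_apply, map_mul, Complex.conj_ofReal]
    rw [hv, ← hp, ← hm]
    ring

/-- The multiplicities are those of the form on quadruples. -/
lemma eigenMultiplicity_eq_eigenMult {D : Submodule ℂ (Lp ℂ 2 μ × Lp ℂ 2 μ)} {V : X → ℝ}
    (hV : AEMeasurable V μ)
    (hD : ∀ u ∈ D, Integrable (fun x => (V x)⁻ * ‖u.1 x‖ ^ 2) μ) (E : ℝ) :
    eigenMultiplicity (D : Set (Lp ℂ 2 μ × Lp ℂ 2 μ)) V E = eigenMult (formGraph D V) E := by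
  -- The solution set is already a subspace, so taking its span changes nothing. The integrability
  -- hypothesis on V₋ supplies the fourth component of the quadruple.
  have : {ψ : Lp ℂ 2 μ | IsSchrodingerImage (D : Set (Lp ℂ 2 μ × Lp ℂ 2 μ)) V ψ ((E : ℂ) • ψ)}
      = (eigenspaceOf (formGraph D V) E : Set (Lp ℂ 2 μ)) := by
    ext ψ
    rw [SetLike.mem_coe, mem_eigenspaceOf]
    constructor
    · rintro ⟨ψ', h1, h2⟩
      obtain ⟨w, hw, rfl, rfl⟩ := exists_mem_formGraph hV h1 (hD _ h1.1)
      refine ⟨w, hw, rfl, fun u hu => ?_⟩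
      rw [shiftedForm_eq_schrodingerForm hu.1 hw.1, sub_eq_zero]
      exact h2 (u.1, u.2.1) (mem_formDomain_of_mem_formGraph hu)
    · rintro ⟨w, hw, rfl, h⟩
      refine ⟨w.2.1, mem_formDomain_of_mem_formGraph hw, fun u hu => ?_⟩
      obtain ⟨v, hv, hv1, hv2⟩ := exists_mem_formGraph hV hu (hD _ hu.1)
      have := h v hv
      rw [shiftedForm_eq_schrodingerForm hv.1 hw.1, sub_eq_zero, hv1, hv2] at this
      exact this
  rw [eigenMultiplicity, this, Submodule.span_eq]
  rfl

lemma negTrace_eq_tsum_eigenMult {D : Submodule ℂ (Lp ℂ 2 μ × Lp ℂ 2 μ)} {V : X → ℝ}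
    (hV : AEMeasurable V μ)
    (hD : ∀ u ∈ D, Integrable (fun x => (V x)⁻ * ‖u.1 x‖ ^ 2) μ) (γ : ℝ) :
    negTrace (D : Set (Lp ℂ 2 μ × Lp ℂ 2 μ)) V γ
      = ∑' E : Iio (0 : ℝ), (eigenMult (formGraph D V) E : ℝ≥0∞)
        * ENNReal.ofReal (|(E : ℝ)| ^ γ) := by
  simp only [negTrace, eigenMultiplicity_eq_eigenMult hV hD]

end FormDomain

/-! ### Transfer of functions between measure spaces -/

section Transfer

variable {X Y : Type*} [MeasurableSpace X] [MeasurableSpace Y] {μ : Measure X} {ν : Measure Y}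
  {σ : X → Y} {A : Set X}

/-- The map `f ↦ 1_A (f ∘ σ)` is a contraction from `L²(ν)` to `L²(μ)`. -/
structure IsTransfer (σ : X → Y) (A : Set X) (μ : Measure X) (ν : Measure Y) : Prop where
  measurable : Measurable σ
  measurableSet : MeasurableSet A
  map_le : (μ.restrict A).map σ ≤ ν

lemma IsTransfer.ae_comp (h : IsTransfer σ A μ ν) {p : Y → Prop} (hp : ∀ᵐ y ∂ν, p y) :
    ∀ᵐ x ∂μ, x ∈ A → p (σ x) :=
  (ae_restrict_iff' h.measurableSet).1
    (ae_of_ae_map h.measurable.aemeasurable (ae_mono h.map_le hp))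

lemma IsTransfer.indicator_ae_eq (h : IsTransfer σ A μ ν) {f g : Y → ℂ} (hfg : f =ᵐ[ν] g) :
    A.indicator (f ∘ σ) =ᵐ[μ] A.indicator (g ∘ σ) := by
  filter_upwards [h.ae_comp hfg] with x hx
  by_cases hxA : x ∈ A
  · simp [hxA, hx hxA]
  · simp [hxA]

lemma IsTransfer.memLp {F : Type*} [NormedAddCommGroup F] (h : IsTransfer σ A μ ν) {f : Y → F}
    {p : ℝ≥0∞} (hf : MemLp f p ν) :
    MemLp (A.indicator (f ∘ σ)) p μ :=
  (memLp_indicator_iff_restrict h.measurableSet).2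
    ((hf.mono_measure h.map_le).comp_of_map h.measurable.aemeasurable)

/-- The map `f ↦ 1_A (f ∘ σ)` from `L²(ν)` to `L²(μ)`. -/
def transferLp (h : IsTransfer σ A μ ν) : Lp ℂ 2 ν →ₗ[ℂ] Lp ℂ 2 μ where
  toFun f := (h.memLp (Lp.memLp f)).toLp _
  map_add' f g := by
    rw [← MemLp.toLp_add]
    refine MemLp.toLp_congr _ _ ((h.indicator_ae_eq (Lp.coeFn_add f g)).trans ?_)
    refine Eventually.of_forall fun x => ?_
    by_cases hx : x ∈ A <;> simp [hx]
  map_smul' c f := by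
    rw [RingHom.id_apply, ← MemLp.toLp_const_smul]
    refine MemLp.toLp_congr _ _ ((h.indicator_ae_eq (Lp.coeFn_smul c f)).trans ?_)
    refine Eventually.of_forall fun x => ?_
    by_cases hx : x ∈ A <;> simp [hx]

lemma coeFn_transferLp (h : IsTransfer σ A μ ν) (f : Lp ℂ 2 ν) :
    transferLp h f =ᵐ[μ] A.indicator (f ∘ σ) := MemLp.coeFn_toLp (h.memLp (Lp.memLp f))

/-- Extension by zero is adjoint to restriction. -/
lemma inner_transferLp_left {τ : Y → X} (h : IsTransfer σ A μ ν) (h' : IsTransfer τ univ ν μ)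
    (hmap : (μ.restrict A).map σ = ν) (hτ : ∀ x ∈ A, τ (σ x) = x) (f : Lp ℂ 2 ν) (g : Lp ℂ 2 μ) :
    inner ℂ (transferLp h f) g = inner ℂ f (transferLp h' g) := by
  rw [L2.inner_def, L2.inner_def]
  have h1 : ∫ y, inner ℂ (f y) (transferLp h' g y) ∂ν = ∫ y, inner ℂ (f y) (g (τ y)) ∂ν := by
    refine integral_congr_ae ?_
    filter_upwards [coeFn_transferLp h' g] with y hy
    rw [hy]; simp
  have h2 : ∫ x, inner ℂ (transferLp h f x) (g x) ∂μ
      = ∫ x in A, inner ℂ (f (σ x)) (g (τ (σ x))) ∂μ := by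
    rw [← integral_indicator h.measurableSet]
    refine integral_congr_ae ?_
    filter_upwards [coeFn_transferLp h f] with x hx
    rw [hx]
    by_cases hxA : x ∈ A
    · simp [hxA, hτ x hxA]
    · simp [hxA]
  have hsm : AEStronglyMeasurable (fun y => inner ℂ (f y) (g (τ y))) ((μ.restrict A).map σ) := by
    rw [hmap]
    refine (Lp.aestronglyMeasurable f).inner ?_
    have := (h'.memLp (Lp.memLp g)).aestronglyMeasurable
    rwa [indicator_univ] at this
  rw [h1, h2, ← integral_map (f := fun y => inner ℂ (f y) (g (τ y))) h.measurable.aemeasurable hsm,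
    hmap]

/-- The action of a linear map on quadruples, with a sign for the derivative. -/
def quadMap {H K : Type*} [AddCommGroup H] [Module ℂ H] [AddCommGroup K] [Module ℂ K]
    (ε : ℝ) (T : H →ₗ[ℂ] K) : (H × H × H × H) →ₗ[ℂ] (K × K × K × K) :=
  T.prodMap (((ε : ℂ) • T).prodMap (T.prodMap T))

lemma quadMap_apply {H K : Type*} [AddCommGroup H] [Module ℂ H] [AddCommGroup K] [Module ℂ K]
    (ε : ℝ) (T : H →ₗ[ℂ] K) (w : H × H × H × H) :
    quadMap ε T w = (T w.1, (ε : ℂ) • T w.2.1, T w.2.2.1, T w.2.2.2) := rfl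

/-- The sign ε is real, so it may be moved across the inner product together with the adjoint. -/
lemma shiftedForm_quadMap_left {H K : Type*} [NormedAddCommGroup H] [InnerProductSpace ℂ H]
    [NormedAddCommGroup K] [InnerProductSpace ℂ K] {T : H →ₗ[ℂ] K} {T' : K →ₗ[ℂ] H}
    (hT : ∀ f g, inner ℂ (T f) g = inner ℂ f (T' g)) (ε E : ℝ) (u : H × H × H × H)
    (w : K × K × K × K) :
    shiftedForm K E (quadMap ε T u) w = shiftedForm H E u (quadMap ε T' w) := by
  simp only [shiftedForm_apply, quadMap_apply, hT, inner_smul_left, inner_smul_right,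
    Complex.conj_ofReal]

lemma quadMap_transferLp_mem_potentialGraph (h : IsTransfer σ A μ ν) {V : Y → ℝ} {W : X → ℝ}
    (hVW : ∀ᵐ x ∂μ, x ∈ A → W x = V (σ x)) (ε : ℝ)
    {w : Lp ℂ 2 ν × Lp ℂ 2 ν × Lp ℂ 2 ν × Lp ℂ 2 ν} (hw : w ∈ potentialGraph ν V) :
    quadMap ε (transferLp h) w ∈ potentialGraph μ W := by
  constructor
  · filter_upwards [coeFn_transferLp h w.1, coeFn_transferLp h w.2.2.1, h.ae_comp hw.1, hVW]
      with x h1 h2 h3 h4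
    simp only [quadMap_apply, h1, h2]
    by_cases hx : x ∈ A
    · simp [hx, h3 hx, h4 hx]
    · simp [hx]
  · filter_upwards [coeFn_transferLp h w.1, coeFn_transferLp h w.2.2.2, h.ae_comp hw.2, hVW]
      with x h1 h2 h3 h4
    simp only [quadMap_apply, h1, h2]
    by_cases hx : x ∈ A
    · simp [hx, h3 hx, h4 hx]
    · simp [hx]

/-- A map between form domains which has an adjoint maps eigenvectors to eigenvectors. -/
lemma map_mem_eigenLift {H K : Type*} [NormedAddCommGroup H] [InnerProductSpace ℂ H]
    [NormedAddCommGroup K] [InnerProductSpace ℂ K] {P : Submodule ℂ (H × H × H × H)}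
    {Q : Submodule ℂ (K × K × K × K)} {T : (H × H × H × H) →ₗ[ℂ] (K × K × K × K)}
    {T' : (K × K × K × K) →ₗ[ℂ] (H × H × H × H)} {E : ℝ}
    (hT' : ∀ u ∈ Q, T' u ∈ P)
    (hTT' : ∀ u w, shiftedForm H E (T' u) w = shiftedForm K E u (T w))
    {w : H × H × H × H} (hw : w ∈ eigenLift P E) (hTw : T w ∈ Q) : T w ∈ eigenLift Q E :=
  ⟨hTw, fun u hu => by rw [← hTT']; exact hw.2 _ (hT' u hu)⟩

end Transfer

/-! ### The star graph -/

section Star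

variable {N : ℕ}

lemma starMeasure_eq_sum (N : ℕ) :
    starMeasure N = ∑ j : Fin N, ((volume : Measure ℝ).restrict (Ioi 0)).map (Prod.mk j) := by
  ext s hs
  rw [starMeasure, Measure.prod_apply hs, lintegral_count, tsum_fintype, Measure.finsetSum_apply]
  refine Finset.sum_congr rfl fun j _ => ?_
  rw [Measure.map_apply measurable_prodMk_left hs]

lemma map_mk_le_starMeasure (j : Fin N) :
    ((volume : Measure ℝ).restrict (Ioi 0)).map (Prod.mk j) ≤ starMeasure N := by
  rw [starMeasure_eq_sum]
  exact Finset.single_le_sum (f := fun j : Fin N =>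
    ((volume : Measure ℝ).restrict (Ioi 0)).map (Prod.mk j)) (fun _ _ => Measure.zero_le _)
    (Finset.mem_univ j)

lemma lintegral_starMeasure (f : Fin N × ℝ → ℝ≥0∞) :
    ∫⁻ p, f p ∂(starMeasure N) = ∑ j, ∫⁻ x in Ioi (0 : ℝ), f (j, x) := by
  rw [starMeasure_eq_sum, lintegral_finsetSum_measure]
  exact Finset.sum_congr rfl fun j _ => (measurableEmbedding_prodMk_left j).lintegral_map f

lemma ae_starMeasure_iff {p : Fin N × ℝ → Prop} :
    (∀ᵐ q ∂(starMeasure N), p q) ↔ ∀ j, ∀ᵐ x ∂(volume.restrict (Ioi (0 : ℝ))), p (j, x) := by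
  rw [starMeasure_eq_sum, ae_finsetSum_measure_iff]
  simp only [Finset.mem_univ, true_imp_iff]
  exact forall_congr' fun j => (measurableEmbedding_prodMk_left j).ae_map_iff

lemma integral_starMeasure {E : Type*} [NormedAddCommGroup E] [NormedSpace ℝ E]
    {f : Fin N × ℝ → E} (hf : Integrable f (starMeasure N)) :
    ∫ p, f p ∂(starMeasure N) = ∑ j, ∫ x in Ioi (0 : ℝ), f (j, x) := by
  have h : ∀ j ∈ (Finset.univ : Finset (Fin N)),
      Integrable f (((volume : Measure ℝ).restrict (Ioi 0)).map (Prod.mk j)) :=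
    fun j _ => hf.mono_measure (map_mk_le_starMeasure j)
  rw [starMeasure_eq_sum, integral_finsetSum_measure h]
  exact Finset.sum_congr rfl fun j _ => (measurableEmbedding_prodMk_left j).integral_map f

lemma memLp_edge {E : Type*} [NormedAddCommGroup E] {f : Fin N × ℝ → E} {p : ℝ≥0∞}
    (hf : MemLp f p (starMeasure N)) (j : Fin N) :
    MemLp (fun x => f (j, x)) p (volume.restrict (Ioi (0 : ℝ))) :=
  (hf.mono_measure (map_mk_le_starMeasure j)).comp_of_map measurable_prodMk_left.aemeasurable

lemma starMeasure_edge_interval_ne_top (j : Fin N) (a b : ℝ) :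
    starMeasure N ({j} ×ˢ Ioc a b) ≠ ∞ := by
  rw [starMeasure, Measure.prod_prod]
  exact ENNReal.mul_ne_top (by simp)
    (ne_top_of_le_ne_top (by simp) (Measure.restrict_apply_le (s := Ioi (0 : ℝ)) (Ioc a b)))

/-- The indicator function of an interval on one edge of the star graph. -/
def edgeIndicator (j : Fin N) (a b : ℝ) : Lp ℂ 2 (starMeasure N) :=
  indicatorConstLp 2 ((measurableSet_singleton j).prod measurableSet_Ioc)
    (starMeasure_edge_interval_ne_top j a b) 1

/-- Writing primitives as L² pairings makes them linear and continuous in f, with no further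
integrability argument. -/
lemma inner_edgeIndicator (j : Fin N) {a b : ℝ} (ha : 0 ≤ a) (f : Lp ℂ 2 (starMeasure N)) :
    inner ℂ (edgeIndicator j a b) f = ∫ t in Ioc a b, f (j, t) := by
  have hms : MeasurableSet (({j} : Set (Fin N)) ×ˢ Ioc a b) :=
    (measurableSet_singleton j).prod measurableSet_Ioc
  rw [edgeIndicator, L2.inner_indicatorConstLp_one, ← integral_indicator hms]
  have hint : Integrable (indicator (({j} : Set (Fin N)) ×ˢ Ioc a b) f) (starMeasure N) := by
    rw [integrable_indicator_iff hms]
    have : IsFiniteMeasure ((starMeasure N).restrict ({j} ×ˢ Ioc a b)) :=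
      ⟨by simpa using (starMeasure_edge_interval_ne_top j a b).lt_top⟩
    exact ((Lp.memLp f).mono_measure Measure.restrict_le_self).integrable (by norm_num)
  rw [integral_starMeasure hint, Finset.sum_eq_single j]
  · rw [← integral_indicator measurableSet_Ioi, ← integral_indicator measurableSet_Ioc]
    refine integral_congr_ae (Eventually.of_forall fun t => ?_)
    by_cases h1 : t ∈ Ioc a b
    · have h2 : 0 < t := ha.trans_lt h1.1
      simp [indicator, h1.1, h1.2, h2]
    · have : (j, t) ∉ ({j} : Set (Fin N)) ×ˢ Ioc a b := fun h => h1 h.2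
      simp only [indicator, h1, this, if_false, ite_self]
  · intro i _ hij
    have : ∀ t, indicator (({j} : Set (Fin N)) ×ˢ Ioc a b) f (i, t) = 0 := fun t =>
      indicator_of_notMem (fun h => hij h.1) _
    simp [this]
  · simp

lemma intervalIntegral_edge (j : Fin N) {x : ℝ} (hx : 0 < x) (f : Lp ℂ 2 (starMeasure N)) :
    ∫ t in (0 : ℝ)..x, f (j, t) = inner ℂ (edgeIndicator j 0 x) f := by
  rw [inner_edgeIndicator j le_rfl, intervalIntegral.integral_of_le hx.le]

/-- The functions in `H¹` of each edge, together with their values at the ends of the edges. -/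
def edgeGraph (N : ℕ) : Submodule ℂ
    ((Lp ℂ 2 (starMeasure N) × Lp ℂ 2 (starMeasure N)) × (Fin N → ℂ)) where
  carrier := {q | ∀ᵐ p ∂(starMeasure N),
    q.1.1 p = q.2 p.1 + inner ℂ (edgeIndicator p.1 0 p.2) q.1.2}
  add_mem' := by
    intro a b ha hb
    filter_upwards [ha, hb, Lp.coeFn_add a.1.1 b.1.1] with p h1 h2 h3
    simp only [Prod.fst_add, Prod.snd_add, h3, Pi.add_apply, h1, h2, inner_add_right]; ring
  zero_mem' := by
    filter_upwards [Lp.coeFn_zero ℂ 2 (starMeasure N)] with p hp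
    simp only [Prod.fst_zero, Prod.snd_zero, hp, inner_zero_right, Pi.zero_apply, add_zero]
  smul_mem' := by
    intro z a ha
    filter_upwards [ha, Lp.coeFn_smul z a.1.1] with p h1 h3
    simp only [Prod.smul_fst, Prod.smul_snd, h3, Pi.smul_apply, h1, inner_smul_right, smul_eq_mul]
    ring

lemma mem_edgeGraph {q : (Lp ℂ 2 (starMeasure N) × Lp ℂ 2 (starMeasure N)) × (Fin N → ℂ)} :
    q ∈ edgeGraph N ↔ ∀ᵐ p ∂(starMeasure N),
      q.1.1 p = q.2 p.1 + inner ℂ (edgeIndicator p.1 0 p.2) q.1.2 := Iff.rfl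

lemma mem_sobolevStar_iff {u : Lp ℂ 2 (starMeasure N) × Lp ℂ 2 (starMeasure N)} :
    u ∈ sobolevStar N ↔ ∃ c : ℂ, (u, fun _ => c) ∈ edgeGraph N := by
  simp only [mem_edgeGraph, ae_starMeasure_iff]
  refine exists_congr fun c => forall_congr' fun j => eventually_congr ?_
  filter_upwards [ae_restrict_mem measurableSet_Ioi] with x hx
  rw [intervalIntegral_edge j hx]

/-- `H¹(Γ_N)` as a subspace. -/
def sobolevStarSubmodule (N : ℕ) :
    Submodule ℂ (Lp ℂ 2 (starMeasure N) × Lp ℂ 2 (starMeasure N)) where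
  carrier := sobolevStar N
  add_mem' := by
    intro a b ha hb
    rw [mem_sobolevStar_iff] at ha hb ⊢
    obtain ⟨c, hc⟩ := ha
    obtain ⟨d, hd⟩ := hb
    exact ⟨c + d, (edgeGraph N).add_mem hc hd⟩
  zero_mem' := mem_sobolevStar_iff.2 ⟨0, (edgeGraph N).zero_mem⟩
  smul_mem' := by
    intro z a ha
    rw [mem_sobolevStar_iff] at ha ⊢
    obtain ⟨c, hc⟩ := ha
    exact ⟨z * c, (edgeGraph N).smul_mem z hc⟩

/-- `H¹₀(Γ_N)`, the functions in `H¹(Γ_N)` which vanish at the vertex. -/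
def sobolevStarZero (N : ℕ) :
    Submodule ℂ (Lp ℂ 2 (starMeasure N) × Lp ℂ 2 (starMeasure N)) :=
  (edgeGraph N).comap ((LinearMap.id).prod 0)

lemma mem_sobolevStarZero {u : Lp ℂ 2 (starMeasure N) × Lp ℂ 2 (starMeasure N)} :
    u ∈ sobolevStarZero N ↔ (u, fun _ => 0) ∈ edgeGraph N := Iff.rfl

lemma sobolevStarZero_le : sobolevStarZero N ≤ sobolevStarSubmodule N := fun _ hu =>
  mem_sobolevStar_iff.2 ⟨0, hu⟩

/-- Primitives converge at every point and the functions converge almost everywhere along a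
subsequence, so the vertex values, being their differences, converge. As N > 0 the measure is
nonzero, and a single good point identifies the limit for all edges at once. -/
lemma isClosed_sobolevStar (hN : 0 < N) :
    IsClosed (sobolevStarSubmodule N :
      Set (Lp ℂ 2 (starMeasure N) × Lp ℂ 2 (starMeasure N))) := by
  refine IsSeqClosed.isClosed fun u v hu huv => ?_
  choose c hc using fun n => mem_sobolevStar_iff.1 (hu n)
  obtain ⟨φ, hφ, h1⟩ := exists_subseq_tendsto_ae ((continuous_fst.tendsto v).comp huv)
  have h2 : ∀ p : Fin N × ℝ, Tendsto (fun n => (inner ℂ (edgeIndicator p.1 0 p.2) (u n).2 : ℂ))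
      atTop (𝓝 (inner ℂ (edgeIndicator p.1 0 p.2) v.2)) := fun p =>
    tendsto_const_nhds.inner ((continuous_snd.tendsto v).comp huv)
  have h3 : ∀ᵐ p ∂(starMeasure N), Tendsto (fun n => c (φ n)) atTop
      (𝓝 (v.1 p - inner ℂ (edgeIndicator p.1 0 p.2) v.2)) := by
    filter_upwards [h1, ae_all_iff.2 hc] with p hp1 hp2
    refine (hp1.sub ((h2 p).comp hφ.tendsto_atTop)).congr fun n => ?_
    simp [hp2]
  have hne : (ae (starMeasure N)).NeBot := by
    rw [ae_neBot, ← Measure.measure_univ_ne_zero, starMeasure, ← univ_prod_univ, Measure.prod_prod]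
    simp [hN.ne']
  obtain ⟨p₀, hp₀⟩ := h3.exists
  refine mem_sobolevStar_iff.2 ⟨v.1 p₀ - inner ℂ (edgeIndicator p₀.1 0 p₀.2) v.2, ?_⟩
  filter_upwards [h3] with p hp
  rw [tendsto_nhds_unique hp₀ hp]; ring

end Star

/-! ### Compactness of the negative part of the potential -/

section HalfLine

/-- The Cauchy–Schwarz inequality, from nonnegativity of the variance of ‖g‖ on the interval. -/
lemma sq_setIntegral_norm_le {g : ℝ → ℂ} {a b : ℝ} (hab : a < b)
    (hg : MemLp g 2 (volume.restrict (Ioc a b))) :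
    (∫ t in Ioc a b, ‖g t‖) ^ 2 ≤ (b - a) * ∫ t in Ioc a b, ‖g t‖ ^ 2 := by
  have h1 : Integrable (fun t => ‖g t‖ ^ 2) (volume.restrict (Ioc a b)) :=
    (memLp_two_iff_integrable_sq_norm hg.1).1 hg
  have h2 : Integrable (fun t => ‖g t‖) (volume.restrict (Ioc a b)) :=
    (hg.integrable (by norm_num)).norm
  set m := ∫ t in Ioc a b, ‖g t‖ with hm
  have hl : 0 < b - a := by linarith
  have h3 : 0 ≤ ∫ t in Ioc a b, (‖g t‖ - m / (b - a)) ^ 2 := integral_nonneg fun _ => sq_nonneg _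
  have h4 : ∫ t in Ioc a b, (‖g t‖ - m / (b - a)) ^ 2
      = (∫ t in Ioc a b, ‖g t‖ ^ 2) - 2 * (m / (b - a)) * m + (m / (b - a)) ^ 2 * (b - a) := by
    have : ∀ t, (‖g t‖ - m / (b - a)) ^ 2
        = ‖g t‖ ^ 2 - 2 * (m / (b - a)) * ‖g t‖ + (m / (b - a)) ^ 2 := fun t => by ring
    simp only [this]
    have h5 : Integrable (fun t => ‖g t‖ ^ 2 - 2 * (m / (b - a)) * ‖g t‖)
        (volume.restrict (Ioc a b)) := h1.sub (h2.const_mul _)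
    rw [integral_add h5 (integrable_const _), integral_sub h1 (h2.const_mul _),
      integral_const_mul, integral_const, ← hm]
    simp [hl.le, mul_comm]
  rw [h4] at h3
  have h5 : (b - a) * ((∫ t in Ioc a b, ‖g t‖ ^ 2) - 2 * (m / (b - a)) * m
      + (m / (b - a)) ^ 2 * (b - a)) = (b - a) * (∫ t in Ioc a b, ‖g t‖ ^ 2) - m ^ 2 := by
    field_simp; ring
  have h6 := mul_nonneg hl.le h3
  rw [h5] at h6
  linarith

/-- A function on an interval is controlled by its derivative and its mean value. -/
lemma sq_norm_le_of_interval {ψ' : ℝ → ℂ} {c : ℂ} {a b x : ℝ} (ha : 0 ≤ a) (hab : a < b)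
    (hψ' : MemLp ψ' 2 (volume.restrict (Ioi 0))) (hx : x ∈ Ioc a b) :
    ‖c + ∫ t in (0 : ℝ)..x, ψ' t‖ ^ 2 ≤ 2 * (b - a) * (∫ t in Ioc a b, ‖ψ' t‖ ^ 2)
      + 2 / (b - a) ^ 2 * ‖∫ y in Ioc a b, (c + ∫ t in (0 : ℝ)..y, ψ' t)‖ ^ 2 := by
  set Ψ : ℝ → ℂ := fun y => c + ∫ t in (0 : ℝ)..y, ψ' t with hΨ
  have hl : 0 < b - a := by linarith
  have hsub : Ioc 0 b ⊆ Ioi 0 := fun y hy => hy.1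
  have hIocb : MemLp ψ' 2 (volume.restrict (Ioc 0 b)) :=
    hψ'.mono_measure (Measure.restrict_mono hsub le_rfl)
  have hint : IntegrableOn ψ' (Ioc 0 b) := hIocb.integrable (by norm_num)
  have hJ : MemLp ψ' 2 (volume.restrict (Ioc a b)) :=
    hIocb.mono_measure (Measure.restrict_mono (Ioc_subset_Ioc_left ha) le_rfl)
  have hii : ∀ y ∈ Icc 0 b, ∀ z ∈ Icc 0 b, IntervalIntegrable ψ' volume y z := by
    intro y hy z hz
    have : IntervalIntegrable ψ' volume 0 b := by
      rw [intervalIntegrable_iff_integrableOn_Ioc_of_le (by linarith)]; exact hint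
    refine this.mono_set ?_
    rw [uIcc_of_le (by linarith : (0 : ℝ) ≤ b)]
    exact uIcc_subset_Icc hy hz
  set B := ∫ t in Ioc a b, ‖ψ' t‖ with hB
  have hdiff : ∀ y ∈ Ioc a b, ‖Ψ x - Ψ y‖ ≤ B := by
    intro y hy
    have h0 : (0 : ℝ) ∈ Icc 0 b := ⟨le_rfl, by linarith⟩
    have hx' : x ∈ Icc 0 b := ⟨by linarith [hx.1], hx.2⟩
    have hy' : y ∈ Icc 0 b := ⟨by linarith [hy.1], hy.2⟩
    have h1 : Ψ x - Ψ y = ∫ t in y..x, ψ' t := by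
      simp only [hΨ]
      rw [← intervalIntegral.integral_add_adjacent_intervals (hii 0 h0 y hy') (hii y hy' x hx')]
      ring
    rw [h1]
    refine intervalIntegral.norm_integral_le_integral_norm_uIoc.trans ?_
    refine setIntegral_mono_set (hJ.integrable (by norm_num)).norm
      (Eventually.of_forall fun _ => norm_nonneg _) (LE.le.eventuallyLE ?_)
    intro t ht
    rw [mem_uIoc] at ht
    rcases ht with h | h
    · exact ⟨by linarith [hy.1], by linarith [hx.2]⟩
    · exact ⟨by linarith [hx.1], by linarith [hy.2]⟩
  have hΨc : ContinuousOn Ψ (Icc 0 b) := by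
    refine continuousOn_const.add ?_
    have h := intervalIntegral.continuousOn_primitive_interval (μ := volume) (f := ψ') (a := 0)
      (b := b) (by
        rw [uIcc_of_le (by linarith : (0 : ℝ) ≤ b), integrableOn_Icc_iff_integrableOn_Ioc]
        exact hint)
    rwa [uIcc_of_le (by linarith : (0 : ℝ) ≤ b)] at h
  have hΨi : IntegrableOn Ψ (Ioc a b) :=
    (hΨc.integrableOn_Icc).mono_set fun y hy => ⟨by linarith [hy.1], hy.2⟩
  -- Averaging over y compares the value at x with the mean; the oscillation on the interval is at
  -- most B.
  have hmean : ((b - a : ℝ) : ℂ) * Ψ x - ∫ y in Ioc a b, Ψ y = ∫ y in Ioc a b, (Ψ x - Ψ y) := by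
    rw [integral_sub (integrable_const _) hΨi, integral_const]
    simp [hl.le]
  have hmean2 : ‖((b - a : ℝ) : ℂ) * Ψ x - ∫ y in Ioc a b, Ψ y‖ ≤ B * (b - a) := by
    rw [hmean]
    have := norm_setIntegral_le_of_norm_le_const (μ := volume) (s := Ioc a b)
      (f := fun y => Ψ x - Ψ y) (C := B) (by simp) hdiff
    simpa [hl.le] using this
  set s := ∫ y in Ioc a b, Ψ y
  have h1 : (b - a) * ‖Ψ x‖ ≤ B * (b - a) + ‖s‖ := by
    have : ‖((b - a : ℝ) : ℂ) * Ψ x‖ = (b - a) * ‖Ψ x‖ := by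
      rw [norm_mul, Complex.norm_real, Real.norm_of_nonneg hl.le]
    rw [← this]
    calc ‖((b - a : ℝ) : ℂ) * Ψ x‖ = ‖(((b - a : ℝ) : ℂ) * Ψ x - s) + s‖ := by congr 1; ring
      _ ≤ _ := (norm_add_le _ _).trans (by gcongr)
  have h2 : ‖Ψ x‖ ≤ B + ‖s‖ / (b - a) := by
    have : B + ‖s‖ / (b - a) = (B * (b - a) + ‖s‖) / (b - a) := by field_simp
    rw [this, le_div_iff₀ hl]; linarith
  have h3 : ‖Ψ x‖ ^ 2 ≤ (B + ‖s‖ / (b - a)) ^ 2 := by gcongr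
  have h4 : (B + ‖s‖ / (b - a)) ^ 2 ≤ 2 * B ^ 2 + 2 * (‖s‖ / (b - a)) ^ 2 := by
    nlinarith [sq_nonneg (B - ‖s‖ / (b - a))]
  have h5 := sq_setIntegral_norm_le hab hJ
  have h6 : 2 * (‖s‖ / (b - a)) ^ 2 = 2 / (b - a) ^ 2 * ‖s‖ ^ 2 := by field_simp
  linarith

lemma iUnion_Ioc_grid {l : ℝ} (hl : 0 < l) :
    ⋃ i : ℕ, Ioc (i * l) ((i + 1) * l) = Ioi (0 : ℝ) := by
  ext x
  simp only [mem_iUnion, mem_Ioc, mem_Ioi]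
  constructor
  · rintro ⟨i, h1, -⟩; exact lt_of_le_of_lt (by positivity) h1
  · intro hx
    have h1 : 0 < ⌈x / l⌉₊ := Nat.ceil_pos.2 (by positivity)
    refine ⟨⌈x / l⌉₊ - 1, ?_, ?_⟩
    · rw [← lt_div_iff₀ hl, Nat.cast_sub h1]
      have := Nat.ceil_lt_add_one (show 0 ≤ x / l by positivity)
      push_cast; linarith
    · rw [← div_le_iff₀ hl, Nat.cast_sub h1]
      have := Nat.le_ceil (x / l)
      push_cast; linarith

lemma pairwise_disjoint_Ioc_grid {l : ℝ} (hl : 0 < l) :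
    Pairwise (Function.onFun Disjoint fun i : ℕ => Ioc (i * l) ((i + 1) * l)) := by
  have key : ∀ i j : ℕ, i < j →
      Disjoint (Ioc (i * l) ((i + 1) * l)) (Ioc (j * l) ((j + 1) * l)) := by
    intro i j hij
    rw [Set.disjoint_left]
    rintro x ⟨-, h1⟩ ⟨h2, -⟩
    have : ((i : ℝ) + 1) * l ≤ j * l := by
      gcongr; exact_mod_cast hij
    linarith
  intro i j hij
  rcases lt_or_gt_of_ne hij with h | h
  · exact key i j h
  · exact (key j i h).symm

/-- An integrable weight is form compact on `H¹(0, ∞)`. -/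
lemma exists_lintegral_mul_sq_le {v : ℝ → ℝ≥0∞} (hv : ∫⁻ x in Ioi (0 : ℝ), v x ≠ ∞)
    {δ : ℝ} (hδ : 0 < δ) :
    ∃ (l C : ℝ) (M : ℕ), 0 < l ∧ 0 ≤ C ∧ ∀ (ψ' : ℝ → ℂ) (c : ℂ),
      MemLp ψ' 2 (volume.restrict (Ioi 0)) →
      MemLp (fun x => c + ∫ t in (0 : ℝ)..x, ψ' t) 2 (volume.restrict (Ioi 0)) →
      ∫⁻ x in Ioi (0 : ℝ), v x * ENNReal.ofReal (‖c + ∫ t in (0 : ℝ)..x, ψ' t‖ ^ 2)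
        ≤ ENNReal.ofReal (δ * ((∫ x in Ioi (0 : ℝ), ‖c + ∫ t in (0 : ℝ)..x, ψ' t‖ ^ 2)
          + ∫ x in Ioi (0 : ℝ), ‖ψ' x‖ ^ 2)
          + C * ∑ i : Fin M, ‖∫ x in Ioc ((i : ℕ) * l) (((i : ℕ) + 1) * l),
            (c + ∫ t in (0 : ℝ)..x, ψ' t)‖ ^ 2) := by
  set A := (∫⁻ x in Ioi (0 : ℝ), v x).toReal with hA
  have hA0 : 0 ≤ A := ENNReal.toReal_nonneg
  have hAv : ∫⁻ x in Ioi (0 : ℝ), v x = ENNReal.ofReal A := (ENNReal.ofReal_toReal hv).symm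
  -- The derivative term on a cell of length l costs at most 2l times the mass of v; with this l,
  -- 2lA ≤ δ.
  set l := δ / (2 * (A + 1)) with hl
  have hl0 : 0 < l := by positivity
  set J : ℕ → Set ℝ := fun i => Ioc (i * l) ((i + 1) * l) with hJ
  have hJm : ∀ i, MeasurableSet (J i) := fun i => measurableSet_Ioc
  set a : ℕ → ℝ≥0∞ := fun i => ∫⁻ x in J i, v x with ha
  have hsum : ∀ f : ℝ → ℝ≥0∞, ∫⁻ x in Ioi (0 : ℝ), f x = ∑' i, ∫⁻ x in J i, f x := by
    intro f
    rw [← iUnion_Ioc_grid hl0, lintegral_iUnion hJm (pairwise_disjoint_Ioc_grid hl0)]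
  have hasum : ∑' i, a i = ENNReal.ofReal A := by rw [← hAv, hsum]
  have htail := ENNReal.tendsto_sum_nat_add a (by rw [hasum]; exact ENNReal.ofReal_ne_top)
  -- Beyond M cells the mass of v is below δl/2. There the mean term is at most (2/l)R, so the tail
  -- costs at most δR. Only the first M means remain, and these are the finitely many functionals.
  obtain ⟨M, hM⟩ := (htail.eventually (gt_mem_nhds (show (0 : ℝ≥0∞) < ENNReal.ofReal (δ * l / 2)
    by rw [ENNReal.ofReal_pos]; positivity))).exists
  refine ⟨l, A * (2 / l ^ 2), M, hl0, by positivity, fun ψ' c hψ' hΨ => ?_⟩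
  set Ψ : ℝ → ℂ := fun x => c + ∫ t in (0 : ℝ)..x, ψ' t with hΨdef
  set P := ∫ x in Ioi (0 : ℝ), ‖ψ' x‖ ^ 2 with hP
  set R := ∫ x in Ioi (0 : ℝ), ‖Ψ x‖ ^ 2 with hR
  have hP0 : 0 ≤ P := integral_nonneg fun _ => sq_nonneg _
  have hR0 : 0 ≤ R := integral_nonneg fun _ => sq_nonneg _
  set s : ℕ → ℝ := fun i => ‖∫ x in J i, Ψ x‖ ^ 2 with hs
  have hJlen : ∀ i : ℕ, (((i : ℝ) + 1) * l) - i * l = l := fun i => by ring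
  have hJlt : ∀ i : ℕ, (i : ℝ) * l < ((i : ℝ) + 1) * l := fun i => by linarith [hJlen i]
  have hJsub : ∀ i, J i ⊆ Ioi 0 := by
    intro i x hx
    exact lt_of_le_of_lt (by positivity) hx.1
  have hpart : ∀ (g : ℝ → ℂ), MemLp g 2 (volume.restrict (Ioi 0)) → ∀ i,
      ∫ x in J i, ‖g x‖ ^ 2 ≤ ∫ x in Ioi (0 : ℝ), ‖g x‖ ^ 2 := fun g hg i =>
    setIntegral_mono_set ((memLp_two_iff_integrable_sq_norm hg.1).1 hg)
      (Eventually.of_forall fun _ => sq_nonneg _) (LE.le.eventuallyLE (hJsub i))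
  have hpt : ∀ i, ∀ x ∈ J i, ‖Ψ x‖ ^ 2 ≤ 2 * l * P + 2 / l ^ 2 * s i := by
    intro i x hx
    have := sq_norm_le_of_interval (c := c) (by positivity) (hJlt i) hψ' hx
    rw [hJlen] at this
    refine this.trans ?_
    have h1 := hpart ψ' hψ' i
    simp only [hJ] at h1
    gcongr
  have hs_le : ∀ i, s i ≤ l * R := by
    intro i
    have hmem : MemLp Ψ 2 (volume.restrict (J i)) :=
      hΨ.mono_measure (Measure.restrict_mono (hJsub i) le_rfl)
    have h1 := sq_setIntegral_norm_le (hJlt i) hmem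
    rw [hJlen] at h1
    have h2 : ‖∫ x in J i, Ψ x‖ ≤ ∫ x in J i, ‖Ψ x‖ := norm_integral_le_integral_norm _
    calc s i ≤ (∫ x in J i, ‖Ψ x‖) ^ 2 := by simp only [hs]; gcongr
      _ ≤ l * ∫ x in J i, ‖Ψ x‖ ^ 2 := h1
      _ ≤ l * R := by gcongr; exact hpart Ψ hΨ i
  have hs0 : ∀ i, 0 ≤ s i := fun i => sq_nonneg _
  have hterm : ∀ i, ∫⁻ x in J i, v x * ENNReal.ofReal (‖Ψ x‖ ^ 2)
      ≤ a i * ENNReal.ofReal (2 * l * P) + a i * ENNReal.ofReal (2 / l ^ 2 * s i) := by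
    intro i
    rw [← mul_add, ← ENNReal.ofReal_add (by positivity) (by have := hs0 i; positivity), ha,
      ← lintegral_mul_const' _ _ ENNReal.ofReal_ne_top]
    refine setLIntegral_mono' (hJm i) fun x hx => ?_
    gcongr
    exact hpt i x hx
  have hhead : ∑ i ∈ Finset.range M, a i * ENNReal.ofReal (2 / l ^ 2 * s i)
      ≤ ENNReal.ofReal (A * (2 / l ^ 2) * ∑ i : Fin M, s i) := by
    have h1 : ∀ i, a i ≤ ENNReal.ofReal A := fun i => hasum ▸ ENNReal.le_tsum i
    have h2 : ∑ i : Fin M, s i = ∑ i ∈ Finset.range M, s i := Fin.sum_univ_eq_sum_range s M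
    rw [h2, Finset.mul_sum, ENNReal.ofReal_sum_of_nonneg (fun i _ => by have := hs0 i; positivity)]
    refine Finset.sum_le_sum fun i _ => ?_
    rw [mul_assoc, ENNReal.ofReal_mul hA0]
    gcongr
    exact h1 i
  have htl : ∑' i, a (i + M) * ENNReal.ofReal (2 / l ^ 2 * s (i + M))
      ≤ ENNReal.ofReal (δ * R) := by
    calc ∑' i, a (i + M) * ENNReal.ofReal (2 / l ^ 2 * s (i + M))
        ≤ ∑' i, a (i + M) * ENNReal.ofReal (2 / l * R) := by
          refine ENNReal.tsum_le_tsum fun i => ?_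
          refine mul_le_mul_right (ENNReal.ofReal_le_ofReal ?_) _
          calc 2 / l ^ 2 * s (i + M) ≤ 2 / l ^ 2 * (l * R) := by gcongr; exact hs_le _
            _ = 2 / l * R := by field_simp
      _ = (∑' i, a (i + M)) * ENNReal.ofReal (2 / l * R) := ENNReal.tsum_mul_right
      _ ≤ ENNReal.ofReal (δ * l / 2) * ENNReal.ofReal (2 / l * R) := by gcongr
      _ = ENNReal.ofReal (δ * R) := by
          rw [← ENNReal.ofReal_mul (by positivity)]; congr 1; field_simp
  rw [hsum]
  calc ∑' i, ∫⁻ x in J i, v x * ENNReal.ofReal (‖Ψ x‖ ^ 2)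
      ≤ ∑' i, (a i * ENNReal.ofReal (2 * l * P) + a i * ENNReal.ofReal (2 / l ^ 2 * s i)) :=
        ENNReal.tsum_le_tsum hterm
    _ = ENNReal.ofReal A * ENNReal.ofReal (2 * l * P)
        + (∑ i ∈ Finset.range M, a i * ENNReal.ofReal (2 / l ^ 2 * s i)
          + ∑' i, a (i + M) * ENNReal.ofReal (2 / l ^ 2 * s (i + M))) := by
        rw [ENNReal.tsum_add, ENNReal.tsum_mul_right, hasum,
          ENNReal.summable.sum_add_tsum_nat_add'
            (f := fun i => a i * ENNReal.ofReal (2 / l ^ 2 * s i))]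
    _ ≤ ENNReal.ofReal (δ * P) + (ENNReal.ofReal (A * (2 / l ^ 2) * ∑ i : Fin M, s i)
          + ENNReal.ofReal (δ * R)) := by
        gcongr
        rw [← ENNReal.ofReal_mul hA0]
        refine ENNReal.ofReal_le_ofReal ?_
        have h1 : A * (2 * l * P) = (A / (A + 1)) * δ * P := by rw [hl]; field_simp
        have h2 : A / (A + 1) ≤ 1 := by rw [div_le_one (by positivity)]; linarith
        rw [h1]
        calc A / (A + 1) * δ * P ≤ 1 * δ * P := by gcongr
          _ = δ * P := by ring
    _ = _ := by
        have h0 : 0 ≤ ∑ i : Fin M, s i := Finset.sum_nonneg fun i _ => hs0 i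
        rw [← ENNReal.ofReal_add (by positivity) (by positivity),
          ← ENNReal.ofReal_add (by positivity) (by positivity)]
        congr 1
        ring

end HalfLine

/-! ### Coercivity of the form on the star graph -/

section StarCoercive

variable {N : ℕ}

/-- A weight in `L^p` splits into a small constant and an integrable weight. -/
lemma exists_le_add_of_memLp {X : Type*} [MeasurableSpace X] {μ : Measure X} {v : X → ℝ}
    (hv0 : ∀ x, 0 ≤ v x) {p : ℝ≥0∞} (hp1 : 1 ≤ p) (hp : p ≠ ∞) (hv : MemLp v p μ) {η : ℝ}
    (hη : 0 < η) :
    ∃ w : X → ℝ≥0∞, AEMeasurable w μ ∧ ∫⁻ x, w x ∂μ ≠ ∞ ∧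
      ∀ x, ENNReal.ofReal (v x) ≤ ENNReal.ofReal η + w x := by
  set r := p.toReal with hr
  have hr1 : 1 ≤ r := by
    rw [hr, ← ENNReal.toReal_one]; exact ENNReal.toReal_mono hp hp1
  -- Where v > η, v = v^(1-r) v^r ≤ η^(1-r) v^r because r ≥ 1, and v^r is integrable.
  refine ⟨fun x => ENNReal.ofReal (η ^ (1 - r)) * ‖v x‖ₑ ^ r,
    (hv.aestronglyMeasurable.aemeasurable.enorm.pow_const r).const_mul _, ?_, fun x => ?_⟩
  · rw [lintegral_const_mul' _ _ ENNReal.ofReal_ne_top]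
    exact ENNReal.mul_ne_top ENNReal.ofReal_ne_top
      (lintegral_rpow_enorm_lt_top_of_eLpNorm_lt_top (zero_lt_one.trans_le hp1).ne' hp hv.2).ne
  · rcases le_or_gt (v x) η with h | h
    · exact (ENNReal.ofReal_le_ofReal h).trans le_self_add
    · refine le_trans ?_ le_add_self
      have hvx : 0 < v x := hη.trans h
      beta_reduce
      rw [Real.enorm_of_nonneg (hv0 x), ENNReal.ofReal_rpow_of_pos hvx,
        ← ENNReal.ofReal_mul (by positivity)]
      refine ENNReal.ofReal_le_ofReal ?_
      have h1 : v x ^ (1 - r) ≤ η ^ (1 - r) :=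
        Real.rpow_le_rpow_of_nonpos hη h.le (by linarith)
      calc v x = v x ^ (1 - r) * v x ^ r := by
            rw [← Real.rpow_add hvx]; simp
        _ ≤ _ := by gcongr

lemma norm_sq_eq_integral {X : Type*} [MeasurableSpace X] {μ : Measure X} (f : Lp ℂ 2 μ) :
    ∫ x, ‖f x‖ ^ 2 ∂μ = ‖f‖ ^ 2 := by
  have := (integrable_mul_sq_of_ae_eq (b := fun _ => 1) (fun _ => zero_le_one) (f := f) (g := f)
    (by simp)).2
  simpa using this

lemma norm_sq_eq_sum_edges (f : Lp ℂ 2 (starMeasure N)) :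
    ‖f‖ ^ 2 = ∑ j, ∫ x in Ioi (0 : ℝ), ‖f (j, x)‖ ^ 2 := by
  rw [← norm_sq_eq_integral, integral_starMeasure]
  exact (memLp_two_iff_integrable_sq_norm (Lp.aestronglyMeasurable f)).1 (Lp.memLp f)

/-- A weight in `L^p` is form compact on `H¹(Γ_N)`. -/
lemma exists_star_lintegral_mul_sq_le {v : Fin N × ℝ → ℝ} (hv0 : ∀ x, 0 ≤ v x) {p : ℝ≥0∞}
    (hp1 : 1 ≤ p) (hp : p ≠ ∞) (hv : MemLp v p (starMeasure N)) {δ : ℝ} (hδ : 0 < δ) :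
    ∃ (C : ℝ) (m : ℕ) (g : Fin m → Lp ℂ 2 (starMeasure N)), 0 ≤ C ∧
      ∀ u ∈ sobolevStar N, ∫⁻ x, ENNReal.ofReal (v x * ‖u.1 x‖ ^ 2) ∂(starMeasure N)
        ≤ ENNReal.ofReal (δ * (‖u.1‖ ^ 2 + ‖u.2‖ ^ 2)
          + C * ∑ i, ‖(inner ℂ (g i) u.1 : ℂ)‖ ^ 2) := by
  obtain ⟨w, hwm, hw, hvw⟩ := exists_le_add_of_memLp hv0 hp1 hp hv (half_pos hδ)
  have hwj : ∀ j, ∫⁻ x in Ioi (0 : ℝ), w (j, x) ≠ ∞ := by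
    rw [lintegral_starMeasure] at hw
    exact fun j => (ENNReal.sum_ne_top.1 hw) j (Finset.mem_univ j)
  choose l C M hl hC hbd using fun j => exists_lintegral_mul_sq_le (hwj j) (half_pos hδ)
  let e := Fintype.equivFin (Σ j : Fin N, Fin (M j))
  let G : (Σ j : Fin N, Fin (M j)) → Lp ℂ 2 (starMeasure N) := fun q =>
    edgeIndicator q.1 ((q.2 : ℕ) * l q.1) (((q.2 : ℕ) + 1) * l q.1)
  refine ⟨∑ j, C j, _, fun i => G (e.symm i), Finset.sum_nonneg fun j _ => hC j, ?_⟩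
  rintro u ⟨c, hc⟩
  have hsum : ∑ i, ‖(inner ℂ (G (e.symm i)) u.1 : ℂ)‖ ^ 2
      = ∑ j, ∑ i : Fin (M j),
        ‖∫ x in Ioc ((i : ℕ) * l j) (((i : ℕ) + 1) * l j), u.1 (j, x)‖ ^ 2 := by
    rw [e.symm.sum_comp (fun q => ‖(inner ℂ (G q) u.1 : ℂ)‖ ^ 2), Fintype.sum_sigma]
    refine Finset.sum_congr rfl fun j _ => Finset.sum_congr rfl fun i _ => ?_
    rw [inner_edgeIndicator j (by have := hl j; positivity)]
  rw [hsum]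
  set S : Fin N → ℝ := fun j => ∑ i : Fin (M j),
    ‖∫ x in Ioc ((i : ℕ) * l j) (((i : ℕ) + 1) * l j), u.1 (j, x)‖ ^ 2 with hS
  have hS0 : ∀ j, 0 ≤ S j := fun j => Finset.sum_nonneg fun _ _ => sq_nonneg _
  set R : Fin N → ℝ := fun j => ∫ x in Ioi (0 : ℝ), ‖u.1 (j, x)‖ ^ 2 with hR
  set P : Fin N → ℝ := fun j => ∫ x in Ioi (0 : ℝ), ‖u.2 (j, x)‖ ^ 2 with hP
  have hR0 : ∀ j, 0 ≤ R j := fun j => integral_nonneg fun _ => sq_nonneg _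
  have hP0 : ∀ j, 0 ≤ P j := fun j => integral_nonneg fun _ => sq_nonneg _
  have hedge : ∀ j, ∫⁻ x in Ioi (0 : ℝ), w (j, x) * ENNReal.ofReal (‖u.1 (j, x)‖ ^ 2)
      ≤ ENNReal.ofReal (δ / 2 * (R j + P j) + C j * S j) := by
    intro j
    have hΨ : MemLp (fun x => c + ∫ t in (0 : ℝ)..x, u.2 (j, t)) 2 (volume.restrict (Ioi 0)) :=
      (memLp_congr_ae (hc j)).1 (memLp_edge (Lp.memLp u.1) j)
    have h1 := hbd j (fun x => u.2 (j, x)) c (memLp_edge (Lp.memLp u.2) j) hΨ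
    have h2 : ∫⁻ x in Ioi (0 : ℝ), w (j, x) * ENNReal.ofReal (‖u.1 (j, x)‖ ^ 2)
        = ∫⁻ x in Ioi (0 : ℝ), w (j, x)
          * ENNReal.ofReal (‖c + ∫ t in (0 : ℝ)..x, u.2 (j, t)‖ ^ 2) := by
      refine lintegral_congr_ae ?_
      filter_upwards [hc j] with x hx
      rw [hx]
    have h3 : R j = ∫ x in Ioi (0 : ℝ), ‖c + ∫ t in (0 : ℝ)..x, u.2 (j, t)‖ ^ 2 := by
      refine integral_congr_ae ?_
      filter_upwards [hc j] with x hx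
      rw [hx]
    have h4 : S j = ∑ i : Fin (M j), ‖∫ x in Ioc ((i : ℕ) * l j) (((i : ℕ) + 1) * l j),
        (c + ∫ t in (0 : ℝ)..x, u.2 (j, t))‖ ^ 2 := by
      refine Finset.sum_congr rfl fun i _ => ?_
      congr 2
      have hsub : Ioc ((i : ℕ) * l j) (((i : ℕ) + 1) * l j) ⊆ Ioi 0 := fun x hx =>
        lt_of_le_of_lt (by have := hl j; positivity) hx.1
      exact integral_congr_ae (ae_mono (Measure.restrict_mono hsub le_rfl) (hc j))
    rw [h2, h3, h4]
    exact h1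
  have hpw : ∀ x, ENNReal.ofReal (v x * ‖u.1 x‖ ^ 2)
      ≤ ENNReal.ofReal (δ / 2 * ‖u.1 x‖ ^ 2) + w x * ENNReal.ofReal (‖u.1 x‖ ^ 2) := by
    intro x
    rw [ENNReal.ofReal_mul (hv0 x), ENNReal.ofReal_mul (by positivity : 0 ≤ δ / 2), ← add_mul]
    gcongr
    exact hvw x
  have hint : Integrable (fun x => ‖u.1 x‖ ^ 2) (starMeasure N) :=
    (memLp_two_iff_integrable_sq_norm (Lp.aestronglyMeasurable u.1)).1 (Lp.memLp u.1)
  have hfirst : ∫⁻ x, ENNReal.ofReal (δ / 2 * ‖u.1 x‖ ^ 2) ∂(starMeasure N)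
      = ENNReal.ofReal (δ / 2 * ‖u.1‖ ^ 2) := by
    rw [← ofReal_integral_eq_lintegral_ofReal (hint.const_mul _)
      (Eventually.of_forall fun x => by positivity), integral_const_mul, norm_sq_eq_integral]
  calc ∫⁻ x, ENNReal.ofReal (v x * ‖u.1 x‖ ^ 2) ∂(starMeasure N)
      ≤ ∫⁻ x, (ENNReal.ofReal (δ / 2 * ‖u.1 x‖ ^ 2)
        + w x * ENNReal.ofReal (‖u.1 x‖ ^ 2)) ∂(starMeasure N) := lintegral_mono hpw
    _ = ENNReal.ofReal (δ / 2 * ‖u.1‖ ^ 2)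
        + ∑ j, ∫⁻ x in Ioi (0 : ℝ), w (j, x) * ENNReal.ofReal (‖u.1 (j, x)‖ ^ 2) := by
        rw [lintegral_add_left' (hint.const_mul _).aemeasurable.ennreal_ofReal, hfirst,
          lintegral_starMeasure]
    _ ≤ ENNReal.ofReal (δ / 2 * ‖u.1‖ ^ 2)
        + ∑ j, ENNReal.ofReal (δ / 2 * (R j + P j) + C j * S j) := by
        gcongr with j; exact hedge j
    _ = ENNReal.ofReal (δ / 2 * ‖u.1‖ ^ 2 + ∑ j, (δ / 2 * (R j + P j) + C j * S j)) := by
        have h0 : ∀ j, 0 ≤ δ / 2 * (R j + P j) + C j * S j := fun j => by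
          have := hR0 j; have := hP0 j; have := hC j; have := hS0 j; positivity
        rw [← ENNReal.ofReal_sum_of_nonneg fun j _ => h0 j,
          ← ENNReal.ofReal_add (by positivity) (Finset.sum_nonneg fun j _ => h0 j)]
    _ ≤ _ := by
        refine ENNReal.ofReal_le_ofReal ?_
        have h1 : ∑ j, (δ / 2 * (R j + P j) + C j * S j)
            = δ / 2 * (‖u.1‖ ^ 2 + ‖u.2‖ ^ 2) + ∑ j, C j * S j := by
          rw [norm_sq_eq_sum_edges u.1, norm_sq_eq_sum_edges u.2, Finset.sum_add_distrib,
            ← Finset.mul_sum, Finset.sum_add_distrib]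
        have h2 : ∑ j, C j * S j ≤ (∑ j, C j) * ∑ j, S j := by
          rw [Finset.mul_sum]
          refine Finset.sum_le_sum fun j _ => ?_
          gcongr
          exact Finset.single_le_sum (f := C) (fun i _ => hC i) (Finset.mem_univ j)
        rw [h1]
        have h3 : 0 ≤ δ / 2 * ‖u.2‖ ^ 2 := by positivity
        linarith

lemma integrable_negPart_mul_sq_star {V : Fin N × ℝ → ℝ} {p : ℝ≥0∞} (hp1 : 1 ≤ p) (hp : p ≠ ∞)
    (hV : MemLp (fun x => (V x)⁻) p (starMeasure N))
    {u : Lp ℂ 2 (starMeasure N) × Lp ℂ 2 (starMeasure N)} (hu : u ∈ sobolevStar N) :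
    Integrable (fun x => (V x)⁻ * ‖u.1 x‖ ^ 2) (starMeasure N) := by
  obtain ⟨C, m, g, -, h⟩ := exists_star_lintegral_mul_sq_le (fun x => negPart_nonneg (V x)) hp1 hp
    hV zero_lt_one
  have hm : AEStronglyMeasurable (fun x => (V x)⁻ * ‖u.1 x‖ ^ 2) (starMeasure N) :=
    hV.aestronglyMeasurable.mul ((Lp.aestronglyMeasurable u.1).norm.pow 2)
  refine ⟨hm, ?_⟩
  rw [hasFiniteIntegral_iff_ofReal (Eventually.of_forall fun x => by
    have := negPart_nonneg (V x); positivity)]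
  exact (h u hu).trans_lt ENNReal.ofReal_lt_top

/-- Below every negative level, the form of `-d²/dx² + V` on the star graph is coercive up to
finitely many functionals. -/
lemma isCoerciveBelow_star {V : Fin N × ℝ → ℝ} {p : ℝ≥0∞} (hp1 : 1 ≤ p) (hp : p ≠ ∞)
    (hV : MemLp (fun x => (V x)⁻) p (starMeasure N)) {E : ℝ} (hE : E < 0) :
    IsCoerciveBelow (formGraph (sobolevStarSubmodule N) V) E := by
  set κ := min 1 (-E) with hκ
  have hκ0 : 0 < κ := lt_min zero_lt_one (by linarith)
  obtain ⟨C, m, g, hC, h⟩ := exists_star_lintegral_mul_sq_le (fun x => negPart_nonneg (V x)) hp1 hp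
    hV (show 0 < κ / 4 by positivity)
  -- Adding κ/2 times the V₋ term costs at most 3/2 of it, since κ ≤ 1. Its bound with κ/4 turns
  -- this into (3κ/8)(‖ψ‖² + ‖ψ'‖²) plus (3/2)C times the functionals, within the available κ/2 and
  -- 2C.
  refine ⟨κ / 2, 2 * C, m, g, by positivity, by positivity, fun w hw => ?_⟩
  have h1 := integrable_mul_sq_of_ae_eq (fun x => negPart_nonneg (V x)) hw.1.2
  have h2 := h (w.1, w.2.1) hw.2
  rw [← ofReal_integral_eq_lintegral_ofReal h1.1 (Eventually.of_forall fun x => by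
    have := negPart_nonneg (V x); positivity), h1.2] at h2
  have hS : 0 ≤ ∑ i, ‖(inner ℂ (g i) w.1 : ℂ)‖ ^ 2 := Finset.sum_nonneg fun _ _ => sq_nonneg _
  rw [ENNReal.ofReal_le_ofReal_iff (by positivity)] at h2
  rw [shiftedForm_self_re]
  have hκ1 : κ ≤ 1 := min_le_left _ _
  have hκE : κ ≤ -E := min_le_right _ _
  have e1 : κ * ‖w.1‖ ^ 2 ≤ -E * ‖w.1‖ ^ 2 := by gcongr
  have e2 : κ * ‖w.2.1‖ ^ 2 ≤ 1 * ‖w.2.1‖ ^ 2 := by gcongr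
  have e3 : κ * ‖w.2.2.1‖ ^ 2 ≤ 1 * ‖w.2.2.1‖ ^ 2 := by gcongr
  have e4 : κ * ‖w.2.2.2‖ ^ 2 ≤ 1 * ‖w.2.2.2‖ ^ 2 := by gcongr
  have e5 := sq_nonneg ‖w.2.2.1‖
  have e6 := sq_nonneg ‖w.2.2.2‖
  simp only at h2
  nlinarith

end StarCoercive

/-! ### Restriction to an edge and extension from an edge -/

section Edges

variable {N : ℕ}

lemma isTransfer_edgePull (j : Fin N) :
    IsTransfer (fun q : Fin 1 × ℝ => (j, q.2)) univ (starMeasure 1) (starMeasure N) where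
  measurable := by fun_prop
  measurableSet := MeasurableSet.univ
  map_le := by
    rw [Measure.restrict_univ, starMeasure_eq_sum 1, Fin.sum_univ_one,
      Measure.map_map (by fun_prop) measurable_prodMk_left]
    exact map_mk_le_starMeasure j

lemma map_edgePush (j : Fin N) :
    ((starMeasure N).restrict ({j} ×ˢ univ)).map (fun q : Fin N × ℝ => ((0 : Fin 1), q.2))
      = starMeasure 1 := by
  rw [starMeasure, ← Measure.prod_restrict, Measure.restrict_univ, starMeasure_eq_sum 1,
    Fin.sum_univ_one, Measure.restrict_singleton, Measure.count_singleton, one_smul,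
    Measure.dirac_prod, Measure.map_map (by fun_prop) measurable_prodMk_left]
  rfl

lemma isTransfer_edgePush (j : Fin N) :
    IsTransfer (fun q : Fin N × ℝ => ((0 : Fin 1), q.2)) ({j} ×ˢ univ) (starMeasure N)
      (starMeasure 1) where
  measurable := by fun_prop
  measurableSet := (measurableSet_singleton j).prod MeasurableSet.univ
  map_le := (map_edgePush j).le

/-- The restriction to the edge `j`. -/
def edgePull (j : Fin N) : Lp ℂ 2 (starMeasure N) →ₗ[ℂ] Lp ℂ 2 (starMeasure 1) :=
  transferLp (isTransfer_edgePull j)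

/-- The extension by zero of a function on the edge `j`. -/
def edgePush (j : Fin N) : Lp ℂ 2 (starMeasure 1) →ₗ[ℂ] Lp ℂ 2 (starMeasure N) :=
  transferLp (isTransfer_edgePush j)

lemma inner_edgePush (j : Fin N) (f : Lp ℂ 2 (starMeasure 1)) (g : Lp ℂ 2 (starMeasure N)) :
    inner ℂ (edgePush j f) g = inner ℂ f (edgePull j g) := by
  refine inner_transferLp_left _ _ (map_edgePush j) ?_ f g
  rintro ⟨i, x⟩ ⟨hi, -⟩
  rw [mem_singleton_iff] at hi
  simp only at hi
  rw [hi]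

lemma ae_edgePull (j : Fin N) (f : Lp ℂ 2 (starMeasure N)) :
    ∀ᵐ x ∂(volume.restrict (Ioi (0 : ℝ))), edgePull j f (0, x) = f (j, x) := by
  have := ae_starMeasure_iff.1 (coeFn_transferLp (isTransfer_edgePull j) f) 0
  filter_upwards [this] with x hx
  rw [edgePull, hx]; simp

lemma ae_edgePush (i j : Fin N) (f : Lp ℂ 2 (starMeasure 1)) :
    ∀ᵐ x ∂(volume.restrict (Ioi (0 : ℝ))), edgePush j f (i, x) = if i = j then f (0, x) else 0 := by
  have := ae_starMeasure_iff.1 (coeFn_transferLp (isTransfer_edgePush j) f) i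
  filter_upwards [this] with x hx
  rw [edgePush, hx]; simp [indicator]

lemma inner_edgeIndicator_congr {M : ℕ} {i : Fin M} {j : Fin N} {f : Lp ℂ 2 (starMeasure M)}
    {g : Lp ℂ 2 (starMeasure N)}
    (h : ∀ᵐ x ∂(volume.restrict (Ioi (0 : ℝ))), f (i, x) = g (j, x)) (x : ℝ) :
    inner ℂ (edgeIndicator i 0 x) f = inner ℂ (edgeIndicator j 0 x) g := by
  rw [inner_edgeIndicator i le_rfl, inner_edgeIndicator j le_rfl]
  exact integral_congr_ae (ae_mono (Measure.restrict_mono (fun t ht => ht.1) le_rfl) h)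

lemma edgePull_mem_edgeGraph (j : Fin N) {u : Lp ℂ 2 (starMeasure N) × Lp ℂ 2 (starMeasure N)}
    {c : Fin N → ℂ} (h : (u, c) ∈ edgeGraph N) :
    ((edgePull j u.1, edgePull j u.2), fun _ => c j) ∈ edgeGraph 1 := by
  rw [mem_edgeGraph, ae_starMeasure_iff] at h ⊢
  intro i
  obtain rfl : i = 0 := Subsingleton.elim _ _
  filter_upwards [h j, ae_edgePull j u.1] with x h1 h2
  simp only [h2, h1, inner_edgeIndicator_congr (ae_edgePull j u.2) x]

/-- Extension by zero from one edge generally breaks continuity at the vertex, so vertex values are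
tracked edge by edge. Summing over all edges restores a common value, and for c = 0 nothing breaks.
-/
lemma edgePush_mem_edgeGraph (j : Fin N) {u : Lp ℂ 2 (starMeasure 1) × Lp ℂ 2 (starMeasure 1)}
    {c : ℂ} (h : (u, fun _ => c) ∈ edgeGraph 1) :
    ((edgePush j u.1, edgePush j u.2), Pi.single j c) ∈ edgeGraph N := by
  rw [mem_edgeGraph, ae_starMeasure_iff] at h ⊢
  intro i
  filter_upwards [h 0, ae_edgePush i j u.1] with x h1 h2
  simp only [h2]
  by_cases hij : i = j
  · subst hij
    have h3 : ∀ᵐ x ∂(volume.restrict (Ioi (0 : ℝ))), edgePush i u.2 (i, x) = u.2 (0, x) := by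
      filter_upwards [ae_edgePush i i u.2] with x hx
      rw [hx, if_pos rfl]
    simp only [if_true, h1, inner_edgeIndicator_congr h3 x, Pi.single_eq_same]
  · have h3 : ∀ᵐ x ∂(volume.restrict (Ioi (0 : ℝ))), edgePush j u.2 (i, x) = 0 := by
      filter_upwards [ae_edgePush i j u.2] with x hx
      rw [hx, if_neg hij]
    have h4 : inner ℂ (edgeIndicator i 0 x) (edgePush j u.2) = 0 := by
      rw [inner_edgeIndicator i le_rfl, ← integral_zero ℝ ℂ]
      exact integral_congr_ae (ae_mono (Measure.restrict_mono (fun t ht => ht.1) le_rfl) h3)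
    simp only [if_neg hij, h4, Pi.single_eq_of_ne hij, add_zero]

end Edges

/-! ### Restriction to a half-line and extension from a half-line -/

section Sides

variable {s : ℝ}

lemma measurePreserving_mul_sign (hs : s = 1 ∨ s = -1) :
    MeasurePreserving (fun x : ℝ => s * x) volume volume := by
  rcases hs with rfl | rfl
  · simp only [one_mul]; exact MeasurePreserving.id (volume : Measure ℝ)
  · simpa using Measure.measurePreserving_neg (volume : Measure ℝ)

lemma isTransfer_linePull (hs : s = 1 ∨ s = -1) :
    IsTransfer (fun q : Fin 1 × ℝ => s * q.2) univ (starMeasure 1) volume where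
  measurable := by fun_prop
  measurableSet := MeasurableSet.univ
  map_le := by
    rw [Measure.restrict_univ, starMeasure_eq_sum 1, Fin.sum_univ_one,
      Measure.map_map (by fun_prop) measurable_prodMk_left]
    exact (Measure.map_mono Measure.restrict_le_self (by fun_prop)).trans
      (measurePreserving_mul_sign hs).map_eq.le

lemma map_linePush (hs : s = 1 ∨ s = -1) :
    ((volume : Measure ℝ).restrict {x | 0 < s * x}).map (fun x => ((0 : Fin 1), s * x))
      = starMeasure 1 := by
  have h := ((measurePreserving_mul_sign hs).restrict_preimage (s := Ioi 0)
    measurableSet_Ioi).map_eq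
  rw [starMeasure_eq_sum 1, Fin.sum_univ_one, ← h,
    Measure.map_map measurable_prodMk_left (by fun_prop)]
  rfl

lemma isTransfer_linePush (hs : s = 1 ∨ s = -1) :
    IsTransfer (fun x : ℝ => ((0 : Fin 1), s * x)) {x | 0 < s * x} volume (starMeasure 1) where
  measurable := by fun_prop
  measurableSet := measurableSet_lt measurable_const (by fun_prop)
  map_le := (map_linePush hs).le

/-- The restriction to the half-line with sign `s`. -/
def linePull (hs : s = 1 ∨ s = -1) : Lp ℂ 2 (volume : Measure ℝ) →ₗ[ℂ] Lp ℂ 2 (starMeasure 1) :=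
  transferLp (isTransfer_linePull hs)

/-- The extension by zero of a function on the half-line with sign `s`. -/
def linePush (hs : s = 1 ∨ s = -1) : Lp ℂ 2 (starMeasure 1) →ₗ[ℂ] Lp ℂ 2 (volume : Measure ℝ) :=
  transferLp (isTransfer_linePush hs)

lemma sign_mul_sign_mul (hs : s = 1 ∨ s = -1) (x : ℝ) : s * (s * x) = x := by
  rcases hs with rfl | rfl <;> ring

lemma inner_linePush (hs : s = 1 ∨ s = -1) (f : Lp ℂ 2 (starMeasure 1))
    (g : Lp ℂ 2 (volume : Measure ℝ)) :
    inner ℂ (linePush hs f) g = inner ℂ f (linePull hs g) :=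
  inner_transferLp_left _ _ (map_linePush hs) (fun x _ => sign_mul_sign_mul hs x) f g

lemma ae_linePull (hs : s = 1 ∨ s = -1) (f : Lp ℂ 2 (volume : Measure ℝ)) :
    ∀ᵐ x ∂(volume.restrict (Ioi (0 : ℝ))), linePull hs f (0, x) = f (s * x) := by
  have := ae_starMeasure_iff.1 (coeFn_transferLp (isTransfer_linePull hs) f) 0
  filter_upwards [this] with x hx
  rw [linePull, hx]; simp

lemma ae_linePush (hs : s = 1 ∨ s = -1) (f : Lp ℂ 2 (starMeasure 1)) :
    ∀ᵐ x : ℝ, linePush hs f x = {x | 0 < s * x}.indicator (fun x => f (0, s * x)) x :=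
  coeFn_transferLp (isTransfer_linePush hs) f

lemma linePull_linePush (hs : s = 1 ∨ s = -1) (f : Lp ℂ 2 (starMeasure 1)) :
    linePull hs (linePush hs f) = f := by
  refine Lp.ext (ae_starMeasure_iff.2 fun j => ?_)
  obtain rfl : j = 0 := Subsingleton.elim _ _
  have h := ae_restrict_of_ae (s := Ioi (0 : ℝ))
    ((measurePreserving_mul_sign hs).quasiMeasurePreserving.ae (ae_linePush hs f))
  filter_upwards [ae_linePull hs (linePush hs f), h, ae_restrict_mem measurableSet_Ioi]
    with x h1 h2 h3
  have h4 : s * x ∈ {x | 0 < s * x} := by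
    rw [mem_ofPred_eq, sign_mul_sign_mul hs]; exact h3
  rw [h1, h2, indicator_of_mem h4, sign_mul_sign_mul hs]

lemma linePull_linePush_neg {t : ℝ} (hs : s = 1 ∨ s = -1) (ht : t = 1 ∨ t = -1) (hst : s = -t)
    (f : Lp ℂ 2 (starMeasure 1)) : linePull hs (linePush ht f) = 0 := by
  refine Lp.ext (ae_starMeasure_iff.2 fun j => ?_)
  obtain rfl : j = 0 := Subsingleton.elim _ _
  have h := ae_restrict_of_ae (s := Ioi (0 : ℝ))
    ((measurePreserving_mul_sign hs).quasiMeasurePreserving.ae (ae_linePush ht f))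
  have h0 := ae_starMeasure_iff.1 (Lp.coeFn_zero ℂ 2 (starMeasure 1)) 0
  filter_upwards [ae_linePull hs (linePush ht f), h, ae_restrict_mem measurableSet_Ioi, h0]
    with x h1 h2 h3 h0
  have h4 : s * x ∉ {x | 0 < t * x} := by
    have h3 : 0 < x := h3
    rw [mem_ofPred_eq, hst, neg_mul, mul_neg, sign_mul_sign_mul ht]; linarith
  rw [h1, h2, indicator_of_notMem h4, h0]; rfl

lemma intervalIntegrable_of_Lp (f : Lp ℂ 2 (volume : Measure ℝ)) (a b : ℝ) :
    IntervalIntegrable f volume a b := by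
  rw [intervalIntegrable_iff]
  have : IsFiniteMeasure ((volume : Measure ℝ).restrict (uIoc a b)) := by
    unfold uIoc; infer_instance
  exact ((Lp.memLp f).mono_measure Measure.restrict_le_self).integrable (by norm_num)

/-- Functions which are antiderivatives up to a given function `c`. -/
def lineGraph : Submodule ℂ
    ((Lp ℂ 2 (volume : Measure ℝ) × Lp ℂ 2 (volume : Measure ℝ)) × (ℝ → ℂ)) where
  carrier := {q | ∀ᵐ x : ℝ, q.1.1 x = q.2 x + ∫ t in (0 : ℝ)..x, q.1.2 t}
  add_mem' := by
    intro a b ha hb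
    have h4 : ∀ x : ℝ, ∫ t in (0 : ℝ)..x, (a.1.2 + b.1.2 : Lp ℂ 2 (volume : Measure ℝ)) t
        = (∫ t in (0 : ℝ)..x, a.1.2 t) + ∫ t in (0 : ℝ)..x, b.1.2 t := by
      intro x
      rw [← intervalIntegral.integral_add (intervalIntegrable_of_Lp _ _ _)
        (intervalIntegrable_of_Lp _ _ _)]
      refine intervalIntegral.integral_congr_ae ?_
      filter_upwards [Lp.coeFn_add a.1.2 b.1.2] with t ht _
      rw [ht]; rfl
    filter_upwards [ha, hb, Lp.coeFn_add a.1.1 b.1.1] with p h1 h2 h3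
    simp only [Prod.fst_add, Prod.snd_add, h3, Pi.add_apply, h1, h2, h4]; ring
  zero_mem' := by
    have h4 : ∀ x : ℝ, ∫ t in (0 : ℝ)..x, (0 : Lp ℂ 2 (volume : Measure ℝ)) t = 0 := by
      intro x
      rw [← intervalIntegral.integral_zero (E := ℂ) (μ := volume) (a := 0) (b := x)]
      refine intervalIntegral.integral_congr_ae ?_
      filter_upwards [Lp.coeFn_zero ℂ 2 (volume : Measure ℝ)] with t ht _
      rw [ht]; rfl
    filter_upwards [Lp.coeFn_zero ℂ 2 (volume : Measure ℝ)] with p hp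
    simp only [Prod.fst_zero, Prod.snd_zero, hp, h4, Pi.zero_apply, add_zero]
  smul_mem' := by
    intro z a ha
    have h4 : ∀ x : ℝ, ∫ t in (0 : ℝ)..x, (z • a.1.2 : Lp ℂ 2 (volume : Measure ℝ)) t
        = z * ∫ t in (0 : ℝ)..x, a.1.2 t := by
      intro x
      rw [← intervalIntegral.integral_const_mul]
      refine intervalIntegral.integral_congr_ae ?_
      filter_upwards [Lp.coeFn_smul z a.1.2] with t ht _
      rw [ht]; rfl
    filter_upwards [ha, Lp.coeFn_smul z a.1.1] with p h1 h3
    simp only [Prod.smul_fst, Prod.smul_snd, h3, Pi.smul_apply, h1, h4, smul_eq_mul]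
    ring

lemma mem_lineGraph {q : (Lp ℂ 2 (volume : Measure ℝ) × Lp ℂ 2 (volume : Measure ℝ)) × (ℝ → ℂ)} :
    q ∈ lineGraph ↔ ∀ᵐ x : ℝ, q.1.1 x = q.2 x + ∫ t in (0 : ℝ)..x, q.1.2 t := Iff.rfl

/-- `H¹(ℝ)` as a subspace. -/
def sobolevLineSubmodule :
    Submodule ℂ (Lp ℂ 2 (volume : Measure ℝ) × Lp ℂ 2 (volume : Measure ℝ)) where
  carrier := sobolevLine
  add_mem' := by
    rintro a b ⟨c, hc⟩ ⟨d, hd⟩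
    exact ⟨c + d, lineGraph.add_mem (x := (a, fun _ => c)) (y := (b, fun _ => d)) hc hd⟩
  zero_mem' := ⟨0, lineGraph.zero_mem⟩
  smul_mem' := by
    rintro z a ⟨c, hc⟩
    exact ⟨z * c, lineGraph.smul_mem (x := (a, fun _ => c)) z hc⟩

lemma mem_sobolevLineSubmodule_of_ae_const
    {u : Lp ℂ 2 (volume : Measure ℝ) × Lp ℂ 2 (volume : Measure ℝ)} {c : ℝ → ℂ}
    (h : (u, c) ∈ lineGraph) {d : ℂ} (hc : ∀ᵐ x : ℝ, c x = d) : u ∈ sobolevLineSubmodule := by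
  refine ⟨d, ?_⟩
  filter_upwards [mem_lineGraph.1 h, hc] with x h1 h2
  rw [← h2]; exact h1

lemma intervalIntegral_mul_sign (hs : s = 1 ∨ s = -1) (f : ℝ → ℂ) (x : ℝ) :
    ∫ t in (0 : ℝ)..s * x, f t = s * ∫ t in (0 : ℝ)..x, f (s * t) := by
  rcases hs with rfl | rfl
  · simp
  · simp only [intervalIntegral.integral_comp_neg, neg_mul, one_mul, neg_zero]
    rw [intervalIntegral.integral_symm]; simp

lemma linePull_mem_edgeGraph (hs : s = 1 ∨ s = -1)
    {u : Lp ℂ 2 (volume : Measure ℝ) × Lp ℂ 2 (volume : Measure ℝ)} {c : ℂ}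
    (h : ∀ᵐ x : ℝ, u.1 x = c + ∫ t in (0 : ℝ)..x, u.2 t) :
    ((linePull hs u.1, (s : ℂ) • linePull hs u.2), fun _ => c) ∈ edgeGraph 1 := by
  rw [mem_edgeGraph, ae_starMeasure_iff]
  intro i
  obtain rfl : i = 0 := Subsingleton.elim _ _
  have h' := ae_restrict_of_ae (s := Ioi (0 : ℝ))
    ((measurePreserving_mul_sign hs).quasiMeasurePreserving.ae h)
  filter_upwards [h', ae_linePull hs u.1, ae_restrict_mem measurableSet_Ioi] with x h1 h2 h3
  simp only [h2, h1, inner_smul_right]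
  rw [← intervalIntegral_edge 0 h3, intervalIntegral_mul_sign hs]
  congr 2
  refine intervalIntegral.integral_congr_ae ?_
  have h4 := (ae_restrict_iff' measurableSet_Ioi).1 (ae_linePull hs u.2)
  filter_upwards [h4] with t ht htx
  rw [uIoc_of_le (le_of_lt h3)] at htx
  exact (ht htx.1).symm

/-- Extension by zero creates a jump of size c at the origin, which the step function records.
Reflection reverses the derivative, hence the factor s. -/
lemma linePush_mem_lineGraph (hs : s = 1 ∨ s = -1)
    {u : Lp ℂ 2 (starMeasure 1) × Lp ℂ 2 (starMeasure 1)} {c : ℂ}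
    (h : (u, fun _ => c) ∈ edgeGraph 1) :
    ((linePush hs u.1, (s : ℂ) • linePush hs u.2), {x : ℝ | 0 < s * x}.indicator fun _ => c)
      ∈ lineGraph := by
  rw [mem_lineGraph]
  have h1 := (isTransfer_linePush hs).ae_comp (mem_edgeGraph.1 h)
  have hprim : ∀ x : ℝ, ∫ t in (0 : ℝ)..x, ((s : ℂ) • linePush hs u.2 : Lp ℂ 2 volume) t
      = if 0 < s * x then inner ℂ (edgeIndicator 0 0 (s * x)) u.2 else 0 := by
    intro x
    have e1 : ∫ t in (0 : ℝ)..x, ((s : ℂ) • linePush hs u.2 : Lp ℂ 2 volume) t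
        = s * ∫ t in (0 : ℝ)..x, {x | 0 < s * x}.indicator (fun x => u.2 (0, s * x)) t := by
      rw [← intervalIntegral.integral_const_mul]
      refine intervalIntegral.integral_congr_ae ?_
      filter_upwards [Lp.coeFn_smul (s : ℂ) (linePush hs u.2), ae_linePush hs u.2] with t h1 h2 _
      rw [h1, Pi.smul_apply, h2, smul_eq_mul]
    have e2 : ∀ t, {x | 0 < s * x}.indicator (fun x => u.2 (0, s * x)) t
        = (fun y => (Ioi (0 : ℝ)).indicator (fun y => u.2 (0, y)) y) (s * t) := by
      intro t
      simp only [indicator, mem_ofPred_eq, mem_Ioi]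
    rw [e1]
    simp only [e2]
    rw [← intervalIntegral_mul_sign hs]
    split_ifs with hx
    · rw [← intervalIntegral_edge 0 hx]
      refine intervalIntegral.integral_congr_ae (Eventually.of_forall fun t ht => ?_)
      rw [uIoc_of_le hx.le] at ht
      exact indicator_of_mem ht.1 _
    · rw [← intervalIntegral.integral_zero (E := ℂ) (μ := volume) (a := 0) (b := s * x)]
      refine intervalIntegral.integral_congr_ae (Eventually.of_forall fun t ht => ?_)
      rw [uIoc_of_ge (not_lt.1 hx)] at ht
      exact indicator_of_notMem (fun h => absurd ht.2 (not_le.2 h)) _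
  filter_upwards [h1, ae_linePush hs u.1] with x h2 h3
  simp only [hprim x, h3]
  by_cases hx : 0 < s * x
  · simp only [indicator, mem_ofPred_eq, hx, if_true, h2 hx]
  · simp [indicator, hx]

lemma ae_indicator_sides (c : ℂ) :
    ∀ᵐ x : ℝ, {x : ℝ | 0 < 1 * x}.indicator (fun _ => c) x
      + {x : ℝ | 0 < -1 * x}.indicator (fun _ => c) x = c := by
  have : ∀ᵐ x : ℝ, x ≠ 0 := by simp [ae_iff]
  filter_upwards [this] with x hx
  rcases lt_or_gt_of_ne hx with h | h
  · simp [indicator, h, h.le]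
  · simp [indicator, h, h.le]

/-- A function in `H¹(ℝ)` is square integrable with respect to a weight in `L^p`. -/
lemma integrable_negPart_mul_sq_line {V : ℝ → ℝ} {p : ℝ≥0∞} (hp1 : 1 ≤ p) (hp : p ≠ ∞)
    (hV : MemLp (fun x => (V x)⁻) p volume)
    {u : Lp ℂ 2 (volume : Measure ℝ) × Lp ℂ 2 (volume : Measure ℝ)} (hu : u ∈ sobolevLine) :
    Integrable (fun x => (V x)⁻ * ‖u.1 x‖ ^ 2) volume := by
  obtain ⟨c, hc⟩ := hu
  have key : ∀ s : ℝ, ∀ hs : s = 1 ∨ s = -1,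
      IntegrableOn (fun x => (V x)⁻ * ‖u.1 x‖ ^ 2) {x | 0 < s * x} := by
    intro s hs
    have hmem : (linePull hs u.1, (s : ℂ) • linePull hs u.2) ∈ sobolevStar 1 :=
      mem_sobolevStar_iff.2 ⟨c, linePull_mem_edgeGraph hs hc⟩
    have hV' : MemLp (fun q : Fin 1 × ℝ => (V (s * q.2))⁻) p (starMeasure 1) := by
      have h := (isTransfer_linePull hs).map_le
      rw [Measure.restrict_univ] at h
      exact (hV.mono_measure h).comp_of_map (by fun_prop)
    have h1 := integrable_negPart_mul_sq_star (V := fun q => V (s * q.2)) hp1 hp hV' hmem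
    have h2 := Integrable.comp_measurable (h1.mono_measure (isTransfer_linePush hs).map_le)
      (isTransfer_linePush hs).measurable
    refine h2.congr ?_
    have h3 := (isTransfer_linePush hs).ae_comp
      (coeFn_transferLp (isTransfer_linePull hs) u.1)
    filter_upwards [ae_restrict_of_ae h3, ae_restrict_mem (isTransfer_linePush hs).measurableSet]
      with x h4 h5
    have h6 : linePull hs u.1 (0, s * x) = u.1 x := by
      rw [linePull, h4 h5]; simp [sign_mul_sign_mul hs]
    simp only [Function.comp_apply, h6, sign_mul_sign_mul hs]
  have h := (key 1 (Or.inl rfl)).union (key (-1) (Or.inr rfl))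
  rw [← integrableOn_univ]
  refine h.congr_set_ae ?_
  have h0 : ∀ᵐ x : ℝ, x ≠ 0 := by simp [ae_iff]
  filter_upwards [h0] with x hx
  simp only [eq_iff_iff]
  refine ⟨fun _ => ?_, fun _ => trivial⟩
  rcases lt_or_gt_of_ne hx with h | h
  · right; change 0 < -1 * x; linarith
  · left; change 0 < 1 * x; linarith

end Sides

/-! ### Reduction of the radial star graph to half-lines -/

section Decomposition

variable {N : ℕ}

/-- The profile of a radial potential, as a potential on the half-line. -/
def halfProfile (f : ℝ → ℝ) : Fin 1 × ℝ → ℝ := fun q => f q.2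

lemma ae_starMeasure_pos (N : ℕ) : ∀ᵐ q ∂(starMeasure N), 0 < q.2 :=
  ae_starMeasure_iff.2 fun _ => ae_restrict_mem measurableSet_Ioi

variable {V : Fin N × ℝ → ℝ} {f : ℝ → ℝ}

lemma edgePull_mem_potentialGraph (hV : ∀ j x, 0 < x → V (j, x) = f x) (j : Fin N)
    {w : Lp ℂ 2 (starMeasure N) × Lp ℂ 2 (starMeasure N) × Lp ℂ 2 (starMeasure N) ×
      Lp ℂ 2 (starMeasure N)} (hw : w ∈ potentialGraph (starMeasure N) V) :
    quadMap 1 (edgePull j) w ∈ potentialGraph (starMeasure 1) (halfProfile f) := by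
  refine quadMap_transferLp_mem_potentialGraph _ ?_ 1 hw
  filter_upwards [ae_starMeasure_pos 1] with q hq _
  rw [hV j _ hq]; rfl

lemma edgePush_mem_potentialGraph (hV : ∀ j x, 0 < x → V (j, x) = f x) (j : Fin N)
    {w : Lp ℂ 2 (starMeasure 1) × Lp ℂ 2 (starMeasure 1) × Lp ℂ 2 (starMeasure 1) ×
      Lp ℂ 2 (starMeasure 1)} (hw : w ∈ potentialGraph (starMeasure 1) (halfProfile f)) :
    quadMap 1 (edgePush j) w ∈ potentialGraph (starMeasure N) V := by
  refine quadMap_transferLp_mem_potentialGraph _ ?_ 1 hw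
  filter_upwards [ae_starMeasure_pos N] with q hq _
  rw [show q = (q.1, q.2) from rfl, hV _ _ hq]; rfl

/-- The sum over all edges of an eigenfunction is a Neumann eigenfunction. -/
lemma sum_edgePull_mem_eigenLift (hV : ∀ j x, 0 < x → V (j, x) = f x) {E : ℝ}
    {w : Lp ℂ 2 (starMeasure N) × Lp ℂ 2 (starMeasure N) × Lp ℂ 2 (starMeasure N) ×
      Lp ℂ 2 (starMeasure N)} (hw : w ∈ eigenLift (formGraph (sobolevStarSubmodule N) V) E) :
    (∑ j, quadMap 1 (edgePull (N := N) j)) w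
      ∈ eigenLift (formGraph (sobolevStarSubmodule 1) (halfProfile f)) E := by
  refine map_mem_eigenLift (T' := ∑ j, quadMap 1 (edgePush (N := N) j)) ?_ ?_ hw ?_
  · intro u hu
    rw [LinearMap.sum_apply]
    refine ⟨Submodule.sum_mem _ fun j _ => edgePush_mem_potentialGraph hV j hu.1, ?_⟩
    obtain ⟨c, hc⟩ := mem_sobolevStar_iff.1 hu.2
    refine mem_sobolevStar_iff.2 ⟨c, ?_⟩
    have := (edgeGraph N).sum_mem (t := Finset.univ) fun j _ => edgePush_mem_edgeGraph j hc
    convert this using 1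
    refine Prod.ext (Prod.ext ?_ ?_) (funext fun i => ?_)
    · simp [Prod.fst_sum, quadMap_apply]
    · simp [Prod.fst_sum, Prod.snd_sum, quadMap_apply]
    · simp [Prod.snd_sum, Finset.sum_pi_single]
  · intro u v
    simp only [LinearMap.sum_apply, map_sum, shiftedForm_quadMap_left (inner_edgePush _)]
  · rw [LinearMap.sum_apply]
    refine ⟨Submodule.sum_mem _ fun j _ => edgePull_mem_potentialGraph hV j hw.1.1, ?_⟩
    obtain ⟨c, hc⟩ := mem_sobolevStar_iff.1 hw.1.2
    refine mem_sobolevStar_iff.2 ⟨∑ j : Fin N, c, ?_⟩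
    have := (edgeGraph 1).sum_mem (t := Finset.univ) fun j _ => edgePull_mem_edgeGraph j hc
    convert this using 1
    refine Prod.ext (Prod.ext ?_ ?_) (funext fun i => ?_)
    · simp [Prod.fst_sum, quadMap_apply]
    · simp [Prod.fst_sum, Prod.snd_sum, quadMap_apply]
    · simp [Prod.snd_sum]

/-- The difference of an eigenfunction on two edges is a Dirichlet eigenfunction. -/
lemma edgePull_sub_mem_eigenLift (hV : ∀ j x, 0 < x → V (j, x) = f x) (i j : Fin N) {E : ℝ}
    {w : Lp ℂ 2 (starMeasure N) × Lp ℂ 2 (starMeasure N) × Lp ℂ 2 (starMeasure N) ×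
      Lp ℂ 2 (starMeasure N)} (hw : w ∈ eigenLift (formGraph (sobolevStarSubmodule N) V) E) :
    (quadMap 1 (edgePull i) - quadMap 1 (edgePull j)) w
      ∈ eigenLift (formGraph (sobolevStarZero 1) (halfProfile f)) E := by
  refine map_mem_eigenLift (T' := quadMap 1 (edgePush i) - quadMap 1 (edgePush j)) ?_ ?_ hw ?_
  · intro u hu
    rw [LinearMap.sub_apply]
    refine ⟨Submodule.sub_mem _ (edgePush_mem_potentialGraph hV i hu.1)
      (edgePush_mem_potentialGraph hV j hu.1), sobolevStarZero_le ?_⟩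
    have := (edgeGraph N).sub_mem (edgePush_mem_edgeGraph i (mem_sobolevStarZero.1 hu.2))
      (edgePush_mem_edgeGraph j (mem_sobolevStarZero.1 hu.2))
    rw [mem_sobolevStarZero]
    convert this using 1
    refine Prod.ext (Prod.ext ?_ ?_) (funext fun i => ?_) <;> simp [quadMap_apply]
  · intro u v
    simp only [LinearMap.sub_apply, map_sub, shiftedForm_quadMap_left (inner_edgePush _)]
  · rw [LinearMap.sub_apply]
    refine ⟨Submodule.sub_mem _ (edgePull_mem_potentialGraph hV i hw.1.1)
      (edgePull_mem_potentialGraph hV j hw.1.1), ?_⟩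
    obtain ⟨c, hc⟩ := mem_sobolevStar_iff.1 hw.1.2
    have := (edgeGraph 1).sub_mem (edgePull_mem_edgeGraph i hc) (edgePull_mem_edgeGraph j hc)
    change _ ∈ sobolevStarZero 1
    rw [mem_sobolevStarZero]
    convert this using 1
    refine Prod.ext (Prod.ext ?_ ?_) (funext fun i => ?_) <;> simp [quadMap_apply]

lemma eq_zero_of_edgePull_eq_zero {ψ : Lp ℂ 2 (starMeasure N)} (h : ∀ j, edgePull j ψ = 0) :
    ψ = 0 := by
  refine Lp.ext (ae_starMeasure_iff.2 fun j => ?_)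
  have h0 := ae_starMeasure_iff.1 (Lp.coeFn_zero ℂ 2 (starMeasure N)) j
  have h1 := ae_starMeasure_iff.1 (Lp.coeFn_zero ℂ 2 (starMeasure 1)) 0
  filter_upwards [ae_edgePull j ψ, h0, h1] with x h2 h3 h4
  rw [h3, ← h2, h j, h4]; rfl

/-- On a radial star graph, the eigenvalues are the Neumann eigenvalues and at most `N - 1` copies
of the Dirichlet eigenvalues of the half-line. -/
theorem eigenMult_star_le (hN : 0 < N) (hV : ∀ j x, 0 < x → V (j, x) = f x) (E : ℝ) :
    eigenMult (formGraph (sobolevStarSubmodule N) V) E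
      ≤ eigenMult (formGraph (sobolevStarSubmodule 1) (halfProfile f)) E
        + (N - 1 : ℕ) * eigenMult (formGraph (sobolevStarZero 1) (halfProfile f)) E := by
  set j₀ : Fin N := ⟨0, hN⟩
  set S := eigenspaceOf (formGraph (sobolevStarSubmodule N) V) E
  set SN := eigenspaceOf (formGraph (sobolevStarSubmodule 1) (halfProfile f)) E
  set SD := eigenspaceOf (formGraph (sobolevStarZero 1) (halfProfile f)) E
  have h1 : ∀ ψ : S, (∑ j, edgePull (N := N) j) ψ.1 ∈ SN := by
    rintro ⟨ψ, w, hw, rfl⟩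
    refine ⟨_, sum_edgePull_mem_eigenLift hV hw, ?_⟩
    simp [quadMap_apply]
  have h2 : ∀ (j : Fin N) (ψ : S), (edgePull j - edgePull j₀) ψ.1 ∈ SD := by
    rintro j ⟨ψ, w, hw, rfl⟩
    exact ⟨_, edgePull_sub_mem_eigenLift hV j j₀ hw, rfl⟩
  -- The sum over edges together with the N - 1 differences from a reference edge determines the
  -- function: equal edge restrictions with zero sum all vanish. Injectivity suffices, as only an
  -- upper bound is needed.
  let L : S →ₗ[ℂ] SN × ({j : Fin N // j ≠ j₀} → SD) :=
    (((∑ j, edgePull (N := N) j).domRestrict S).codRestrict SN h1).prod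
      (LinearMap.pi fun j => ((edgePull j.1 - edgePull j₀).domRestrict S).codRestrict SD (h2 j.1))
  have hL : Function.Injective L := by
    rw [← LinearMap.ker_eq_bot, LinearMap.ker_eq_bot']
    intro ψ hψ
    have e1 : (∑ j, edgePull (N := N) j) ψ.1 = 0 := congrArg Subtype.val (congrArg Prod.fst hψ)
    have e2 : ∀ j, edgePull j ψ.1 = edgePull j₀ ψ.1 := by
      intro j
      by_cases hj : j = j₀
      · rw [hj]
      · have := congrArg Subtype.val (congrFun (congrArg Prod.snd hψ) ⟨j, hj⟩)
        exact sub_eq_zero.1 this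
    rw [LinearMap.sum_apply, Finset.sum_congr rfl (fun j _ => e2 j), Finset.sum_const,
      Finset.card_univ, Fintype.card_fin, ← Nat.cast_smul_eq_nsmul ℂ, smul_eq_zero] at e1
    have e3 := e1.resolve_left (Nat.cast_ne_zero.2 hN.ne')
    exact Subtype.ext (eq_zero_of_edgePull_eq_zero fun j => (e2 j).trans e3)
  have hrank := LinearMap.rank_le_of_injective L hL
  rw [rank_prod', rank_fun] at hrank
  have := Cardinal.toENat.monotone' hrank
  simpa [eigenMult, Fintype.card_subtype_compl] using this

end Decomposition

/-! ### Even and odd extensions to the line -/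

section EvenLine

variable {f : ℝ → ℝ}

/-- The two half-lines, as signs. -/
lemma pos_sign : (1 : ℝ) = 1 ∨ (1 : ℝ) = -1 := Or.inl rfl

lemma neg_sign : (-1 : ℝ) = 1 ∨ (-1 : ℝ) = -1 := Or.inr rfl

lemma abs_sign_mul {s : ℝ} (hs : s = 1 ∨ s = -1) (x : ℝ) : |s * x| = |x| := by
  rcases hs with rfl | rfl <;> simp

lemma linePull_mem_potentialGraph {s : ℝ} (hs : s = 1 ∨ s = -1)
    {w : Lp ℂ 2 (volume : Measure ℝ) × Lp ℂ 2 (volume : Measure ℝ) × Lp ℂ 2 (volume : Measure ℝ) ×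
      Lp ℂ 2 (volume : Measure ℝ)} (hw : w ∈ potentialGraph volume fun x => f |x|) :
    quadMap s (linePull hs) w ∈ potentialGraph (starMeasure 1) (halfProfile f) := by
  refine quadMap_transferLp_mem_potentialGraph _ ?_ s hw
  filter_upwards [ae_starMeasure_pos 1] with q hq _
  rw [abs_sign_mul hs, abs_of_pos hq]; rfl

lemma linePush_mem_potentialGraph {s : ℝ} (hs : s = 1 ∨ s = -1)
    {w : Lp ℂ 2 (starMeasure 1) × Lp ℂ 2 (starMeasure 1) × Lp ℂ 2 (starMeasure 1) ×
      Lp ℂ 2 (starMeasure 1)} (hw : w ∈ potentialGraph (starMeasure 1) (halfProfile f)) :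
    quadMap s (linePush hs) w ∈ potentialGraph volume fun x => f |x| := by
  refine quadMap_transferLp_mem_potentialGraph _ (Eventually.of_forall fun x hx => ?_) s hw
  have hx : 0 < s * x := hx
  simp only [halfProfile]
  rw [← abs_sign_mul hs x, abs_of_pos hx]

/-- The even extension of a Neumann eigenfunction is an eigenfunction on the line. -/
lemma even_mem_eigenLift {E : ℝ}
    {w : Lp ℂ 2 (starMeasure 1) × Lp ℂ 2 (starMeasure 1) × Lp ℂ 2 (starMeasure 1) ×
      Lp ℂ 2 (starMeasure 1)}
    (hw : w ∈ eigenLift (formGraph (sobolevStarSubmodule 1) (halfProfile f)) E) :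
    (quadMap 1 (linePush pos_sign) + quadMap (-1) (linePush neg_sign)) w
      ∈ eigenLift (formGraph sobolevLineSubmodule fun x => f |x|) E := by
  refine map_mem_eigenLift
    (T' := quadMap 1 (linePull pos_sign) + quadMap (-1) (linePull neg_sign)) ?_ ?_ hw ?_
  · intro u hu
    rw [LinearMap.add_apply]
    refine ⟨Submodule.add_mem _ (linePull_mem_potentialGraph pos_sign hu.1)
      (linePull_mem_potentialGraph neg_sign hu.1), ?_⟩
    obtain ⟨c, hc⟩ := hu.2
    have := (edgeGraph 1).add_mem (linePull_mem_edgeGraph pos_sign hc)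
      (linePull_mem_edgeGraph neg_sign hc)
    refine mem_sobolevStar_iff.2 ⟨c + c, ?_⟩
    convert this using 1
    refine Prod.ext rfl (funext fun i => ?_)
    simp
  · intro u v
    simp only [LinearMap.add_apply, map_add]
    -- The adjoint relation has the extension in the left slot; Hermitian symmetry moves it to the
    -- right one.
    rw [← shiftedForm_conj_symm E _ v, ← shiftedForm_conj_symm E _ v,
      ← shiftedForm_quadMap_left (inner_linePush _), ← shiftedForm_quadMap_left (inner_linePush _),
      shiftedForm_conj_symm, shiftedForm_conj_symm]
  · rw [LinearMap.add_apply]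
    refine ⟨Submodule.add_mem _ (linePush_mem_potentialGraph pos_sign hw.1.1)
      (linePush_mem_potentialGraph neg_sign hw.1.1), ?_⟩
    obtain ⟨c, hc⟩ := mem_sobolevStar_iff.1 hw.1.2
    have h := lineGraph.add_mem
      (linePush_mem_lineGraph pos_sign hc) (linePush_mem_lineGraph neg_sign hc)
    -- The step functions of the two sides add up to the constant c away from the origin, so the
    -- even extension has no jump.
    exact mem_sobolevLineSubmodule_of_ae_const h (ae_indicator_sides c)

/-- The odd extension of a Dirichlet eigenfunction is an eigenfunction on the line. -/
lemma odd_mem_eigenLift {E : ℝ}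
    {w : Lp ℂ 2 (starMeasure 1) × Lp ℂ 2 (starMeasure 1) × Lp ℂ 2 (starMeasure 1) ×
      Lp ℂ 2 (starMeasure 1)}
    (hw : w ∈ eigenLift (formGraph (sobolevStarZero 1) (halfProfile f)) E) :
    (quadMap 1 (linePush pos_sign) - quadMap (-1) (linePush neg_sign)) w
      ∈ eigenLift (formGraph sobolevLineSubmodule fun x => f |x|) E := by
  refine map_mem_eigenLift
    (T' := quadMap 1 (linePull pos_sign) - quadMap (-1) (linePull neg_sign)) ?_ ?_ hw ?_
  · intro u hu
    rw [LinearMap.sub_apply]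
    refine ⟨Submodule.sub_mem _ (linePull_mem_potentialGraph pos_sign hu.1)
      (linePull_mem_potentialGraph neg_sign hu.1), ?_⟩
    obtain ⟨c, hc⟩ := hu.2
    have := (edgeGraph 1).sub_mem (linePull_mem_edgeGraph pos_sign hc)
      (linePull_mem_edgeGraph neg_sign hc)
    change _ ∈ sobolevStarZero 1
    rw [mem_sobolevStarZero]
    convert this using 1
    refine Prod.ext rfl (funext fun i => ?_)
    simp
  · intro u v
    simp only [LinearMap.sub_apply, map_sub]
    rw [← shiftedForm_conj_symm E _ v, ← shiftedForm_conj_symm E _ v,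
      ← shiftedForm_quadMap_left (inner_linePush _), ← shiftedForm_quadMap_left (inner_linePush _),
      shiftedForm_conj_symm, shiftedForm_conj_symm]
  · rw [LinearMap.sub_apply]
    refine ⟨Submodule.sub_mem _ (linePush_mem_potentialGraph pos_sign hw.1.1)
      (linePush_mem_potentialGraph neg_sign hw.1.1), ?_⟩
    have hc := mem_sobolevStarZero.1 hw.1.2
    have h := lineGraph.sub_mem
      (linePush_mem_lineGraph pos_sign hc) (linePush_mem_lineGraph neg_sign hc)
    exact mem_sobolevLineSubmodule_of_ae_const h (d := 0) (Eventually.of_forall fun x => by simp)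

/-- The Neumann and Dirichlet eigenvalues on the half-line are eigenvalues of the even extension
of the potential to the line. -/
theorem eigenMult_line_ge (f : ℝ → ℝ) (E : ℝ) :
    eigenMult (formGraph (sobolevStarSubmodule 1) (halfProfile f)) E
        + eigenMult (formGraph (sobolevStarZero 1) (halfProfile f)) E
      ≤ eigenMult (formGraph sobolevLineSubmodule fun x => f |x|) E := by
  set S := eigenspaceOf (formGraph sobolevLineSubmodule fun x => f |x|) E
  set SN := eigenspaceOf (formGraph (sobolevStarSubmodule 1) (halfProfile f)) E
  set SD := eigenspaceOf (formGraph (sobolevStarZero 1) (halfProfile f)) E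
  have h1 : ∀ ψ : SN, (linePush pos_sign + linePush neg_sign) ψ.1 ∈ S := by
    rintro ⟨ψ, w, hw, rfl⟩
    exact ⟨_, even_mem_eigenLift hw, rfl⟩
  have h2 : ∀ ψ : SD, (linePush pos_sign - linePush neg_sign) ψ.1 ∈ S := by
    rintro ⟨ψ, w, hw, rfl⟩
    exact ⟨_, odd_mem_eigenLift hw, rfl⟩
  let L : SN × SD →ₗ[ℂ] S :=
    (((linePush pos_sign + linePush neg_sign).domRestrict SN).codRestrict S h1).coprod
      (((linePush pos_sign - linePush neg_sign).domRestrict SD).codRestrict S h2)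
  have hL : Function.Injective L := by
    rw [← LinearMap.ker_eq_bot, LinearMap.ker_eq_bot']
    rintro ⟨ψ, φ⟩ h
    -- Restricted to the right and left half-lines this reads ψ + φ = 0 and ψ - φ = 0.
    have e0 : (linePush pos_sign ψ.1 + linePush neg_sign ψ.1)
        + (linePush pos_sign φ.1 - linePush neg_sign φ.1) = 0 := congrArg Subtype.val h
    have e1 := congrArg (linePull pos_sign) e0
    have e2 := congrArg (linePull neg_sign) e0
    simp only [map_add, map_sub, map_zero, linePull_linePush,
      linePull_linePush_neg pos_sign neg_sign (by norm_num),
      linePull_linePush_neg neg_sign pos_sign (by norm_num), add_zero, zero_add, sub_zero,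
      zero_sub] at e1 e2
    have e3 : ψ.1 = 0 := by
      have : (2 : ℂ) • ψ.1 = 0 := by
        rw [two_smul]
        calc ψ.1 + ψ.1 = (ψ.1 + φ.1) + (ψ.1 + -φ.1) := by abel
          _ = 0 := by rw [e1, e2, add_zero]
      exact (smul_eq_zero.1 this).resolve_left two_ne_zero
    have e4 : φ.1 = 0 := by rw [e3, zero_add] at e1; exact e1
    exact Prod.ext (Subtype.ext e3) (Subtype.ext e4)
  have hrank := LinearMap.rank_le_of_injective L hL
  rw [rank_prod'] at hrank
  have := Cardinal.toENat.monotone' hrank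
  simpa [eigenMult] using this

end EvenLine

/-! ### The constant on the line bounds the constant on the star graph -/

section WeightBelow

/-- Allows an infinite weight to be treated through finite trial spaces: the weight is a supremum of
extended natural numbers, each reached by integers k. -/
lemma mul_weightBelow_le {m : ℝ → ℕ∞} {E : ℝ} {C b : ℝ≥0∞}
    (h : ∀ k : ℕ, (k : ℝ≥0∞) ≤ weightBelow m E → C * k ≤ b) : C * weightBelow m E ≤ b := by
  have h1 : ∀ F : Finset ℝ, ∑ x ∈ F, (Iic E).indicator (fun x => (m x : ℝ≥0∞)) x
      = ((∑ x ∈ F, (Iic E).indicator m x : ℕ∞) : ℝ≥0∞) := by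
    intro F
    rw [← ENat.toENNRealRingHom_apply, map_sum]
    refine Finset.sum_congr rfl fun x _ => ?_
    by_cases hx : x ∈ Iic E <;> simp [hx]
  have h2 : ∀ F : Finset ℝ, ((∑ x ∈ F, (Iic E).indicator m x : ℕ∞) : ℝ≥0∞) ≤ weightBelow m E :=
    fun F => h1 F ▸ ENNReal.sum_le_tsum F
  rw [weightBelow, ENNReal.tsum_eq_iSup_sum, ENNReal.mul_iSup]
  refine iSup_le fun F => ?_
  rw [h1]
  have h3 := h2 F
  generalize (∑ x ∈ F, (Iic E).indicator m x) = e at h3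
  induction e using ENat.recTopCoe with
  | top =>
    have h4 : ∀ k : ℕ, C * k ≤ b := fun k => h k (le_top.trans (by simpa using h3))
    rw [ENat.toENNReal_top, ← ENNReal.iSup_natCast, ENNReal.mul_iSup]
    exact iSup_le h4
  | coe k =>
    rw [ENat.toENNReal_coe] at h3 ⊢
    exact h k h3

end WeightBelow

/-! ### Even extension of radial potentials -/

section Admissible

lemma IsAdmissiblePotential.aemeasurable {X : Type*} [TopologicalSpace X]
    [SecondCountableTopology X] [MeasurableSpace X] {μ : Measure X} {V : X → ℝ}
    (hV : IsAdmissiblePotential μ V) : AEMeasurable V μ := by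
  obtain ⟨⟨p, -, -, hp⟩, hloc⟩ := hV
  have h := hloc.aestronglyMeasurable.aemeasurable.sub hp.aestronglyMeasurable.aemeasurable
  refine h.congr (Eventually.of_forall fun x => ?_)
  simp [posPart_sub_negPart]

lemma memLp_comp_abs {N : ℕ} {F : Type*} [NormedAddCommGroup F] {g : Fin N × ℝ → F} {p : ℝ≥0∞}
    (hg : MemLp g p (starMeasure N)) (j : Fin N) : MemLp (fun x : ℝ => g (j, |x|)) p volume := by
  have h1 : MemLp (fun q : Fin 1 × ℝ => g (j, q.2)) p (starMeasure 1) := by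
    simpa [Function.comp_def] using (isTransfer_edgePull j).memLp hg
  have h2 := ((isTransfer_linePush pos_sign).memLp h1).add ((isTransfer_linePush neg_sign).memLp h1)
  refine (memLp_congr_ae ?_).1 h2
  have h0 : ∀ᵐ x : ℝ, x ≠ 0 := by simp [ae_iff]
  filter_upwards [h0] with x hx
  rcases lt_or_gt_of_ne hx with h | h
  · simp [indicator, h, h.le, abs_of_neg]
  · simp [indicator, h, h.le, abs_of_pos]

lemma isAdmissiblePotential_comp_abs {N : ℕ} {V : Fin N × ℝ → ℝ}
    (hV : IsAdmissiblePotential (starMeasure N) V) (j : Fin N) :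
    IsAdmissiblePotential volume fun x : ℝ => V (j, |x|) := by
  obtain ⟨⟨p, hp1, hp, hpV⟩, hloc⟩ := hV
  refine ⟨⟨p, hp1, hp, memLp_comp_abs hpV j⟩, ?_⟩
  rw [locallyIntegrable_iff]
  intro K hK
  obtain ⟨R, hR⟩ := hK.isBounded.subset_closedBall 0
  -- The symmetric interval is invariant under taking absolute values, so the indicator commutes
  -- with the even extension.
  have hms : MeasurableSet ((univ : Set (Fin N)) ×ˢ Icc (-R) R) :=
    MeasurableSet.univ.prod measurableSet_Icc
  have h1 : IntegrableOn (fun q => (V q)⁺) ((univ : Set (Fin N)) ×ˢ Icc (-R) R) (starMeasure N) :=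
    hloc.integrableOn_isCompact (isCompact_univ.prod isCompact_Icc)
  have h2 := memLp_comp_abs (memLp_one_iff_integrable.2 ((integrable_indicator_iff hms).2 h1)) j
  rw [memLp_one_iff_integrable] at h2
  have h3 : IntegrableOn (fun x : ℝ => (V (j, |x|))⁺) (Icc (-R) R) := by
    rw [← integrable_indicator_iff measurableSet_Icc]
    refine h2.congr (Eventually.of_forall fun x => ?_)
    have : |x| ∈ Icc (-R) R ↔ x ∈ Icc (-R) R := by
      rw [mem_Icc, mem_Icc, ← abs_le, ← abs_le, abs_abs]
    simp only [indicator, mem_prod, mem_univ, true_and, this]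
  refine h3.mono_set fun x hx => ?_
  have := hR hx
  rwa [mem_closedBall_zero_iff, Real.norm_eq_abs, abs_le] at this

lemma lintegral_comp_abs_eq (g : ℝ → ℝ≥0∞) :
    ∫⁻ x : ℝ, g |x| = 2 * ∫⁻ x in Ioi (0 : ℝ), g x := by
  have h1 : ∫⁻ x in Ioi (0 : ℝ), g |x| = ∫⁻ x in Ioi (0 : ℝ), g x :=
    setLIntegral_congr_fun measurableSet_Ioi fun x hx => by rw [abs_of_pos hx]
  have h2 : ∫⁻ x in Iio (0 : ℝ), g |x| = ∫⁻ x in Ioi (0 : ℝ), g |x| := by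
    have := (Measure.measurePreserving_neg (volume : Measure ℝ)).setLIntegral_comp_preimage_emb
      (MeasurableEquiv.neg ℝ).measurableEmbedding (fun x => g |x|) (Ioi 0)
    simpa using this
  have h3 := lintegral_add_compl (μ := volume) (fun x : ℝ => g |x|)
    (measurableSet_Ioi (a := (0 : ℝ)))
  rw [← h3, compl_Ioi, ← setLIntegral_congr (Iio_ae_eq_Iic (μ := volume) (a := (0 : ℝ))), h2, h1,
    two_mul]

end Admissible

/-! ### From the line to the star graph -/

section LineToStar

/-- The Dirichlet eigenvalues dominate the Neumann eigenvalues on the half-line. -/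
lemma weightBelow_dirichlet_le_neumann {V : Fin 1 × ℝ → ℝ} {p : ℝ≥0∞} (hp1 : 1 ≤ p) (hp : p ≠ ∞)
    (hV : MemLp (fun x => (V x)⁻) p (starMeasure 1)) {E : ℝ} (hE : E < 0) :
    weightBelow (eigenMult (formGraph (sobolevStarZero 1) V)) E
      ≤ weightBelow (eigenMult (formGraph (sobolevStarSubmodule 1) V)) E := by
  have key : 1 * weightBelow (eigenMult (formGraph (sobolevStarZero 1) V)) E
      ≤ weightBelow (eigenMult (formGraph (sobolevStarSubmodule 1) V)) E := by
    refine mul_weightBelow_le fun k hk => ?_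
    obtain ⟨ι, _, w, e, hcard, ho, hw⟩ := exists_orthonormal_eigenLift _ _ k hk
    -- Dirichlet eigenvectors serve as trial vectors in the larger Neumann form domain, where the
    -- form is the same.
    refine le_trans ?_ (card_le_weightBelow
      (isClosed_formGraph (isClosed_sobolevStar zero_lt_one) V)
      (isCoerciveBelow_star hp1 hp hV hE) w
      (fun i => ⟨(hw i).2.1.1, sobolevStarZero_le (hw i).2.1.2⟩)
      (fun a ha => fst_sum_ne_zero_of_orthonormal ho ha) fun a => ?_)
    · rw [one_mul]; exact_mod_cast hcard
    · rw [shiftedForm_sum_eigenLift ho (fun i => (hw i).2)]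
      exact Finset.sum_nonpos fun i _ =>
        mul_nonpos_of_nonpos_of_nonneg (by linarith [(hw i).1]) (sq_nonneg _)
  rwa [one_mul] at key

/-- The trace for a radial potential is controlled by the one for its even extension. -/
lemma two_mul_negTrace_star_le {N : ℕ} (hN : 2 ≤ N) {V : Fin N × ℝ → ℝ}
    (hV : IsAdmissiblePotential (starMeasure N) V) {f : ℝ → ℝ}
    (hVf : ∀ j x, 0 < x → V (j, x) = f x) {j : Fin N} (hj : ∀ x, V (j, x) = f x)
    {γ : ℝ} (hγ : 0 < γ) :
    2 * negTrace (sobolevStar N) V γ ≤ N * negTrace sobolevLine (fun x => f |x|) γ := by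
  have hW : IsAdmissiblePotential volume fun x : ℝ => f |x| := by
    simpa only [hj] using isAdmissiblePotential_comp_abs hV j
  have hVm := hV.aemeasurable
  have hWm := hW.aemeasurable
  obtain ⟨⟨p, hp1, hp, hpV⟩, -⟩ := hV
  obtain ⟨⟨q, hq1, hq, hqW⟩, -⟩ := hW
  have hp1V : MemLp (fun x => (halfProfile f x)⁻) p (starMeasure 1) := by
    have := (isTransfer_edgePull j).memLp hpV
    simpa [Function.comp_def, hj, halfProfile] using this
  have e1 := negTrace_eq_tsum_eigenMult (D := sobolevStarSubmodule N) hVm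
    (fun u hu => integrable_negPart_mul_sq_star hp1 hp hpV hu) γ
  have e2 := negTrace_eq_tsum_eigenMult (D := sobolevLineSubmodule) hWm
    (fun u hu => integrable_negPart_mul_sq_line hq1 hq hqW hu) γ
  change negTrace (sobolevStar N) V γ = _ at e1
  change negTrace sobolevLine (fun x => f |x|) γ = _ at e2
  rw [e1, e2]
  set mN := eigenMult (formGraph (sobolevStarSubmodule 1) (halfProfile f)) with hmN
  set mD := eigenMult (formGraph (sobolevStarZero 1) (halfProfile f)) with hmD
  set tN := ∑' E : Iio (0 : ℝ), (mN E : ℝ≥0∞) * ENNReal.ofReal (|(E : ℝ)| ^ γ) with htN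
  set tD := ∑' E : Iio (0 : ℝ), (mD E : ℝ≥0∞) * ENNReal.ofReal (|(E : ℝ)| ^ γ) with htD
  have hDN : tD ≤ tN := by
    -- Multiplicities cannot be compared level by level; the counting functions can, and the layer
    -- cake formula turns this into an inequality of traces.
    rw [htN, htD, tsum_abs_rpow_eq_lintegral _ hγ, tsum_abs_rpow_eq_lintegral _ hγ]
    refine setLIntegral_mono' measurableSet_Ioi fun s hs => ?_
    exact weightBelow_dirichlet_le_neumann hp1 hp hp1V (neg_lt_zero.2 (Real.rpow_pos_of_pos hs _))
  have hstar : ∑' E : Iio (0 : ℝ), (eigenMult (formGraph (sobolevStarSubmodule N) V) E : ℝ≥0∞)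
      * ENNReal.ofReal (|(E : ℝ)| ^ γ) ≤ tN + (N - 1 : ℕ) * tD := by
    rw [htN, htD, ← ENNReal.tsum_mul_left, ← ENNReal.tsum_add]
    refine ENNReal.tsum_le_tsum fun E => ?_
    rw [← mul_assoc, ← add_mul]
    gcongr
    have := ENat.toENNReal_le.2 (eigenMult_star_le (by omega : 0 < N) hVf E)
    simpa using this
  have hline : tN + tD ≤ ∑' E : Iio (0 : ℝ),
      (eigenMult (formGraph sobolevLineSubmodule fun x => f |x|) E : ℝ≥0∞)
        * ENNReal.ofReal (|(E : ℝ)| ^ γ) := by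
    rw [htN, htD, ← ENNReal.tsum_add]
    refine ENNReal.tsum_le_tsum fun E => ?_
    rw [← add_mul]
    gcongr
    have := ENat.toENNReal_le.2 (eigenMult_line_ge f E)
    simpa using this
  refine (mul_le_mul_right hstar 2).trans (le_trans ?_ (mul_le_mul_right hline (N : ℝ≥0∞)))
  -- With N = M + 2 the comparison only exchanges M copies of tD for tN, so no subtraction is needed
  -- even when the traces are infinite.
  obtain ⟨M, rfl⟩ : ∃ M, N = M + 2 := ⟨N - 2, by omega⟩
  have h1 : (M + 2 - 1 : ℕ) = M + 1 := by omega
  rw [h1]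
  push_cast
  calc 2 * (tN + ((M : ℝ≥0∞) + 1) * tD) = (2 * tN + (M + 2) * tD) + M * tD := by ring
    _ ≤ (2 * tN + (M + 2) * tD) + M * tN := by gcongr
    _ = (M + 2) * (tN + tD) := by ring

/-- A constant which is valid on the line is valid on the star graph. -/
theorem star_bound_of_line_bound {N : ℕ} (hN : 2 ≤ N) {γ : ℝ} (hγ : 0 < γ) {C : ℝ≥0∞}
    (hC : ∀ V : ℝ → ℝ, IsAdmissiblePotential volume V → True →
      negTrace sobolevLine V γ ≤ C * ∫⁻ x, ENNReal.ofReal ((V x)⁻ ^ (γ + 1 / 2)))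
    {V : Fin N × ℝ → ℝ} (hV : IsAdmissiblePotential (starMeasure N) V) (hr : IsRadial V) :
    negTrace (sobolevStar N) V γ
      ≤ C * ∫⁻ x, ENNReal.ofReal ((V x)⁻ ^ (γ + 1 / 2)) ∂(starMeasure N) := by
  set j : Fin N := ⟨0, by omega⟩
  set f : ℝ → ℝ := fun x => V (j, x)
  have hVf : ∀ i x, 0 < x → V (i, x) = f x := fun i x => hr i j x
  have h1 := two_mul_negTrace_star_le hN hV hVf (j := j) (fun _ => rfl) hγ
  have h2 := hC (fun x => f |x|) (isAdmissiblePotential_comp_abs hV j) trivial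
  rw [lintegral_comp_abs_eq fun x => ENNReal.ofReal ((f x)⁻ ^ (γ + 1 / 2))] at h2
  set I := ∫⁻ x in Ioi (0 : ℝ), ENNReal.ofReal ((f x)⁻ ^ (γ + 1 / 2)) with hI
  have h3 : ∫⁻ x, ENNReal.ofReal ((V x)⁻ ^ (γ + 1 / 2)) ∂(starMeasure N) = N * I := by
    rw [lintegral_starMeasure]
    have : ∀ i : Fin N, ∫⁻ x in Ioi (0 : ℝ), ENNReal.ofReal ((V (i, x))⁻ ^ (γ + 1 / 2)) = I :=
      fun i => setLIntegral_congr_fun measurableSet_Ioi fun x hx => by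
        rw [hVf i x hx]
    simp only [this, Finset.sum_const, Finset.card_univ, Fintype.card_fin, nsmul_eq_mul]
  rw [h3]
  -- The even extension has integral 2I and the radial potential N·I, which balances the factors N
  -- and 2 of the trace inequality.
  have h4 : 2 * negTrace (sobolevStar N) V γ ≤ 2 * (C * (N * I)) := by
    refine h1.trans ((mul_le_mul_right h2 _).trans_eq ?_)
    ring
  exact (ENNReal.mul_le_mul_iff_right two_ne_zero ENNReal.ofNat_ne_top).1 h4

end LineToStar

/-! ### Cutting off functions on the line -/

section Multiplication

variable {X : Type*} [MeasurableSpace X] {μ : Measure X}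

lemma memLp_mul_of_abs_le_one {b : X → ℝ} (hb : Measurable b) (hb1 : ∀ x, |b x| ≤ 1)
    (f : Lp ℂ 2 μ) : MemLp (fun x => (b x : ℂ) * f x) 2 μ := by
  refine (Lp.memLp f).mono ((Complex.measurable_ofReal.comp hb).aestronglyMeasurable.mul
    (Lp.aestronglyMeasurable f)) (Eventually.of_forall fun x => ?_)
  rw [norm_mul, Complex.norm_real, Real.norm_eq_abs]
  exact mul_le_of_le_one_left (norm_nonneg _) (hb1 x)

/-- Multiplication by a function bounded by `1`. -/
def mulLp {b : X → ℝ} (hb : Measurable b) (hb1 : ∀ x, |b x| ≤ 1) (f : Lp ℂ 2 μ) : Lp ℂ 2 μ :=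
  (memLp_mul_of_abs_le_one hb hb1 f).toLp _

lemma coeFn_mulLp {b : X → ℝ} (hb : Measurable b) (hb1 : ∀ x, |b x| ≤ 1) (f : Lp ℂ 2 μ) :
    mulLp hb hb1 f =ᵐ[μ] fun x => (b x : ℂ) * f x := MemLp.coeFn_toLp _

/-- Bounded pointwise convergence of the multipliers implies convergence in `L²`. -/
lemma tendsto_mulLp {b : ℕ → X → ℝ} (hb : ∀ n, Measurable (b n)) (hb1 : ∀ n x, |b n x| ≤ 1)
    {c : ℝ} (hc : |c| ≤ 1) (hbc : ∀ x, Tendsto (fun n => b n x) atTop (𝓝 c)) (f : Lp ℂ 2 μ) :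
    Tendsto (fun n => mulLp (hb n) (hb1 n) f) atTop (𝓝 ((c : ℂ) • f)) := by
  have hint : Integrable (fun x => ‖f x‖ ^ 2) μ :=
    (memLp_two_iff_integrable_sq_norm (Lp.aestronglyMeasurable f)).1 (Lp.memLp f)
  have h1 : ∀ n, ‖mulLp (hb n) (hb1 n) f - (c : ℂ) • f‖ ^ 2
      = ∫ x, (b n x - c) ^ 2 * ‖f x‖ ^ 2 ∂μ := by
    intro n
    rw [← norm_sq_eq_integral]
    refine integral_congr_ae ?_
    filter_upwards [Lp.coeFn_sub (mulLp (hb n) (hb1 n) f) ((c : ℂ) • f), Lp.coeFn_smul (c : ℂ) f,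
      coeFn_mulLp (hb n) (hb1 n) f] with x e1 e2 e3
    rw [e1, Pi.sub_apply, e2, e3, Pi.smul_apply, smul_eq_mul, ← sub_mul, ← Complex.ofReal_sub,
      norm_mul, mul_pow, Complex.norm_real, Real.norm_eq_abs, sq_abs]
  have h2 : Tendsto (fun n => ∫ x, (b n x - c) ^ 2 * ‖f x‖ ^ 2 ∂μ) atTop (𝓝 (∫ _, (0 : ℝ) ∂μ)) := by
    refine tendsto_integral_of_dominated_convergence (fun x => 4 * ‖f x‖ ^ 2) (fun n => ?_)
      (hint.const_mul 4) (fun n => Eventually.of_forall fun x => ?_)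
      (Eventually.of_forall fun x => ?_)
    · exact ((((hb n).sub_const c).pow_const 2).aestronglyMeasurable).mul
        ((Lp.aestronglyMeasurable f).norm.pow 2)
    · rw [Real.norm_of_nonneg (by positivity)]
      have h3 : (b n x - c) ^ 2 ≤ 4 := by
        have := abs_le.1 (hb1 n x)
        have := abs_le.1 hc
        nlinarith
      gcongr
    · have := (((hbc x).sub_const c).pow 2).mul_const (‖f x‖ ^ 2)
      simpa using this
  simp only [integral_zero, ← h1] at h2
  rw [tendsto_iff_norm_sub_tendsto_zero]
  have h4 := h2.sqrt
  simpa [Real.sqrt_sq (norm_nonneg _)] using h4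

end Multiplication

/-! ### Linear cutoffs and the product rule -/

section Cutoff

/-- The cutoff function which vanishes left of `-n` and equals `1` right of `-n + 1`. -/
def cutoff (n : ℕ) (x : ℝ) : ℝ := min 1 (max 0 (x + n))

/-- The derivative of the cutoff function. -/
def cutoffDeriv (n : ℕ) (x : ℝ) : ℝ := (Ioc (-(n : ℝ)) (-n + 1)).indicator (fun _ => 1) x

lemma measurable_cutoff (n : ℕ) : Measurable (cutoff n) := by unfold cutoff; fun_prop

lemma measurable_cutoffDeriv (n : ℕ) : Measurable (cutoffDeriv n) :=
  measurable_const.indicator measurableSet_Ioc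

lemma abs_cutoff_le (n : ℕ) (x : ℝ) : |cutoff n x| ≤ 1 := by
  rw [cutoff, abs_of_nonneg (le_min zero_le_one (le_max_left _ _))]
  exact min_le_left _ _

lemma abs_cutoffDeriv_le (n : ℕ) (x : ℝ) : |cutoffDeriv n x| ≤ 1 := by
  unfold cutoffDeriv indicator; split_ifs <;> simp

lemma cutoff_of_le {n : ℕ} {x : ℝ} (h : x ≤ -n) : cutoff n x = 0 := by
  rw [cutoff, max_eq_left (by linarith)]; simp

lemma cutoff_of_ge {n : ℕ} {x : ℝ} (h : -n + 1 ≤ x) : cutoff n x = 1 := by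
  rw [cutoff, min_eq_left]
  exact le_max_of_le_right (by linarith)

lemma cutoff_of_mem {n : ℕ} {x : ℝ} (h : x ∈ Icc (-(n : ℝ)) (-n + 1)) : cutoff n x = x + n := by
  rw [cutoff, max_eq_right (by linarith [h.1]), min_eq_right (by linarith [h.2])]

lemma cutoffDeriv_of_le {n : ℕ} {x : ℝ} (h : x ≤ -n) : cutoffDeriv n x = 0 :=
  indicator_of_notMem (fun h' => absurd h'.1 (not_lt.2 h)) _

lemma cutoffDeriv_of_gt {n : ℕ} {x : ℝ} (h : -n + 1 < x) : cutoffDeriv n x = 0 :=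
  indicator_of_notMem (fun h' => absurd h'.2 (not_le.2 h)) _

lemma tendsto_cutoff (x : ℝ) : Tendsto (fun n => cutoff n x) atTop (𝓝 1) := by
  refine tendsto_const_nhds.congr' ?_
  filter_upwards [eventually_ge_atTop ⌈1 - x⌉₊] with n hn
  rw [cutoff_of_ge]
  have := Nat.ceil_le.1 hn
  linarith

lemma tendsto_cutoffDeriv (x : ℝ) : Tendsto (fun n => cutoffDeriv n x) atTop (𝓝 0) := by
  refine tendsto_const_nhds.congr' ?_
  filter_upwards [eventually_gt_atTop ⌈1 - x⌉₊] with n hn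
  rw [cutoffDeriv_of_gt]
  have := Nat.lt_of_ceil_lt hn
  linarith

/-- Fubini's theorem on a triangle. -/
lemma integral_primitive {g : ℝ → ℂ} {a y : ℝ} (hay : a ≤ y)
    (hg : IntervalIntegrable g volume a y) :
    ∫ t in a..y, ∫ s in a..t, g s = ∫ s in a..y, ((y - s : ℝ) : ℂ) * g s := by
  have hg' : Integrable g (volume.restrict (Ioc a y)) :=
    (intervalIntegrable_iff_integrableOn_Ioc_of_le hay).1 hg
  set F : ℝ → ℝ → ℂ := fun t s => {p : ℝ × ℝ | p.2 ≤ p.1}.indicator (fun p => g p.2) (t, s) with hF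
  have hFi : Integrable (Function.uncurry F)
      ((volume.restrict (Ioc a y)).prod (volume.restrict (Ioc a y))) := by
    have := (hg'.comp_snd (volume.restrict (Ioc a y))).indicator
      (measurableSet_le measurable_snd measurable_fst)
    exact this
  have hswap := integral_integral_swap hFi
  rw [intervalIntegral.integral_of_le hay, intervalIntegral.integral_of_le hay]
  have h1 : ∫ t in Ioc a y, ∫ s in a..t, g s = ∫ t in Ioc a y, ∫ s in Ioc a y, F t s := by
    refine setIntegral_congr_fun measurableSet_Ioc fun t ht => ?_
    rw [intervalIntegral.integral_of_le ht.1.le, ← integral_indicator measurableSet_Ioc,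
      ← integral_indicator measurableSet_Ioc]
    refine integral_congr_ae (Eventually.of_forall fun s => ?_)
    by_cases hs : s ∈ Ioc a t
    · have h2 : s ∈ Ioc a y := ⟨hs.1, hs.2.trans ht.2⟩
      simp only [indicator_of_mem hs, indicator_of_mem h2, hF]
      rw [indicator_of_mem (show (t, s) ∈ {p : ℝ × ℝ | p.2 ≤ p.1} from hs.2)]
    · simp only [indicator_of_notMem hs]
      by_cases h2 : s ∈ Ioc a y
      · have h3 : (t, s) ∉ {p : ℝ × ℝ | p.2 ≤ p.1} := fun h => hs ⟨h2.1, h⟩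
        simp only [indicator_of_mem h2, hF, indicator_of_notMem h3]
      · rw [indicator_of_notMem h2]
  have h2 : ∫ s in Ioc a y, ∫ t in Ioc a y, F t s = ∫ s in Ioc a y, ((y - s : ℝ) : ℂ) * g s := by
    refine setIntegral_congr_fun measurableSet_Ioc fun s hs => ?_
    have h3 : ∫ t in Ioc a y, F t s = ∫ t in Icc s y, g s := by
      rw [← integral_indicator measurableSet_Ioc, ← integral_indicator measurableSet_Icc]
      refine integral_congr_ae (Eventually.of_forall fun t => ?_)
      by_cases ht : t ∈ Icc s y
      · have h4 : t ∈ Ioc a y := ⟨hs.1.trans_le ht.1, ht.2⟩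
        simp only [indicator_of_mem ht, indicator_of_mem h4, hF]
        rw [indicator_of_mem (show (t, s) ∈ {p : ℝ × ℝ | p.2 ≤ p.1} from ht.1)]
      · simp only [indicator_of_notMem ht]
        by_cases h4 : t ∈ Ioc a y
        · have h5 : (t, s) ∉ {p : ℝ × ℝ | p.2 ≤ p.1} := fun h => ht ⟨h, h4.2⟩
          simp only [indicator_of_mem h4, hF, indicator_of_notMem h5]
        · rw [indicator_of_notMem h4]
    simp only [h3, integral_const]
    simp [hs.2]
  rw [h1, hswap, h2]

/-- The product rule for the cutoff of an antiderivative. -/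
lemma cutoff_mul_eq_integral (n : ℕ) {g : ℝ → ℂ} (hg : ∀ a b, IntervalIntegrable g volume a b)
    (c : ℂ) {y : ℝ} (hy : -(n : ℝ) ≤ y) :
    (cutoff n y : ℂ) * (c + ∫ t in (0 : ℝ)..y, g t)
      = ∫ t in (-(n : ℝ))..y, ((cutoff n t : ℂ) * g t
        + (cutoffDeriv n t : ℂ) * (c + ∫ s in (0 : ℝ)..t, g s)) := by
  set a : ℝ := -(n : ℝ) with ha
  set Ψ : ℝ → ℂ := fun y => c + ∫ t in (0 : ℝ)..y, g t with hΨ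
  have hΨc : Continuous Ψ :=
    continuous_const.add (intervalIntegral.continuous_primitive hg 0)
  have hΨa : ∀ s t, Ψ t = Ψ s + ∫ s in s..t, g s := by
    intro s t
    simp only [hΨ]
    rw [add_assoc, intervalIntegral.integral_add_adjacent_intervals (hg 0 s) (hg s t)]
  have hii : ∀ s t, IntervalIntegrable (fun t => ((t + n : ℝ) : ℂ) * g t) volume s t := fun s t =>
    (hg s t).continuousOn_mul (by fun_prop)
  -- On the ramp the cutoff is t + n with slope 1. As g is only locally integrable, the product rule
  -- is obtained by exchanging the order of integration.
  have hleft : ∀ y ∈ Icc a (a + 1), (cutoff n y : ℂ) * Ψ y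
      = ∫ t in a..y, ((cutoff n t : ℂ) * g t + (cutoffDeriv n t : ℂ) * Ψ t) := by
    intro y hy
    have e1 : ∫ t in a..y, ((cutoff n t : ℂ) * g t + (cutoffDeriv n t : ℂ) * Ψ t)
        = ∫ t in a..y, (((t + n : ℝ) : ℂ) * g t + Ψ t) := by
      refine intervalIntegral.integral_congr_ae (Eventually.of_forall fun t ht => ?_)
      rw [uIoc_of_le hy.1] at ht
      have h2 : t ∈ Ioc a (a + 1) := ⟨ht.1, ht.2.trans hy.2⟩
      rw [cutoff_of_mem ⟨h2.1.le, h2.2⟩, cutoffDeriv, indicator_of_mem h2]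
      simp
    have e2 : ∫ t in a..y, Ψ t = ((y - a : ℝ) : ℂ) * Ψ a
        + ∫ s in a..y, ((y - s : ℝ) : ℂ) * g s := by
      rw [← integral_primitive hy.1 (hg a y)]
      have : ∀ t, Ψ t = Ψ a + ∫ s in a..t, g s := hΨa a
      rw [intervalIntegral.integral_congr (g := fun t => Ψ a + ∫ s in a..t, g s)
        (fun t _ => this t), intervalIntegral.integral_add (by simp)
        ((intervalIntegral.continuous_primitive hg a).intervalIntegrable _ _)]
      simp
    rw [e1, intervalIntegral.integral_add (hii a y) (hΨc.intervalIntegrable _ _), e2,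
      cutoff_of_mem hy, hΨa a y]
    -- The weights t + n and y - t add up to the constant y + n.
    have e3 : (∫ t in a..y, ((t + n : ℝ) : ℂ) * g t) + ∫ s in a..y, ((y - s : ℝ) : ℂ) * g s
        = ((y + n : ℝ) : ℂ) * ∫ s in a..y, g s := by
      rw [← intervalIntegral.integral_add (hii a y) ((hg a y).continuousOn_mul (by fun_prop)),
        ← intervalIntegral.integral_const_mul]
      refine intervalIntegral.integral_congr fun t _ => ?_
      push_cast; ring
    have e4 : ((y - a : ℝ) : ℂ) = ((y + n : ℝ) : ℂ) := by rw [ha]; congr 1; ring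
    rw [e4]
    linear_combination -e3
  rcases le_or_gt y (a + 1) with h | h
  · exact hleft y ⟨hy, h⟩
  · have hb := hleft (a + 1) ⟨by linarith, le_rfl⟩
    have e1 : ∫ t in (a + 1)..y, ((cutoff n t : ℂ) * g t + (cutoffDeriv n t : ℂ) * Ψ t)
        = ∫ t in (a + 1)..y, g t := by
      refine intervalIntegral.integral_congr_ae (Eventually.of_forall fun t ht => ?_)
      rw [uIoc_of_le h.le] at ht
      rw [cutoff_of_ge ht.1.le, cutoffDeriv_of_gt ht.1]; simp
    have hint : ∀ s t, IntervalIntegrable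
        (fun t => (cutoff n t : ℂ) * g t + (cutoffDeriv n t : ℂ) * Ψ t) volume s t := by
      intro s t
      refine IntervalIntegrable.add ((hg s t).continuousOn_mul ?_) ?_
      · unfold cutoff; fun_prop
      · have h1 := hΨc.intervalIntegrable (μ := volume) s t
        rw [intervalIntegrable_iff] at h1 ⊢
        refine Integrable.mono h1 (((Complex.measurable_ofReal.comp
          (measurable_cutoffDeriv n)).aestronglyMeasurable).mul hΨc.aestronglyMeasurable)
          (Eventually.of_forall fun x => ?_)
        rw [norm_mul, Complex.norm_real, Real.norm_eq_abs]
        exact mul_le_of_le_one_left (norm_nonneg _) (abs_cutoffDeriv_le n x)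
    change (cutoff n y : ℂ) * Ψ y
      = ∫ t in a..y, ((cutoff n t : ℂ) * g t + (cutoffDeriv n t : ℂ) * Ψ t)
    rw [← intervalIntegral.integral_add_adjacent_intervals (hint a (a + 1)) (hint (a + 1) y), ← hb,
      e1, cutoff_of_ge h.le, cutoff_of_ge (le_refl (a + 1)), hΨa (a + 1) y]
    simp

/-- The cutoff of a vector of the form domain. -/
def cutoffQuad (n : ℕ) (w : Lp ℂ 2 (volume : Measure ℝ) × Lp ℂ 2 (volume : Measure ℝ) ×
      Lp ℂ 2 (volume : Measure ℝ) × Lp ℂ 2 (volume : Measure ℝ)) :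
    Lp ℂ 2 (volume : Measure ℝ) × Lp ℂ 2 (volume : Measure ℝ) ×
      Lp ℂ 2 (volume : Measure ℝ) × Lp ℂ 2 (volume : Measure ℝ) :=
  (mulLp (measurable_cutoff n) (abs_cutoff_le n) w.1,
    mulLp (measurable_cutoff n) (abs_cutoff_le n) w.2.1
      + mulLp (measurable_cutoffDeriv n) (abs_cutoffDeriv_le n) w.1,
    mulLp (measurable_cutoff n) (abs_cutoff_le n) w.2.2.1,
    mulLp (measurable_cutoff n) (abs_cutoff_le n) w.2.2.2)

lemma tendsto_cutoffQuad (w : Lp ℂ 2 (volume : Measure ℝ) × Lp ℂ 2 (volume : Measure ℝ) ×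
      Lp ℂ 2 (volume : Measure ℝ) × Lp ℂ 2 (volume : Measure ℝ)) :
    Tendsto (fun n => cutoffQuad n w) atTop (𝓝 w) := by
  have h1 : ∀ f : Lp ℂ 2 (volume : Measure ℝ), Tendsto
      (fun n => mulLp (measurable_cutoff n) (abs_cutoff_le n) f) atTop (𝓝 f) := by
    intro f
    simpa using tendsto_mulLp measurable_cutoff abs_cutoff_le (c := 1) (by simp) tendsto_cutoff f
  have h2 : Tendsto (fun n => mulLp (measurable_cutoffDeriv n) (abs_cutoffDeriv_le n) w.1) atTop
      (𝓝 0) := by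
    simpa using tendsto_mulLp measurable_cutoffDeriv abs_cutoffDeriv_le (c := 0) (by simp)
      tendsto_cutoffDeriv w.1
  have h3 := (h1 w.2.1).add h2
  rw [add_zero] at h3
  exact (h1 _).prodMk_nhds (h3.prodMk_nhds ((h1 _).prodMk_nhds (h1 _)))

lemma cutoffQuad_mem_potentialGraph (n : ℕ) {V : ℝ → ℝ}
    {w : Lp ℂ 2 (volume : Measure ℝ) × Lp ℂ 2 (volume : Measure ℝ) ×
      Lp ℂ 2 (volume : Measure ℝ) × Lp ℂ 2 (volume : Measure ℝ)}
    (hw : w ∈ potentialGraph volume V) : cutoffQuad n w ∈ potentialGraph volume V := by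
  constructor
  · filter_upwards [coeFn_mulLp (measurable_cutoff n) (abs_cutoff_le n) w.1,
      coeFn_mulLp (measurable_cutoff n) (abs_cutoff_le n) w.2.2.1, hw.1] with x h1 h2 h3
    simp only [cutoffQuad, h1, h2, h3]; ring
  · filter_upwards [coeFn_mulLp (measurable_cutoff n) (abs_cutoff_le n) w.1,
      coeFn_mulLp (measurable_cutoff n) (abs_cutoff_le n) w.2.2.2, hw.2] with x h1 h2 h3
    simp only [cutoffQuad, h1, h2, h3]; ring

/-- The functions on the line which vanish left of `-n`. -/
def vanishLeft (n : ℕ) : Submodule ℂ (Lp ℂ 2 (volume : Measure ℝ)) where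
  carrier := {f | ∀ᵐ x : ℝ, x ≤ -n → f x = 0}
  add_mem' := by
    intro f g hf hg
    filter_upwards [hf, hg, Lp.coeFn_add f g] with x h1 h2 h3 hx
    rw [h3, Pi.add_apply, h1 hx, h2 hx, add_zero]
  zero_mem' := by
    filter_upwards [Lp.coeFn_zero ℂ 2 (volume : Measure ℝ)] with x h1 _
    rw [h1]; rfl
  smul_mem' := by
    intro c f hf
    filter_upwards [hf, Lp.coeFn_smul c f] with x h1 h3 hx
    rw [h3, Pi.smul_apply, h1 hx, smul_zero]

lemma cutoffQuad_mem_vanishLeft (n : ℕ) (w : Lp ℂ 2 (volume : Measure ℝ) ×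
      Lp ℂ 2 (volume : Measure ℝ) × Lp ℂ 2 (volume : Measure ℝ) × Lp ℂ 2 (volume : Measure ℝ)) :
    cutoffQuad n w ∈ (vanishLeft n).prod ((vanishLeft n).prod
      ((vanishLeft n).prod (vanishLeft n))) := by
  have h1 : ∀ f : Lp ℂ 2 (volume : Measure ℝ),
      mulLp (measurable_cutoff n) (abs_cutoff_le n) f ∈ vanishLeft n := by
    intro f
    filter_upwards [coeFn_mulLp (measurable_cutoff n) (abs_cutoff_le n) f] with x h hx
    rw [h, cutoff_of_le hx]; simp
  have h2 : ∀ f : Lp ℂ 2 (volume : Measure ℝ),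
      mulLp (measurable_cutoffDeriv n) (abs_cutoffDeriv_le n) f ∈ vanishLeft n := by
    intro f
    filter_upwards [coeFn_mulLp (measurable_cutoffDeriv n) (abs_cutoffDeriv_le n) f] with x h hx
    rw [h, cutoffDeriv_of_le hx]; simp
  exact ⟨h1 _, (vanishLeft n).add_mem (h1 _) (h2 _), h1 _, h1 _⟩

end Cutoff

/-! ### The constant on the star graph bounds the constant on the line -/

section Translation

variable {N : ℕ}

lemma isTransfer_translate (n : ℕ) (j : Fin N) :
    IsTransfer (fun q : Fin N × ℝ => q.2 - n) ({j} ×ˢ univ) (starMeasure N) volume where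
  measurable := by fun_prop
  measurableSet := (measurableSet_singleton j).prod MeasurableSet.univ
  map_le := by
    have h1 : (fun q : Fin N × ℝ => q.2 - (n : ℝ))
        = (fun q : Fin 1 × ℝ => q.2 - (n : ℝ)) ∘ fun q : Fin N × ℝ => ((0 : Fin 1), q.2) := rfl
    rw [h1, ← Measure.map_map (by fun_prop) (by fun_prop), map_edgePush, starMeasure_eq_sum 1,
      Fin.sum_univ_one, Measure.map_map (by fun_prop) measurable_prodMk_left]
    exact (Measure.map_mono Measure.restrict_le_self (by fun_prop)).trans
      (measurePreserving_sub_right volume (n : ℝ)).map_eq.le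

/-- Translation by `n` to the right, followed by restriction to the half-line, which is identified
with the edge `j`. -/
def translateLp (n : ℕ) (j : Fin N) :
    Lp ℂ 2 (volume : Measure ℝ) →ₗ[ℂ] Lp ℂ 2 (starMeasure N) :=
  transferLp (isTransfer_translate n j)

lemma ae_translateLp (n : ℕ) (i j : Fin N) (f : Lp ℂ 2 (volume : Measure ℝ)) :
    ∀ᵐ x ∂(volume.restrict (Ioi (0 : ℝ))),
      translateLp n j f (i, x) = if i = j then f (x - n) else 0 := by
  have := ae_starMeasure_iff.1 (coeFn_transferLp (isTransfer_translate n j) f) i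
  filter_upwards [this] with x hx
  rw [translateLp, hx]; simp [indicator]

lemma ae_comp_sub {p : ℝ → Prop} (h : ∀ᵐ x : ℝ, p x) (n : ℝ) : ∀ᵐ x : ℝ, p (x - n) :=
  (measurePreserving_sub_right volume n).quasiMeasurePreserving.ae h

/-- Restricting the translate to the half-line loses nothing where f vanishes left of -n, so only
one argument needs this support; distinct edges are disjoint. -/
lemma inner_translateLp (n : ℕ) (i j : Fin N) {f : Lp ℂ 2 (volume : Measure ℝ)}
    (hf : f ∈ vanishLeft n) (g : Lp ℂ 2 (volume : Measure ℝ)) :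
    inner ℂ (translateLp n i f) (translateLp n j g) = if i = j then inner ℂ f g else 0 := by
  have h1 : ∀ k : Fin N, ∫ x in Ioi (0 : ℝ), inner ℂ (translateLp n i f (k, x))
      (translateLp n j g (k, x)) = if k = i ∧ i = j then inner ℂ f g else 0 := by
    intro k
    split_ifs with h
    · obtain ⟨rfl, rfl⟩ := h
      rw [L2.inner_def, ← integral_sub_right_eq_self (fun x => inner ℂ (f x) (g x)) (n : ℝ),
        ← integral_indicator measurableSet_Ioi]
      have h2 := (ae_restrict_iff' measurableSet_Ioi).1 (ae_translateLp n k k f)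
      have h3 := (ae_restrict_iff' measurableSet_Ioi).1 (ae_translateLp n k k g)
      refine integral_congr_ae ?_
      filter_upwards [h2, h3, ae_comp_sub hf n] with x e2 e3 e4
      by_cases hx : x ∈ Ioi (0 : ℝ)
      · rw [indicator_of_mem hx, e2 hx, e3 hx, if_pos rfl, if_pos rfl]
      · rw [indicator_of_notMem hx, e4 (by rw [mem_Ioi] at hx; linarith), inner_zero_left]
    · rw [← integral_zero ℝ ℂ]
      refine integral_congr_ae ?_
      filter_upwards [ae_translateLp n k i f, ae_translateLp n k j g] with x e2 e3
      rw [e2, e3]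
      by_cases hk : k = i
      · rw [if_neg (c := k = j) fun h' => h ⟨hk, hk.symm.trans h'⟩, inner_zero_right]
      · rw [if_neg hk, inner_zero_left]
  rw [L2.inner_def, integral_starMeasure (L2.integrable_inner _ _)]
  simp only [h1, ite_and, Finset.sum_ite_eq', Finset.mem_univ, if_true]

/-- Translates on different edges are orthogonal with respect to the form. -/
lemma shiftedForm_sum_translate (n : ℕ) (E : ℝ)
    {z : Fin N → Lp ℂ 2 (volume : Measure ℝ) × Lp ℂ 2 (volume : Measure ℝ) ×
      Lp ℂ 2 (volume : Measure ℝ) × Lp ℂ 2 (volume : Measure ℝ)}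
    (hz : ∀ j, z j ∈ (vanishLeft n).prod ((vanishLeft n).prod
      ((vanishLeft n).prod (vanishLeft n)))) :
    shiftedForm _ E (∑ j, quadMap 1 (translateLp n j) (z j))
      (∑ j, quadMap 1 (translateLp n j) (z j)) = ∑ j, shiftedForm _ E (z j) (z j) := by
  have h1 : ∀ i j, shiftedForm _ E (quadMap 1 (translateLp n i) (z i))
      (quadMap 1 (translateLp n j) (z j)) = if i = j then shiftedForm _ E (z i) (z j) else 0 := by
    intro i j
    obtain ⟨h1, h2, h3, h4⟩ := hz i
    simp only [shiftedForm_apply, quadMap_apply, Complex.ofReal_one, one_smul,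
      inner_translateLp n i j h1, inner_translateLp n i j h2, inner_translateLp n i j h3,
      inner_translateLp n i j h4]
    split_ifs <;> simp
  simp only [map_sum, LinearMap.sum_apply, h1, Finset.sum_ite_eq', Finset.mem_univ, if_true]

/-- The cutoff vanishes at -n, which is moved to the vertex. The vertex value is thus 0, and
extension by zero to the other edges stays in H¹. -/
lemma translate_cutoffQuad_mem_formGraph (n : ℕ) (j : Fin N) {V : ℝ → ℝ}
    {w : Lp ℂ 2 (volume : Measure ℝ) × Lp ℂ 2 (volume : Measure ℝ) ×
      Lp ℂ 2 (volume : Measure ℝ) × Lp ℂ 2 (volume : Measure ℝ)}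
    (hw : w ∈ formGraph sobolevLineSubmodule V) :
    quadMap 1 (translateLp n j) (cutoffQuad n w)
      ∈ formGraph (sobolevStarSubmodule N) (fun q => V (q.2 - n)) := by
  have hpot := quadMap_transferLp_mem_potentialGraph (isTransfer_translate n j) (V := V)
    (W := fun q => V (q.2 - n)) (Eventually.of_forall fun _ _ => rfl) 1
    (cutoffQuad_mem_potentialGraph n hw.1)
  refine mem_formGraph.2 ⟨hpot, 0, fun i => ?_⟩
  obtain ⟨c, hc⟩ := hw.2
  replace hc : ∀ᵐ x : ℝ, w.1 x = c + ∫ t in (0 : ℝ)..x, w.2.1 t := hc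
  have hmul := coeFn_mulLp (measurable_cutoff n) (abs_cutoff_le n) w.1
  have hd : ∀ᵐ t : ℝ, (cutoffQuad n w).2.1 t = (cutoff n t : ℂ) * w.2.1 t
      + (cutoffDeriv n t : ℂ) * (c + ∫ s in (0 : ℝ)..t, w.2.1 s) := by
    filter_upwards [Lp.coeFn_add (mulLp (measurable_cutoff n) (abs_cutoff_le n) w.2.1)
      (mulLp (measurable_cutoffDeriv n) (abs_cutoffDeriv_le n) w.1),
      coeFn_mulLp (measurable_cutoff n) (abs_cutoff_le n) w.2.1,
      coeFn_mulLp (measurable_cutoffDeriv n) (abs_cutoffDeriv_le n) w.1, hc] with t e1 e2 e3 e4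
    rw [cutoffQuad, e1, Pi.add_apply, e2, e3, e4]
  have h2 := (ae_restrict_iff' measurableSet_Ioi).1 (ae_translateLp n i j (cutoffQuad n w).2.1)
  filter_upwards [ae_translateLp n i j (cutoffQuad n w).1, ae_restrict_of_ae (ae_comp_sub hc n),
    ae_restrict_of_ae (ae_comp_sub hmul n), ae_restrict_mem measurableSet_Ioi] with x e1 e2 e3 hx
  have hx : 0 < x := hx
  simp only [quadMap_apply, Complex.ofReal_one, one_smul]
  have h3 : ∫ t in (0 : ℝ)..x, translateLp n j (cutoffQuad n w).2.1 (i, t)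
      = ∫ t in (0 : ℝ)..x, if i = j then ((cutoff n (t - n) : ℂ) * w.2.1 (t - n)
        + (cutoffDeriv n (t - n) : ℂ) * (c + ∫ s in (0 : ℝ)..(t - n), w.2.1 s)) else 0 := by
    refine intervalIntegral.integral_congr_ae ?_
    filter_upwards [h2, ae_comp_sub hd n] with t e4 e5 ht
    rw [uIoc_of_le hx.le] at ht
    rw [e4 ht.1, e5]
  rw [h3, e1, zero_add]
  split_ifs with hij
  · rw [intervalIntegral.integral_comp_sub_right (fun t => (cutoff n t : ℂ) * w.2.1 t
        + (cutoffDeriv n t : ℂ) * (c + ∫ s in (0 : ℝ)..t, w.2.1 s)), zero_sub,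
      ← cutoff_mul_eq_integral n (intervalIntegrable_of_Lp w.2.1) c (by linarith), ← e2]
    exact e3
  · simp

end Translation

/-! ### From the star graph to the line -/

section StarToLine

variable {N : ℕ}

lemma memLp_translate {F : Type*} [NormedAddCommGroup F] {g : ℝ → F} {p : ℝ≥0∞}
    (hg : MemLp g p volume) (n : ℝ) :
    MemLp (fun q : Fin N × ℝ => g (q.2 - n)) p (starMeasure N) :=
  ((hg.comp_measurePreserving (measurePreserving_sub_right volume n)).restrict (Ioi 0)).comp_snd
    Measure.count

lemma isAdmissiblePotential_translate {V : ℝ → ℝ} (hV : IsAdmissiblePotential volume V) (n : ℝ) :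
    IsAdmissiblePotential (starMeasure N) fun q => V (q.2 - n) := by
  obtain ⟨⟨p, hp1, hp, hpV⟩, hloc⟩ := hV
  refine ⟨⟨p, hp1, hp, memLp_translate hpV n⟩, ?_⟩
  rw [locallyIntegrable_iff]
  intro K hK
  have hK' : IsCompact ((fun q : Fin N × ℝ => q.2 - n) '' K) := hK.image (by fun_prop)
  have h1 := memLp_one_iff_integrable.1 (memLp_translate (N := N) (memLp_one_iff_integrable.2
    ((integrable_indicator_iff hK'.measurableSet).2 (hloc.integrableOn_isCompact hK'))) n)
  refine (h1.integrableOn (s := K)).congr_fun (fun q hq => ?_) hK.measurableSet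
  exact indicator_of_mem (mem_image_of_mem (fun q : Fin N × ℝ => q.2 - n) hq) _

/-- Eigenfunctions on the line give trial functions on each edge of the star graph. -/
lemma eventually_mul_le_weightBelow_star (hN : 0 < N) {V : ℝ → ℝ}
    (hV : IsAdmissiblePotential volume V) {E E' : ℝ} (hE : E < E') (hE' : E' < 0) {k : ℕ}
    (hk : (k : ℝ≥0∞) ≤ weightBelow (eigenMult (formGraph sobolevLineSubmodule V)) E) :
    ∀ᶠ n : ℕ in atTop, (N : ℝ≥0∞) * k ≤ weightBelow
      (eigenMult (formGraph (sobolevStarSubmodule N) fun q => V (q.2 - n))) E' := by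
  obtain ⟨ι, _, w, e, hcard, ho, hw⟩ := exists_orthonormal_eigenLift _ _ k hk
  -- Raising the level from E to E' makes the form strictly negative on the trial space, which then
  -- survives the cutoff for large n.
  have hneg : ∀ a : ι → ℂ, a ≠ 0 →
      (shiftedForm _ E' (∑ i, a i • w i) (∑ i, a i • w i)).re < 0 := by
    intro a ha
    rw [shiftedForm_sum_eigenLift ho (fun i => (hw i).2)]
    obtain ⟨i, hi⟩ := Function.ne_iff.1 ha
    refine Finset.sum_neg' (fun i _ => mul_nonpos_of_nonpos_of_nonneg (by linarith [(hw i).1])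
      (sq_nonneg _)) ⟨i, Finset.mem_univ i, mul_neg_of_neg_of_pos (by linarith [(hw i).1]) ?_⟩
    exact pow_pos (norm_pos_iff.2 hi) 2
  filter_upwards [eventually_shiftedForm_neg hneg fun i => tendsto_cutoffQuad (w i)] with n hn
  obtain ⟨⟨p, hp1, hp, hpV⟩, -⟩ := hV
  have hcoer := isCoerciveBelow_star (N := N) hp1 hp (memLp_translate hpV n) hE'
  set W : Fin N × ι → _ := fun q => quadMap 1 (translateLp n q.1) (cutoffQuad n (w q.2)) with hW
  have hWmem : ∀ q, W q ∈ formGraph (sobolevStarSubmodule N) (fun q => V (q.2 - n)) :=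
    fun q => translate_cutoffQuad_mem_formGraph n q.1 (hw q.2).2.1
  -- Copies on different edges do not interact, so the form splits into N blocks, each governed by
  -- the same cut-off trial space.
  have hform : ∀ a : Fin N × ι → ℂ, shiftedForm _ E' (∑ q, a q • W q) (∑ q, a q • W q)
      = ∑ j, shiftedForm _ E' (∑ i, a (j, i) • cutoffQuad n (w i))
        (∑ i, a (j, i) • cutoffQuad n (w i)) := by
    intro a
    rw [← shiftedForm_sum_translate n E' fun j => Submodule.sum_mem _ fun i _ =>
      Submodule.smul_mem _ _ (cutoffQuad_mem_vanishLeft n (w i))]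
    simp only [Fintype.sum_prod_type, map_sum, map_smul, hW]
  have hnonpos : ∀ a : ι → ℂ, (shiftedForm _ E' (∑ i, a i • cutoffQuad n (w i))
      (∑ i, a i • cutoffQuad n (w i))).re ≤ 0 := by
    intro a
    by_cases ha : a = 0
    · simp [ha]
    · exact (hn a ha).le
  refine le_trans ?_ (card_le_weightBelow (isClosed_formGraph (isClosed_sobolevStar hN) _) hcoer W
    hWmem (fun a ha => ?_) fun a => ?_)
  · rw [Fintype.card_prod, Fintype.card_fin, Nat.cast_mul]
    gcongr
  · refine hcoer.fst_ne_zero (Submodule.sum_mem _ fun q _ => Submodule.smul_mem _ _ (hWmem q)) ?_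
    rw [hform, Complex.re_sum]
    obtain ⟨q, hq⟩ := Function.ne_iff.1 ha
    exact Finset.sum_neg' (fun j _ => hnonpos fun i => a (j, i)) ⟨q.1, Finset.mem_univ _,
      hn (fun i => a (q.1, i)) fun h => hq (congrFun h q.2)⟩
  · rw [hform, Complex.re_sum]
    exact Finset.sum_nonpos fun j _ => hnonpos fun i => a (j, i)

/-- A constant which is valid on the star graph is valid on the line. -/
theorem line_bound_of_star_bound (hN : 0 < N) {γ : ℝ} (hγ : 0 < γ) {C : ℝ≥0∞}
    (hC : ∀ V : Fin N × ℝ → ℝ, IsAdmissiblePotential (starMeasure N) V → IsRadial V →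
      negTrace (sobolevStar N) V γ
        ≤ C * ∫⁻ x, ENNReal.ofReal ((V x)⁻ ^ (γ + 1 / 2)) ∂(starMeasure N))
    {V : ℝ → ℝ} (hV : IsAdmissiblePotential volume V) :
    negTrace sobolevLine V γ ≤ C * ∫⁻ x, ENNReal.ofReal ((V x)⁻ ^ (γ + 1 / 2)) := by
  set I := ∫⁻ x : ℝ, ENNReal.ofReal ((V x)⁻ ^ (γ + 1 / 2)) with hI
  obtain ⟨⟨p, hp1, hp, hpV⟩, -⟩ := id hV
  have e1 := negTrace_eq_tsum_eigenMult (D := sobolevLineSubmodule) hV.aemeasurable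
    (fun u hu => integrable_negPart_mul_sq_line hp1 hp hpV hu) γ
  change negTrace sobolevLine V γ = _ at e1
  set m := eigenMult (formGraph sobolevLineSubmodule V) with hm
  set M : ℕ → ℝ → ℕ∞ := fun n =>
    eigenMult (formGraph (sobolevStarSubmodule N) fun q => V (q.2 - n)) with hM
  have hstar : ∀ n : ℕ, ∫⁻ s in Ioi (0 : ℝ), weightBelow (M n) (-(s ^ (1 / γ))) ≤ C * (N * I) := by
    intro n
    have hadm := isAdmissiblePotential_translate (N := N) hV n
    have e2 := negTrace_eq_tsum_eigenMult (D := sobolevStarSubmodule N) hadm.aemeasurable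
      (fun u hu => integrable_negPart_mul_sq_star hp1 hp (memLp_translate hpV n) hu) γ
    rw [← tsum_abs_rpow_eq_lintegral _ hγ, ← e2]
    refine (hC _ hadm fun _ _ _ _ => rfl).trans ?_
    gcongr
    simp only [lintegral_starMeasure]
    rw [Finset.sum_const, Finset.card_univ, Fintype.card_fin, nsmul_eq_mul]
    gcongr
    refine (setLIntegral_le_lintegral _ _).trans_eq ?_
    exact lintegral_sub_right_eq_self (fun x => ENNReal.ofReal ((V x)⁻ ^ (γ + 1 / 2))) (n : ℝ)
  -- Shrinking the eigenvalues by t < 1 opens the gap between levels that the cutoff argument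
  -- consumes.
  have hscaled : ∀ t ∈ Ioo (0 : ℝ) 1,
      ENNReal.ofReal (t ^ γ) * negTrace sobolevLine V γ ≤ C * I := by
    intro t ht
    have h1 : ENNReal.ofReal (t ^ γ) * negTrace sobolevLine V γ
        = ∫⁻ s in Ioi (0 : ℝ), weightBelow m (-(s ^ (1 / γ)) / t) := by
      rw [← tsum_mul_abs_rpow_eq_lintegral m hγ ht.1, e1, ← ENNReal.tsum_mul_left]
      refine tsum_congr fun x => ?_
      rw [Real.mul_rpow ht.1.le (abs_nonneg _), ENNReal.ofReal_mul (Real.rpow_nonneg ht.1.le _)]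
      ring
    have hmeas : ∀ n, Measurable fun s : ℝ => weightBelow (M n) (-(s ^ (1 / γ))) := fun n =>
      (weightBelow_mono (M n)).measurable.comp (by fun_prop)
    -- The threshold for n depends on the level s and on k, so the pointwise bound holds for the
    -- lower limit only; Fatou's lemma then passes to the integral. The factor N cancels on both
    -- sides afterwards.
    have h2 : (N : ℝ≥0∞) * ∫⁻ s in Ioi (0 : ℝ), weightBelow m (-(s ^ (1 / γ)) / t)
        ≤ C * (N * I) := by
      rw [← lintegral_const_mul' _ _ (ENNReal.natCast_ne_top N)]
      calc ∫⁻ s in Ioi (0 : ℝ), N * weightBelow m (-(s ^ (1 / γ)) / t)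
          ≤ ∫⁻ s in Ioi (0 : ℝ), liminf (fun n => weightBelow (M n) (-(s ^ (1 / γ)))) atTop := by
            refine setLIntegral_mono' measurableSet_Ioi fun s hs =>
              mul_weightBelow_le fun k hk => ?_
            have hs' : 0 < s ^ (1 / γ) := Real.rpow_pos_of_pos hs _
            refine le_liminf_of_le (by isBoundedDefault)
              (eventually_mul_le_weightBelow_star hN hV ?_ (neg_lt_zero.2 hs') hk)
            rw [div_lt_iff₀ ht.1]
            nlinarith [ht.2]
        _ ≤ liminf (fun n => ∫⁻ s in Ioi (0 : ℝ), weightBelow (M n) (-(s ^ (1 / γ)))) atTop :=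
            lintegral_liminf_le hmeas
        _ ≤ C * (N * I) := by
            refine liminf_le_of_frequently_le' (Eventually.frequently (Eventually.of_forall hstar))
    rw [h1]
    refine (ENNReal.mul_le_mul_iff_right (by exact_mod_cast hN.ne') (ENNReal.natCast_ne_top N)).1
      (h2.trans_eq ?_)
    ring
  -- Letting t increase to 1 closes the gap; continuity of the product holds even if the trace is
  -- infinite, since the limit factor is nonzero.
  have hlim : Tendsto (fun t : ℝ => ENNReal.ofReal (t ^ γ) * negTrace sobolevLine V γ) (𝓝[<] 1)
      (𝓝 (ENNReal.ofReal (1 ^ γ) * negTrace sobolevLine V γ)) := by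
    refine ENNReal.Tendsto.mul_const ?_ (Or.inl (by simp))
    refine ENNReal.tendsto_ofReal (Tendsto.mono_left ?_ nhdsWithin_le_nhds)
    exact (Real.continuousAt_rpow_const 1 γ (Or.inl one_ne_zero)).tendsto
  rw [Real.one_rpow, ENNReal.ofReal_one, one_mul] at hlim
  refine le_of_tendsto hlim ?_
  filter_upwards [Ioo_mem_nhdsLT (zero_lt_one' ℝ)] with t ht using hscaled t ht

end StarToLine

end

/-! ### Equality of the two constants -/

theorem theorem2 (γ : ℝ) (hγ : 1 / 2 ≤ γ) (N : ℕ) (hN : 2 ≤ N) :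
    starRadialConst γ N = lineConst γ := by
  have hγ0 : 0 < γ := by linarith
  refine congrArg sInf (Set.ext fun C => ⟨fun hC V hV _ => ?_, fun hC V hV hr => ?_⟩)
  · exact line_bound_of_star_bound (by omega) hγ0 hC hV
  · exact star_bound_of_line_bound hN hγ0 hC hV hr
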